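/- **Reduced Hypergraph Dealternation Lemma.** Hypergraphs $H=(V(H),E(H))$ are finite, have non-empty edges and have no isolated vertices. $\mathrm{rank}(H)$ is the maximum size of an edge and $\Delta(H)$ the maximum number of edges containing a vertex. $H[U]$ is the hypergraph with vertex set $U\subseteq V(H)$ whose edges are the non-empty sets $e\cap U$, $e\in E(H)$. A width function $f$ assigns a non-negative real $f_H(U)$ to every hypergraph $H$ and every $U\subseteq V(H)$. Assume that $f$ is manageable, of which only the following is needed: (i) $f_H(U_1\cup U_2)=f_H(U_1)+f_H(U_2)$ whenever $U_1,U_2\subseteq V(H)$ are disjoint and no edge meets both; (ii) there is a function $\beta$ such that $f_H(U)\le k$ implies $|U|\le\beta(k,\mathrm{rank}(H))$ for all $k\geq 0$, $H$ and $U$; (iii) $f_{H_1}(U_1)=f_{H_2}(U_2)$ whenever $H_1[U_1]\cong H_2[U_2]$. A tree decomposition $\mathbf t=(T,\mathrm{bag})$ of $H$ is a finite rooted tree $T$ with sets $\mathrm{bag}(x)\subseteq V(H)$, $x\in V(T)$, such that each edge of $H$ is contained in a bag and, for each $v\in V(H)$, the nodes whose bags contain $v$ induce a connected subgraph of $T$.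 Put $\mathrm{tw}(\mathbf t)=\max_x|\mathrm{bag}(x)|-1$ (and $\mathrm{tw}(\mathbf t)=0$ if $V(H)=\emptyset$). The $f$-width of $\mathbf t$ is $\max_x f_H(\mathrm{bag}(x))$, and $f\text{-width}(H)$ is the minimum $f$-width of a tree decomposition of $H$. For a node $x$ with parent $p$ let $\mathrm{adh}(x)=\mathrm{bag}(x)\cap\mathrm{bag}(p)$ ($\emptyset$ for the root), $\mathrm{mrg}(x)=\mathrm{bag}(x)\setminus\mathrm{adh}(x)$, and $\mathrm{cmp}(x)=\bigcup_y\mathrm{mrg}(y)$ over all descendants $y$ of $x$ (including $x$). The sets $\mathrm{cmp}(x)$ are the target sets of $\mathbf t$. An elimination forest $F$ of $H$ is a rooted forest on $V(H)$ such that any two vertices in a common edge are in the ancestor relation (which is reflexive). Let $\mathrm{bag}_F(u)$ consist of $u$ and all ancestors of $u$ adjacent in $H$ to a descendant of $u$ (including $u$); the $f$-width of $F$ is $\max_u f_H(\mathrm{bag}_F(u))$ ($0$ if $V(H)=\emptyset$). A tree factor of $F$ is the set $F_u$ of descendants of a vertex $u$; a forest factor is a non-empty union of tree factors whose roots are siblings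 (have the same parent, or are all roots of $F$); a context factor is a set $F_u\setminus Y$ with $Y$ a forest factor whose roots are strict descendants of $u$. For $U\subseteq V(H)$ let $\mathrm{MF}_F(U)$ be the set of inclusion-maximal factors contained in $U$; $U$ is well-formed if $\mathrm{MF}_F(U)$ contains no context factor. Let $\mathrm{split}(\mathbf t,F)$ be the maximum of $|\mathrm{MF}_F(U)|$ over the target sets $U$ of $\mathbf t$, and let $\mathrm{mir}(\mathbf t,F)$ be the maximum, over the nodes $x$ of $\mathbf t$, of the number of children $y$ of $x$ such that $\mathrm{cmp}(y)$ is not well-formed. **Statement.** For every such $f$ there is a function $\gamma$ with values in $\mathbb N$, monotone in all its arguments, such that for every hypergraph $H$ and every tree decomposition $\mathbf t$ of $H$ there is an elimination forest $F$ of $H$ whose $f$-width is the smallest among all elimination forests of $H$ and which satisfies $$\mathrm{split}(\mathbf t,F),\ \mathrm{mir}(\mathbf t,F)\ \le\ \gamma\bigl(\mathrm{tw}(\mathbf t),\,f\text{-width}(H),\,\mathrm{rank}(H),\,\Delta(H)\bigr).$$ If moreover $f$ is monotone ($f_H(U)\le f_H(W)$ for $U\subseteq W\subseteq V(H)$), then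 the $f$-width of $F$ equals $f\text{-width}(H)$. -/

import Mathlib

open scoped NNReal Hypergraph

universe u v

noncomputable section

/-! ### Hypergraphs -/

namespace Hypergraph

variable {α : Type u} {β : Type v}

/-- The standing conventions on hypergraphs: the vertex set is finite, edges are non-empty, and
every vertex lies in some edge. -/
structure IsProper (H : Hypergraph α) : Prop where
  finite : V(H).Finite
  edge_nonempty : ∀ e ∈ E(H), e.Nonempty
  not_isolated : ∀ v ∈ V(H), ¬ H.IsIsolated v

/-- The largest size of an edge. -/
def rank (H : Hypergraph α) : ℕ := sSup (Set.ncard '' E(H))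

/-- The largest number of edges incident to a single vertex. -/
def maxDegree (H : Hypergraph α) : ℕ :=
  sSup ((fun v => {e | e ∈ E(H) ∧ v ∈ e}.ncard) '' V(H))

/-- The subhypergraph `H[U]` induced by a set `U` of vertices: its edges are the non-empty traces
on `U` of the edges of `H`. -/
def induce (H : Hypergraph α) (U : Set α) : Hypergraph α where
  vertexSet := U
  edgeSet := {e' | ∃ e ∈ E(H), e' = U ∩ e ∧ (U ∩ e).Nonempty}
  subset_vertexSet_of_mem_edgeSet' := by
    rintro _ ⟨e, _, rfl, _⟩
    exact Set.inter_subset_left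

/-- Two hypergraphs are isomorphic: a bijection between the vertex sets carries the edges of one
onto the edges of the other. -/
def Isomorphic (H₁ : Hypergraph α) (H₂ : Hypergraph β) : Prop :=
  ∃ φ : α → β, Set.BijOn φ V(H₁) V(H₂) ∧ Set.image φ '' E(H₁) = E(H₂)

end Hypergraph

/-! ### Width functions -/

/-- A width function assigns a non-negative real `f_H(U)` to a hypergraph `H` and a set `U` of
vertices of `H`. (Only the values at proper `H` and `U ⊆ V(H)` are ever used.) -/
def WidthFunction : Type (u + 1) := ∀ ⦃α : Type u⦄, Hypergraph α → Set α → ℝ≥0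

namespace WidthFunction

/-- `f_H(U₁ ∪ U₂) = f_H(U₁) + f_H(U₂)` for disjoint `U₁, U₂` such that no edge meets both. -/
def WeaklyAdditive (f : WidthFunction.{u}) : Prop :=
  ∀ ⦃α : Type u⦄ (H : Hypergraph α), H.IsProper → ∀ U₁ U₂ : Set α, U₁ ⊆ V(H) → U₂ ⊆ V(H) →
    Disjoint U₁ U₂ → (∀ u ∈ U₁, ∀ v ∈ U₂, ¬ H.Adj u v) →
      f H (U₁ ∪ U₂) = f H U₁ + f H U₂

/-- `|U|` is bounded by a function of `f_H(U)` and the rank of `H` that does not depend on `H`. -/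
def BoundedSize (f : WidthFunction.{u}) : Prop :=
  ∃ β : ℝ≥0 → ℕ → ℕ, ∀ (k : ℝ≥0) ⦃α : Type u⦄ (H : Hypergraph α), H.IsProper →
    ∀ U : Set α, U ⊆ V(H) → f H U ≤ k → U.ncard ≤ β k H.rank

/-- `f_H(U)` depends only on the isomorphism type of `H[U]`. -/
def InvariantlyLocal (f : WidthFunction.{u}) : Prop :=
  ∀ ⦃α₁ α₂ : Type u⦄ (H₁ : Hypergraph α₁) (H₂ : Hypergraph α₂), H₁.IsProper → H₂.IsProper →
    ∀ (U₁ : Set α₁) (U₂ : Set α₂), U₁ ⊆ V(H₁) → U₂ ⊆ V(H₂) →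
      (H₁.induce U₁).Isomorphic (H₂.induce U₂) → f H₁ U₁ = f H₂ U₂

/-- Manageable width functions. The algorithmic requirements that are often added to this notion
(the size bound is computable, and so is `f_H(V(H))`) are not imposed, so that all manageable width
functions are covered, and more. -/
structure IsManageable (f : WidthFunction.{u}) : Prop where
  weaklyAdditive : f.WeaklyAdditive
  boundedSize : f.BoundedSize
  invariantlyLocal : f.InvariantlyLocal

/-- `f_H(U) ≤ f_H(W)` whenever `U ⊆ W`. -/
def IsMonotone (f : WidthFunction.{u}) : Prop :=
  ∀ ⦃α : Type u⦄ (H : Hypergraph α), H.IsProper → ∀ U W : Set α, U ⊆ W → W ⊆ V(H) →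
    f H U ≤ f H W

end WidthFunction

/-! ### Rooted forests and their factors -/

/-- A finite rooted forest with its edges directed away from the roots: `arc p x` says that `p` is
the parent of `x`. Every node has at most one parent and there is no directed cycle. -/
structure RootedForest (N : Type v) where
  nodes : Set N
  finite_nodes : nodes.Finite
  arc : N → N → Prop
  arc_mem : ∀ p x, arc p x → p ∈ nodes ∧ x ∈ nodes
  parent_unique : ∀ p q x, arc p x → arc q x → p = q
  acyclic : ∀ x, ¬ Relation.TransGen arc x x

namespace RootedForest

variable {N : Type v} (T : RootedForest N)

/-- A root is a node without a parent. -/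
def IsRoot (x : N) : Prop := x ∈ T.nodes ∧ ∀ p, ¬ T.arc p x

/-- `x` is an ancestor of `y` (every node is an ancestor of itself). -/
def Ancestor (x y : N) : Prop := x ∈ T.nodes ∧ Relation.ReflTransGen T.arc x y

/-- The set `T_x` of descendants of `x`, including `x`. -/
def desc (x : N) : Set N := {y | T.Ancestor x y}

/-- The underlying undirected graph. -/
def graph : SimpleGraph N := SimpleGraph.fromRel T.arc

/-- Siblings have the same parent, or are both roots. A node is its own sibling. -/
def Siblings (x y : N) : Prop := ∀ p, T.arc p x ↔ T.arc p y

/-- `A` is the forest factor with set of roots `R`: a non-empty union of tree factors `T_x` whose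
roots `x` are siblings. A tree factor is the case that `R` is a singleton. -/
def IsForestFactorWithRoots (R A : Set N) : Prop :=
  R.Nonempty ∧ R ⊆ T.nodes ∧ (∀ x ∈ R, ∀ y ∈ R, T.Siblings x y) ∧ A = ⋃ x ∈ R, T.desc x

def IsForestFactor (A : Set N) : Prop := ∃ R, T.IsForestFactorWithRoots R A

/-- A context factor is a tree factor `T_x` minus a forest factor whose roots are strict
descendants of `x`. -/
def IsContextFactor (A : Set N) : Prop :=
  ∃ x ∈ T.nodes, ∃ R Y : Set N, T.IsForestFactorWithRoots R Y ∧
    (∀ y ∈ R, T.Ancestor x y ∧ y ≠ x) ∧ A = T.desc x \ Y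

def IsFactor (A : Set N) : Prop := T.IsForestFactor A ∨ T.IsContextFactor A

/-- The maximal factorization of `U`: the set of the inclusion-maximal factors contained in
`U`. -/
def MF (U : Set N) : Set (Set N) := {A | Maximal (fun B => T.IsFactor B ∧ B ⊆ U) A}

/-- `U` is well-formed if its maximal factorization contains no context factor. -/
def WellFormed (U : Set N) : Prop := ∀ A ∈ T.MF U, ¬ T.IsContextFactor A

end RootedForest

/-! ### Tree decompositions -/

/-- A (rooted) tree decomposition of `H` with nodes in `ι`. -/
structure TreeDecomposition {α : Type u} (H : Hypergraph α) (ι : Type v)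
    extends RootedForest ι where
  existsUnique_root : ∃! r, toRootedForest.IsRoot r
  bag : ι → Set α
  bag_subset : ∀ x ∈ nodes, bag x ⊆ V(H)
  edge_subset_bag : ∀ e ∈ E(H), ∃ x ∈ nodes, e ⊆ bag x
  connected : ∀ v ∈ V(H), (toRootedForest.graph.induce {x | x ∈ nodes ∧ v ∈ bag x}).Connected

namespace TreeDecomposition

variable {α : Type u} {H : Hypergraph α} {ι : Type v} (t : TreeDecomposition H ι)

/-- The width of `t`: the maximum size of a bag, minus one. -/
def tw : ℕ := sSup ((fun x => (t.bag x).ncard) '' t.nodes) - 1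

/-- The `f`-width of `t`: the maximum of `f_H` over the bags. -/
def fWidth (f : WidthFunction.{u}) : ℝ≥0 := sSup ((fun x => f H (t.bag x)) '' t.nodes)

/-- The adhesion of `x`: the part of its bag shared with its parent; empty for the root. -/
def adh (x : ι) : Set α := {v | v ∈ t.bag x ∧ ∃ p, t.arc p x ∧ v ∈ t.bag p}

/-- The margin of `x`. -/
def mrg (x : ι) : Set α := t.bag x \ t.adh x

/-- The component of `x`: the union of the margins of its descendants. -/
def cmp (x : ι) : Set α := ⋃ y ∈ t.toRootedForest.desc x, t.mrg y

/-- The target sets of `t`: the components of its nodes. -/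
def TS : Set (Set α) := t.cmp '' t.nodes

end TreeDecomposition

/-- The `f`-width of `H`: the minimum `f`-width of a tree decomposition of `H`. -/
def Hypergraph.fWidth {α : Type u} (H : Hypergraph α) (f : WidthFunction.{u}) : ℝ≥0 :=
  sInf {w | ∃ (ι : Type) (t : TreeDecomposition H ι), w = t.fWidth f}

/-! ### Elimination forests -/

/-- An elimination forest of `H`: a rooted forest on `V(H)` in which any two vertices that lie in a
common edge are in the ancestor relation. -/
structure EliminationForest {α : Type u} (H : Hypergraph α) extends RootedForest α where
  nodes_eq : nodes = V(H)
  comparable : ∀ u v, H.Adj u v → toRootedForest.Ancestor u v ∨ toRootedForest.Ancestor v u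

namespace EliminationForest

variable {α : Type u} {H : Hypergraph α} (F : EliminationForest H)

/-- The bag of `u`: the vertex `u` and its ancestors that are adjacent to a descendant of `u`
(possibly `u` itself). -/
def bag (u : α) : Set α :=
  {v | v = u ∨ (F.Ancestor v u ∧ ∃ w, F.Ancestor u w ∧ H.Adj v w)}

/-- The `f`-width of the tree decomposition induced by `F`. -/
def fWidth (f : WidthFunction.{u}) : ℝ≥0 := sSup ((fun u => f H (F.bag u)) '' F.nodes)

end EliminationForest

/-! ### Split and irregularity -/

section TFPair

variable {α : Type u} {H : Hypergraph α} {ι : Type v}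

/-- The largest size of the maximal factorization in `F` of a target set of `t`. -/
def split (t : TreeDecomposition H ι) (F : EliminationForest H) : ℕ :=
  sSup ((fun U => (F.MF U).ncard) '' t.TS)

/-- The number of children `y` of `x` such that `cmp y` is not well-formed with respect to `F`. -/
def irregularity (t : TreeDecomposition H ι) (F : EliminationForest H) (x : ι) : ℕ :=
  {y | t.arc x y ∧ ¬ F.WellFormed (t.cmp y)}.ncard

/-- The maximum irregularity of a node of `t`. -/
def mir (t : TreeDecomposition H ι) (F : EliminationForest H) : ℕ :=
  sSup (irregularity t F '' t.nodes)

end TFPair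

end

/-! The ancestor order of a width-optimal elimination forest is rearranged, without raising its
width, until every target set has few maximal factors. Fix a target set `U` and colour the vertices
by membership in `U`. Monochromatic factors with a common element unite to a monochromatic factor
(`IsFac.union`), so `V` is partitioned into maximal ones (`cls`). It suffices to bound the number of
these classes.

The tool is an exchange: if `X`, `Y`, `Z` are consecutive parts, `X` and `Y` have opposite colours
and both are far from the cut of `U`, then `Y` is moved above `X`. A bag that changes does so in one
colour only, exactly as one separator between the parts is replaced by another. By additivity the
effect on `f` does not depend on the rest of the bag (`IsAdditive.exchange`). Hence the width does
not grow if the value of the separator between `X` and `Y` is at least the values above `X` and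
below `Y` (`IsStack.width_exchange`).

Take a good order with the fewest classes and, among those, the fewest relations
(`exists_isExchangeReduced`). A class with no vertex near the cut in it or below it is then closed
under descendants (`IsExchangeReduced.strictBelow_eq_empty`). Along a chain of classes that avoid
the neighbourhood of the cut but have the same part of it below them, colours alternate and
separator values have no interior local maximum (`IsConsecutive.no_local_max`), so each value occurs
at most twice. Only finitely many values are possible on sets of bounded size
(`WidthFunction.IsManageable.finite_values`), and the neighbourhood of the cut is bounded in terms
of tree width, rank and degree. The remaining classes are determined by parent class and colour
(`ncard_cls_le`).

Target sets form a laminar family and are treated by increasing size. Exchanges made for a large set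
keep the classes of the smaller ones together (`exists_isGood_of_laminar`). Irregularity is bounded
because related vertices are kept within one connected component: a component of a child that is not
well-formed must then send an edge to the bag of the parent (`irregularity_le`). -/

noncomputable section

/-! ### Tree orders and their factors -/

/-- `r` is the ancestor relation of a rooted forest on `V`, extended by the identity to elements
outside `V`. -/
structure IsTreeOrder {α : Type u} (V : Set α) (r : α → α → Prop) : Prop where
  refl : ∀ a, r a a
  trans : ∀ {a b c}, r a b → r b c → r a c
  antisymm : ∀ {a b}, r a b → r b a → a = b
  chain : ∀ {a b c}, r a c → r b c → r a b ∨ r b a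
  supp : ∀ {a b}, r a b → a = b ∨ (a ∈ V ∧ b ∈ V)

/-- The factors of a rooted forest in terms of its ancestor relation: elements outside `A` cannot
tell the elements of `A` apart. -/
structure IsFac {α : Type u} (V : Set α) (r : α → α → Prop) (A : Set α) : Prop where
  nonempty : A.Nonempty
  subset : A ⊆ V
  above : ∀ z ∉ A, ∀ a ∈ A, ∀ b ∈ A, r z a → r z b
  below : ∀ z ∉ A, ∀ z' ∉ A, ∀ a ∈ A, ∀ b ∈ A, r a z → r b z' → r a z'
  least : ∀ z ∉ A, ∀ a ∈ A, r a z → ∃ x ∈ A, ∀ b ∈ A, r x b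

/-- The elements outside `A` that lie below an element of `A`. -/
def strictBelow {α : Type u} (r : α → α → Prop) (A : Set α) : Set α := {z | z ∉ A ∧ ∃ a ∈ A, r a z}

/-- `A` does not meet both `U` and its complement. -/
def Monochromatic {α : Type u} (U A : Set α) : Prop := ∀ a ∈ A, ∀ b ∈ A, (a ∈ U ↔ b ∈ U)

/-- The largest monochromatic factor that contains `v`. -/
def cls {α : Type u} (V : Set α) (r : α → α → Prop) (U : Set α) (v : α) : Set α :=
  ⋃₀ {B | IsFac V r B ∧ Monochromatic U B ∧ v ∈ B}

section Factors

variable {α : Type u} {V U : Set α} {r : α → α → Prop}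

theorem IsTreeOrder.mem_left (h : IsTreeOrder V r) {a b : α} (hab : r a b) (hb : b ∈ V) : a ∈ V := by
  rcases h.supp hab with rfl | h <;> tauto

theorem IsTreeOrder.mem_right (h : IsTreeOrder V r) {a b : α} (hab : r a b) (ha : a ∈ V) :
    b ∈ V := by
  rcases h.supp hab with rfl | h <;> tauto

theorem isFac_singleton (h : IsTreeOrder V r) {v : α} (hv : v ∈ V) : IsFac V r {v} := by
  refine ⟨⟨v, rfl⟩, by simpa using hv, ?_, ?_, ?_⟩
  · rintro z - a rfl b rfl h; exact h
  · rintro z - z' - a rfl b rfl - h; exact h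
  · rintro z - a rfl -; exact ⟨a, rfl, by rintro b rfl; exact h.refl _⟩

/-- The mixed case of `below` for a union. The least elements of `A` and `B` both lie above the
common element `c`, so they are comparable, and the relation to `z'` passes from `b` to the least
element of `A` and from there to `a`. -/
theorem IsFac.union_below (h : IsTreeOrder V r) {A B : Set α} (hA : IsFac V r A) (hB : IsFac V r B)
    {c a b z z' : α} (hcA : c ∈ A) (hcB : c ∈ B) (ha : a ∈ A) (hb : b ∈ B) (hzA : z ∉ A)
    (hzB : z ∉ B) (hzA' : z' ∉ A) (hzB' : z' ∉ B) (haz : r a z) (hbz : r b z') : r a z' := by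
  by_cases haB : a ∈ B
  · exact hB.below z hzB z' hzB' a haB b hb haz hbz
  obtain ⟨x, hx, hxA⟩ := hA.least z hzA a ha haz
  obtain ⟨y, hy, hyB⟩ := hB.least z' hzB' b hb hbz
  rcases h.chain (hxA c hcA) (hyB c hcB) with hxy | hyx
  · exact hA.below z hzA z' hzA' a ha x hx haz (h.trans hxy (h.trans (hyB b hb) hbz))
  · by_cases hxB : x ∈ B
    · exact hA.below z hzA z' hzA' a ha x hx haz
        (hB.below a haB z' hzB' x hxB b hb (hxA a ha) hbz)
    · have := hB.above x hxB c hcB y hy (hxA c hcA)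
      exact absurd (h.antisymm this hyx ▸ hy) hxB

theorem IsFac.union_least (h : IsTreeOrder V r) {A B : Set α} (hA : IsFac V r A) (hB : IsFac V r B)
    {c a z : α} (hcA : c ∈ A) (hcB : c ∈ B) (ha : a ∈ A) (hzA : z ∉ A)
    (hzB : z ∉ B) (haz : r a z) : ∃ x ∈ A ∪ B, ∀ b ∈ A ∪ B, r x b := by
  obtain ⟨x, hx, hxA⟩ := hA.least z hzA a ha haz
  by_cases hxB : x ∈ B
  · obtain ⟨y, hy, hyB⟩ := hB.least z hzB x hxB (h.trans (hxA a ha) haz)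
    exact ⟨y, .inr hy, fun b hb => hb.elim (fun hb => h.trans (hyB x hxB) (hxA b hb)) (hyB b)⟩
  · exact ⟨x, .inl hx, fun b hb => hb.elim (hxA b) (fun hb => hB.above x hxB c hcB b hb (hxA c hcA))⟩

/-- The common element `c` transmits what outside elements see of one factor to the other. If
something outside lies below, the factor that reaches higher supplies the least element of the
union. -/
theorem IsFac.union (h : IsTreeOrder V r) {A B : Set α} (hA : IsFac V r A) (hB : IsFac V r B)
    {c : α} (hcA : c ∈ A) (hcB : c ∈ B) : IsFac V r (A ∪ B) := by
  refine ⟨⟨c, .inl hcA⟩, Set.union_subset hA.subset hB.subset, ?_, ?_, ?_⟩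
  · intro z hz a ha b hb hza
    have hzA : z ∉ A := fun h => hz (.inl h)
    have hzB : z ∉ B := fun h => hz (.inr h)
    have hzc : r z c := ha.elim (fun ha => hA.above z hzA a ha c hcA hza)
      (fun ha => hB.above z hzB a ha c hcB hza)
    exact hb.elim (fun hb => hA.above z hzA c hcA b hb hzc) (fun hb => hB.above z hzB c hcB b hb hzc)
  · intro z hz z' hz' a ha b hb haz hbz
    simp only [Set.mem_union, not_or] at hz hz'
    rcases ha with ha | ha <;> rcases hb with hb | hb
    · exact hA.below z hz.1 z' hz'.1 a ha b hb haz hbz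
    · exact hA.union_below h hB hcA hcB ha hb hz.1 hz.2 hz'.1 hz'.2 haz hbz
    · exact hB.union_below h hA hcB hcA ha hb hz.2 hz.1 hz'.2 hz'.1 haz hbz
    · exact hB.below z hz.2 z' hz'.2 a ha b hb haz hbz
  · intro z hz a ha haz
    simp only [Set.mem_union, not_or] at hz
    rcases ha with ha | ha
    · exact hA.union_least h hB hcA hcB ha hz.1 hz.2 haz
    · rw [Set.union_comm]
      exact hB.union_least h hA hcB hcA ha hz.2 hz.1 haz

theorem Monochromatic.union {A B : Set α} (hA : Monochromatic U A) (hB : Monochromatic U B) {c : α}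
    (hcA : c ∈ A) (hcB : c ∈ B) : Monochromatic U (A ∪ B) := by
  have key : ∀ a ∈ A ∪ B, (a ∈ U ↔ c ∈ U) := by
    rintro a (ha | ha)
    · exact hA a ha c hcA
    · exact hB a ha c hcB
  exact fun a ha b hb => (key a ha).trans (key b hb).symm

/-- The monochromatic factors through `v` are finite in number and closed under union, so a maximal
one contains all of them and is their union. -/
theorem cls_spec (hV : V.Finite) (h : IsTreeOrder V r) {v : α} (hv : v ∈ V) :
    IsFac V r (cls V r U v) ∧ Monochromatic U (cls V r U v) ∧ v ∈ cls V r U v := by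
  have hfin : {B | IsFac V r B ∧ Monochromatic U B ∧ v ∈ B}.Finite :=
    hV.finite_subsets.subset fun B hB => hB.1.subset
  obtain ⟨M, -, hM⟩ := hfin.exists_le_maximal
    (show ({v} : Set α) ∈ {B | IsFac V r B ∧ Monochromatic U B ∧ v ∈ B} from
      ⟨isFac_singleton h hv, by rintro a rfl b rfl; rfl, rfl⟩)
  have : cls V r U v = M := by
    refine Set.Subset.antisymm (Set.sUnion_subset fun B hB => ?_) (Set.subset_sUnion_of_mem hM.1)
    have := hM.2 (y := M ∪ B) ⟨hM.1.1.union h hB.1 hM.1.2.2 hB.2.2,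
      hM.1.2.1.union hB.2.1 hM.1.2.2 hB.2.2, .inl hM.1.2.2⟩ Set.subset_union_left
    exact Set.subset_union_right.trans this
  rw [this]
  exact hM.1

theorem mem_cls_self (hV : V.Finite) (h : IsTreeOrder V r) {v : α} (hv : v ∈ V) :
    v ∈ cls V r U v := (cls_spec hV h hv).2.2

theorem subset_cls {v : α} {B : Set α} (hB : IsFac V r B) (hU : Monochromatic U B) (hv : v ∈ B) :
    B ⊆ cls V r U v := Set.subset_sUnion_of_mem ⟨hB, hU, hv⟩

theorem cls_subset : cls V r U v ⊆ V := Set.sUnion_subset fun _ hB => hB.1.subset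

theorem cls_eq (hV : V.Finite) (h : IsTreeOrder V r) {v w : α} (hv : v ∈ V)
    (hw : w ∈ cls V r U v) : cls V r U w = cls V r U v := by
  have hwV := cls_subset hw
  obtain ⟨h1, h2, h3⟩ := cls_spec (U := U) hV h hv
  obtain ⟨k1, k2, k3⟩ := cls_spec (U := U) hV h hwV
  have hsub := subset_cls h1 h2 hw
  exact Set.Subset.antisymm (subset_cls k1 k2 (hsub h3)) hsub

theorem exists_isLeast_of_chain (h : IsTreeOrder V r) {S : Set α} (hS : S.Finite)
    (hne : S.Nonempty) (hc : ∀ a ∈ S, ∀ b ∈ S, r a b ∨ r b a) : ∃ m ∈ S, ∀ a ∈ S, r m a := by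
  induction S, hS using Set.Finite.induction_on with
  | empty => exact absurd hne (by simp)
  | @insert a S _ _ ih =>
    rcases S.eq_empty_or_nonempty with rfl | hne'
    · exact ⟨a, by simp, by simp [h.refl]⟩
    obtain ⟨m, hm, hmS⟩ := ih hne' fun a ha b hb => hc a (.inr ha) b (.inr hb)
    rcases hc a (.inl rfl) m (.inr hm) with ham | hma
    · refine ⟨a, .inl rfl, ?_⟩
      rintro b (rfl | hb)
      · exact h.refl _
      · exact h.trans ham (hmS b hb)
    · refine ⟨m, .inr hm, ?_⟩
      rintro b (rfl | hb)
      · exact hma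
      · exact hmS b hb

theorem exists_isGreatest_of_chain (h : IsTreeOrder V r) {S : Set α} (hS : S.Finite)
    (hne : S.Nonempty) (hc : ∀ a ∈ S, ∀ b ∈ S, r a b ∨ r b a) : ∃ m ∈ S, ∀ a ∈ S, r a m := by
  induction S, hS using Set.Finite.induction_on with
  | empty => exact absurd hne (by simp)
  | @insert a S _ _ ih =>
    rcases S.eq_empty_or_nonempty with rfl | hne'
    · exact ⟨a, by simp, by simp [h.refl]⟩
    obtain ⟨m, hm, hmS⟩ := ih hne' fun a ha b hb => hc a (.inr ha) b (.inr hb)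
    rcases hc a (.inl rfl) m (.inr hm) with ham | hma
    · refine ⟨m, .inr hm, ?_⟩
      rintro b (rfl | hb)
      · exact ham
      · exact hmS b hb
    · refine ⟨a, .inl rfl, ?_⟩
      rintro b (rfl | hb)
      · exact h.refl _
      · exact h.trans (hmS b hb) hma

end Factors

/-! ### Exchanging two consecutive parts of a tree order -/

/-- `X`, `Y`, `Z` are consecutive parts of the tree order `r`: the elements of `X` that lie above
something in `Y ∪ Z` lie above all of it, and likewise for `Y` and `Z`. -/
structure IsStack {α : Type u} (V : Set α) (r : α → α → Prop) (X Y Z : Set α) : Prop where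
  subset : X ∪ Y ∪ Z ⊆ V
  disjXY : Disjoint X Y
  disjXZ : Disjoint X Z
  disjYZ : Disjoint Y Z
  closed : ∀ a ∈ X ∪ Y ∪ Z, ∀ b, r a b → b ∈ X ∪ Y ∪ Z
  above : ∀ z ∉ X ∪ Y ∪ Z, ∀ a ∈ X ∪ Y ∪ Z, ∀ b ∈ X ∪ Y ∪ Z, r z a → r z b
  not_le : ∀ y ∈ Y, ∀ x ∈ X, ¬ r y x
  belowX : ∀ a ∈ X, ∀ b ∈ Y ∪ Z, ∀ b' ∈ Y ∪ Z, r a b → r a b'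
  closedZ : ∀ a ∈ Z, ∀ b, r a b → b ∈ Z
  belowY : ∀ a ∈ Y, ∀ z ∈ Z, ∀ z' ∈ Z, r a z → r a z'

/-- The tree order in which `Y` is moved above `X`. -/
def exchange {α : Type u} (r : α → α → Prop) (X Y Z : Set α) (a b : α) : Prop :=
  -- Only the elements of `Y` with something of `Z` below them, its spine, are placed above `X`. The
  -- rest of `Y` becomes incomparable to `X`. For `Z = ∅` the operation merely deletes the relations
  -- from `X` to `Y`.
  (r a b ∧ ¬ (a ∈ X ∧ b ∈ Y)) ∨ (a ∈ Y ∧ b ∈ X ∧ ∃ z ∈ Z, r a z)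

section Exchange

variable {α : Type u} {V U : Set α} {r : α → α → Prop} {X Y Z : Set α}

theorem IsStack.notMem (s : IsStack V r X Y Z) {a : α} :
    (a ∈ X → a ∉ Y ∧ a ∉ Z) ∧ (a ∈ Y → a ∉ X ∧ a ∉ Z) ∧ (a ∈ Z → a ∉ X ∧ a ∉ Y) := by
  have h1 := fun h : a ∈ X => Set.disjoint_left.mp s.disjXY h
  have h2 := fun h : a ∈ X => Set.disjoint_left.mp s.disjXZ h
  have h3 := fun h : a ∈ Y => Set.disjoint_left.mp s.disjYZ h
  tauto

theorem IsStack.exchange_trans (h : IsTreeOrder V r) (s : IsStack V r X Y Z) {a b c : α}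
    (hab : exchange r X Y Z a b) (hbc : exchange r X Y Z b c) : exchange r X Y Z a c := by
  have na := s.notMem (a := a)
  have nb := s.notMem (a := b)
  have nc := s.notMem (a := c)
  rcases hab with ⟨hab, hab'⟩ | ⟨haY, hbX, z, hz, haz⟩ <;>
    rcases hbc with ⟨hbc, hbc'⟩ | ⟨hbY, hcX, z', hz', hbz⟩
  · refine .inl ⟨h.trans hab hbc, fun ⟨haX, hcY⟩ => ?_⟩
    have hb : b ∈ X ∪ Y ∪ Z := s.closed a (.inl (.inl haX)) b hab
    rcases hb with (hb | hb) | hb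
    · exact hbc' ⟨hb, hcY⟩
    · exact hab' ⟨haX, hb⟩
    · exact (nc.2.1 hcY).2 (s.closedZ b hb c hbc)
  · by_cases haN : a ∈ X ∪ Y ∪ Z
    · rcases haN with (ha | ha) | ha
      · exact absurd ⟨ha, hbY⟩ hab'
      · exact .inr ⟨ha, hcX, z', hz', h.trans hab hbz⟩
      · exact absurd (s.closedZ a ha b hab) (nb.2.1 hbY).2
    · exact .inl ⟨s.above a haN b (.inl (.inr hbY)) c (.inl (.inl hcX)) hab,
        fun hx => haN (.inl (.inl hx.1))⟩
  · have hc : c ∈ X ∪ Y ∪ Z := s.closed b (.inl (.inl hbX)) c hbc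
    rcases hc with (hc | hc) | hc
    · exact .inr ⟨haY, hc, z, hz, haz⟩
    · exact absurd ⟨hbX, hc⟩ hbc'
    · exact .inl ⟨s.belowY a haY z hz c hc haz, fun hx => (nc.2.2 hc).2 hx.2⟩
  · exact absurd hbY (nb.1 hbX).1

theorem IsStack.exchange_chain (h : IsTreeOrder V r) (s : IsStack V r X Y Z) {a b c : α}
    (hac : exchange r X Y Z a c) (hbc : exchange r X Y Z b c) :
    exchange r X Y Z a b ∨ exchange r X Y Z b a := by
  have key1 : ∀ {a b : α}, r a b → r a c → ¬ (a ∈ X ∧ c ∈ Y) → r b c → ¬ (b ∈ X ∧ c ∈ Y) →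
      exchange r X Y Z a b ∨ exchange r X Y Z b a := by
    intro a b hab hac hac' hbc hbc'
    by_cases hx : a ∈ X ∧ b ∈ Y
    · obtain ⟨ha, hb⟩ := hx
      have hc : c ∈ X ∪ Y ∪ Z := s.closed a (.inl (.inl ha)) c hac
      rcases hc with (hc | hc) | hc
      · exact absurd hbc (s.not_le b hb c hc)
      · exact absurd ⟨ha, hc⟩ hac'
      · exact .inr (.inr ⟨hb, ha, c, hc, hbc⟩)
    · exact .inl (.inl ⟨hab, hx⟩)
  have key2 : ∀ {a b : α}, r a c → c ∈ X → b ∈ Y → (∃ z ∈ Z, r b z) →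
      exchange r X Y Z a b ∨ exchange r X Y Z b a := by
    rintro a b hac hc hb ⟨z, hz, hbz⟩
    by_cases haN : a ∈ X ∪ Y ∪ Z
    · rcases haN with (ha | ha) | ha
      · exact .inr (.inr ⟨hb, ha, z, hz, hbz⟩)
      · exact absurd hac (s.not_le a ha c hc)
      · exact absurd (s.closedZ a ha c hac) (s.notMem.1 hc).2
    · exact .inl (.inl ⟨s.above a haN c (.inl (.inl hc)) b (.inl (.inr hb)) hac,
        fun hx => haN (.inl (.inl hx.1))⟩)
  rcases hac with ⟨hac, hac'⟩ | ⟨haY, hcX, z, hz, haz⟩ <;>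
    rcases hbc with ⟨hbc, hbc'⟩ | ⟨hbY, hcX', z', hz', hbz⟩
  · rcases h.chain hac hbc with hab | hba
    · exact key1 hab hac hac' hbc hbc'
    · exact (key1 hba hbc hbc' hac hac').symm
  · exact key2 hac hcX' hbY ⟨z', hz', hbz⟩
  · exact (key2 hbc hcX haY ⟨z, hz, haz⟩).symm
  · have haz' := s.belowY a haY z hz z' hz' haz
    have na := (s.notMem.2.1 haY).1
    have nb := (s.notMem.2.1 hbY).1
    rcases h.chain haz' hbz with hab | hba
    · exact .inl (.inl ⟨hab, by tauto⟩)
    · exact .inr (.inl ⟨hba, by tauto⟩)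

theorem IsStack.isTreeOrder_exchange (h : IsTreeOrder V r) (s : IsStack V r X Y Z) :
    IsTreeOrder V (exchange r X Y Z) where
  refl a := .inl ⟨h.refl a, fun hx => (s.notMem.1 hx.1).1 hx.2⟩
  trans := s.exchange_trans h
  antisymm {a b} hab hba := by
    have na := s.notMem (a := a)
    have nb := s.notMem (a := b)
    rcases hab with ⟨hab, hab'⟩ | ⟨haY, hbX, -⟩ <;> rcases hba with ⟨hba, hba'⟩ | ⟨hbY, haX, -⟩
    · exact h.antisymm hab hba
    all_goals tauto
  chain := s.exchange_chain h
  supp {a b} hab := by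
    rcases hab with ⟨hab, hab'⟩ | ⟨haY, hbX, -⟩
    · exact h.supp hab
    · exact .inr ⟨s.subset (.inl (.inr haY)), s.subset (.inl (.inl hbX))⟩

/-- A factor contained in `X` or in `Y` or disjoint from both survives the exchange. -/
theorem IsStack.isFac_exchange (s : IsStack V r X Y Z) {B : Set α} (hB : IsFac V r B)
    (hBX : (B ∩ X).Nonempty → B ⊆ X) (hBY : (B ∩ Y).Nonempty → B ⊆ Y) :
    IsFac V (exchange r X Y Z) B := by
  have cases : B ⊆ X ∨ B ⊆ Y ∨ ∀ b ∈ B, b ∉ X ∧ b ∉ Y := by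
    by_cases h1 : (B ∩ X).Nonempty
    · exact .inl (hBX h1)
    by_cases h2 : (B ∩ Y).Nonempty
    · exact .inr (.inl (hBY h2))
    · exact .inr (.inr fun b hb => ⟨fun h => h1 ⟨b, hb, h⟩, fun h => h2 ⟨b, hb, h⟩⟩)
  have nm := fun a => s.notMem (a := a)
  refine ⟨hB.nonempty, hB.subset, ?_, ?_, ?_⟩
  · intro z hz a ha b hb hza
    have na := nm a
    have nb := nm b
    rcases hza with ⟨hza, hza'⟩ | ⟨hzY, haX, w, hw, hzw⟩
    · have hzb := hB.above z hz a ha b hb hza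
      refine .inl ⟨hzb, fun hx => ?_⟩
      rcases cases with hc | hc | hc
      · exact (nb.1 (hc hb)).1 hx.2
      · exact hza' ⟨hx.1, hc ha⟩
      · exact (hc b hb).2 hx.2
    · rcases cases with hc | hc | hc
      · exact .inr ⟨hzY, hc hb, w, hw, hzw⟩
      · exact absurd (hc ha) (na.1 haX).1
      · exact absurd haX (hc a ha).1
  · intro z hz z' hz' a ha b hb haz hbz
    rcases cases with hc | hc | hc
    · have haX := hc ha
      have hbX := hc hb
      rcases haz with ⟨haz, haz'⟩ | ⟨haY, -⟩
      · rcases hbz with ⟨hbz, hbz'⟩ | ⟨hbY, -⟩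
        · exact .inl ⟨hB.below z hz z' hz' a ha b hb haz hbz, by tauto⟩
        · exact absurd hbY ((nm b).1 hbX).1
      · exact absurd haY ((nm a).1 haX).1
    · have haY := hc ha
      have hbY := hc hb
      have na := (nm a).2.1 haY
      have hZB : ∀ w ∈ Z, w ∉ B := fun w hw hwB => ((nm w).2.2 hw).2 (hc hwB)
      rcases haz with ⟨haz, haz'⟩ | ⟨-, hzX, w, hw, haw⟩
      · rcases hbz with ⟨hbz, hbz'⟩ | ⟨-, hzX', w', hw', hbw⟩
        · exact .inl ⟨hB.below z hz z' hz' a ha b hb haz hbz, by tauto⟩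
        · exact .inr ⟨haY, hzX', w', hw', hB.below z hz w' (hZB w' hw') a ha b hb haz hbw⟩
      · rcases hbz with ⟨hbz, hbz'⟩ | ⟨-, hzX', w', hw', hbw⟩
        · exact .inl ⟨hB.below w (hZB w hw) z' hz' a ha b hb haw hbz, by tauto⟩
        · exact .inr ⟨haY, hzX', w, hw, haw⟩
    · have ha' := hc a ha
      have hb' := hc b hb
      rcases haz with ⟨haz, haz'⟩ | ⟨haY, -⟩
      · rcases hbz with ⟨hbz, hbz'⟩ | ⟨hbY, -⟩
        · exact .inl ⟨hB.below z hz z' hz' a ha b hb haz hbz, by tauto⟩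
        · exact absurd hbY hb'.2
      · exact absurd haY ha'.2
  · intro z hz a ha haz
    obtain ⟨x, hx, hxB⟩ : ∃ x ∈ B, ∀ b ∈ B, r x b := by
      rcases haz with ⟨haz, -⟩ | ⟨haY, -, w, hw, haw⟩
      · exact hB.least z hz a ha haz
      · refine hB.least w (fun hwB => ?_) a ha haw
        exact ((nm w).2.2 hw).2 (hBY ⟨a, ha, haY⟩ hwB)
    refine ⟨x, hx, fun b hb => .inl ⟨hxB b hb, fun hxy => ?_⟩⟩
    have nb := nm b
    exact (nb.1 (hBX ⟨x, hx, hxy.1⟩ hb)).1 hxy.2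

theorem IsFac.least_of_strictBelow {A : Set α} (hA : IsFac V r A)
    (hne : (strictBelow r A).Nonempty) : ∃ x ∈ A, ∀ b ∈ A, r x b := by
  obtain ⟨z, hz, a, ha, haz⟩ := hne
  exact hA.least z hz a ha haz

theorem IsFac.mem_strictBelow_iff {A : Set α} (h : IsTreeOrder V r) {x : α}
    (hx : x ∈ A) (hxA : ∀ b ∈ A, r x b) {z : α} : z ∈ strictBelow r A ↔ z ∉ A ∧ r x z :=
  ⟨fun ⟨hz, a, ha, haz⟩ => ⟨hz, h.trans (hxA a ha) haz⟩, fun ⟨hz, hxz⟩ => ⟨hz, x, hx, hxz⟩⟩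

theorem IsFac.not_le_of_strictBelow {A : Set α} (h : IsTreeOrder V r) (hA : IsFac V r A) {z a : α}
    (hz : z ∈ strictBelow r A) (ha : a ∈ A) : ¬ r z a := by
  intro hza
  obtain ⟨x, hx, hxA⟩ := hA.least_of_strictBelow ⟨z, hz⟩
  have h1 := ((IsFac.mem_strictBelow_iff h hx hxA).mp hz).2
  have h2 := hA.above z hz.1 a ha x hx hza
  exact hz.1 (h.antisymm h1 h2 ▸ hx)

theorem IsFac.strictBelow_closed {A : Set α} (h : IsTreeOrder V r) (hA : IsFac V r A) {z w : α}
    (hz : z ∈ strictBelow r A) (hzw : r z w) : w ∈ strictBelow r A := by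
  obtain ⟨x, hx, hxA⟩ := hA.least_of_strictBelow ⟨z, hz⟩
  refine (IsFac.mem_strictBelow_iff h hx hxA).mpr ⟨fun hw => hA.not_le_of_strictBelow h hz hw hzw,
    h.trans ((IsFac.mem_strictBelow_iff h hx hxA).mp hz).2 hzw⟩

theorem IsFac.strictBelow_above {A : Set α} (h : IsTreeOrder V r) (hA : IsFac V r A) {z a b : α}
    (hz : z ∉ strictBelow r A) (ha : a ∈ strictBelow r A) (hb : b ∈ strictBelow r A)
    (hza : r z a) : r z b := by
  obtain ⟨x, hx, hxA⟩ := hA.least_of_strictBelow ⟨a, ha⟩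
  have hm : ∀ z, _ := fun z => IsFac.mem_strictBelow_iff h hx hxA (z := z)
  by_cases hzA : z ∈ A
  · obtain ⟨hb', c, hc, hcb⟩ := hb
    exact hA.below a ha.1 b hb' z hzA c hc hza hcb
  · rcases h.chain hza ((hm a).mp ha).2 with hzx | hxz
    · exact h.trans hzx ((hm b).mp hb).2
    · exact absurd ((hm z).mpr ⟨hzA, hxz⟩) hz

theorem IsFac.strictBelow_subset {A : Set α} (h : IsTreeOrder V r) (hA : IsFac V r A) :
    strictBelow r A ⊆ V := fun _ ⟨_, _, ha, hab⟩ => h.mem_right hab (hA.subset ha)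

/-- After the exchange, `Y` extends the factor directly above. -/
theorem IsStack.isFac_union_exchange (h : IsTreeOrder V r) (s : IsStack V r X Y Z) {A : Set α}
    (hA : IsFac V r A) (hN : strictBelow r A = X ∪ Y ∪ Z) (hne : (X ∪ Y ∪ Z).Nonempty) :
    IsFac V (exchange r X Y Z) (A ∪ Y) := by
  obtain ⟨x, hx, hxA⟩ := hA.least_of_strictBelow (hN ▸ hne)
  have hm : ∀ z, z ∈ X ∪ Y ∪ Z ↔ z ∉ A ∧ r x z := fun z => by
    rw [← hN]; exact IsFac.mem_strictBelow_iff h hx hxA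
  have nm := fun a => s.notMem (a := a)
  have hAX : ∀ a ∈ A, a ∉ X := fun a ha haX => ((hm a).mp (.inl (.inl haX))).1 ha
  have hAY : ∀ a ∈ A, a ∉ Y := fun a ha haX => ((hm a).mp (.inl (.inr haX))).1 ha
  have hNle : ∀ a ∈ A, ∀ n ∈ X ∪ Y ∪ Z, ∀ n' ∈ X ∪ Y ∪ Z, r a n → r a n' := by
    intro a ha n hn n' hn' han
    rw [← hN] at hn hn'
    obtain ⟨h1, c, hc, hcn⟩ := hn'
    exact hA.below n hn.1 n' h1 a ha c hc han hcn
  have hxle : ∀ b ∈ A ∪ Y, r x b := by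
    rintro b (hb | hb)
    · exact hxA b hb
    · exact ((hm b).mp (.inl (.inr hb))).2
  -- In the new order only `X ∪ Z` remains below `A ∪ Y`, and an element of `Y` sees any of it only
  -- if it belongs to the spine.
  have hout : ∀ z ∉ A ∪ Y, ∀ a ∈ A ∪ Y, exchange r X Y Z a z → z ∈ X ∪ Z ∧
      (a ∈ A ∧ r a z ∨ a ∈ Y ∧ ∃ w ∈ Z, r a w) := by
    intro z hz a ha haz
    simp only [Set.mem_union, not_or] at hz
    rcases haz with ⟨haz, haz'⟩ | ⟨haY, hzX, w⟩
    · have hzN : z ∈ X ∪ Y ∪ Z := (hm z).mpr ⟨hz.1, h.trans (hxle a ha) haz⟩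
      have hzXZ : z ∈ X ∪ Z := by
        rcases hzN with (h1 | h1) | h1
        · exact .inl h1
        · exact absurd h1 hz.2
        · exact .inr h1
      refine ⟨hzXZ, ?_⟩
      rcases ha with ha | ha
      · exact .inl ⟨ha, haz⟩
      · rcases hzXZ with h1 | h1
        · exact absurd haz (s.not_le a ha z h1)
        · exact .inr ⟨ha, z, h1, haz⟩
    · exact ⟨.inl hzX, .inr ⟨haY, w⟩⟩
  refine ⟨⟨x, .inl hx⟩, Set.union_subset hA.subset fun y hy => s.subset (.inl (.inr hy)), ?_, ?_, ?_⟩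
  · intro z hz a ha b hb hza
    simp only [Set.mem_union, not_or] at hz
    have hzN : z ∉ X ∪ Y ∪ Z ∧ r z a := by
      rcases ha with ha | ha
      · rcases hza with ⟨hza, -⟩ | ⟨hzY, haX, -⟩
        · refine ⟨fun hzN => ?_, hza⟩
          rw [← hN] at hzN
          exact hA.not_le_of_strictBelow h hzN ha hza
        · exact absurd haX (hAX a ha)
      · rcases hza with ⟨hza, hza'⟩ | ⟨hzY, haX, -⟩
        · refine ⟨?_, hza⟩
          rintro ((h1 | h1) | h1)
          · exact hza' ⟨h1, ha⟩
          · exact hz.2 h1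
          · exact ((nm a).2.1 ha).2 (s.closedZ z h1 a hza)
        · exact absurd haX ((nm a).2.1 ha).1
    obtain ⟨hzN, hza⟩ := hzN
    have hzx : r z x := by
      rcases h.chain hza (hxle a ha) with h1 | h1
      · exact h1
      · exact absurd ((hm z).mpr ⟨hz.1, h1⟩) hzN
    exact .inl ⟨h.trans hzx (hxle b hb), fun hx => hzN (.inl (.inl hx.1))⟩
  · intro z hz z' hz' a ha b hb haz hbz
    obtain ⟨hzm, ha'⟩ := hout z hz a ha haz
    obtain ⟨hzm', -⟩ := hout z' hz' b hb hbz
    have hzN : z ∈ X ∪ Y ∪ Z := hzm.elim (fun h => .inl (.inl h)) .inr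
    have hzN' : z' ∈ X ∪ Y ∪ Z := hzm'.elim (fun h => .inl (.inl h)) .inr
    rcases ha' with ⟨ha, haz⟩ | ⟨ha, w, hw, haw⟩
    · exact .inl ⟨hNle a ha z hzN z' hzN' haz, fun hx => hAX a ha hx.1⟩
    · rcases hzm' with h1 | h1
      · exact .inr ⟨ha, h1, w, hw, haw⟩
      · exact .inl ⟨s.belowY a ha w hw z' h1 haw, fun hx => ((nm a).2.1 ha).1 hx.1⟩
  · intro _ _ _ _ _
    exact ⟨x, .inl hx, fun b hb => .inl ⟨hxle b hb, fun hxx => hAX x hx hxx.1⟩⟩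

end Exchange

/-! ### Bags of a tree order and their width -/

/-- `u` and the ancestors of `u` adjacent to a descendant of `u`. -/
def orderBag {α : Type u} (adj r : α → α → Prop) (u : α) : Set α :=
  {v | v = u ∨ (r v u ∧ ∃ w, r u w ∧ adj v w)}

/-- The elements outside `Q` adjacent to a descendant in `Q`. -/
def separator {α : Type u} (adj r : α → α → Prop) (Q : Set α) : Set α :=
  {v | v ∉ Q ∧ ∃ w ∈ Q, r v w ∧ adj v w}

/-- The endpoints of the edges between `U` and its complement. -/
def cutSet {α : Type u} (adj : α → α → Prop) (U : Set α) : Set α :=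
  {v | ∃ w, adj v w ∧ ¬ (v ∈ U ↔ w ∈ U)}

/-- The elements at distance at most `n` from `K`. -/
def closedNhd {α : Type u} (adj : α → α → Prop) (K : Set α) : ℕ → Set α
  | 0 => K
  | n + 1 => closedNhd adj K n ∪ {v | ∃ u ∈ closedNhd adj K n, adj u v}

/-- The part of `R` connected to `K` inside `R`. -/
def reach {α : Type u} (adj : α → α → Prop) (K R : Set α) : Set α :=
  {v | ∃ u ∈ K ∩ R, Relation.ReflTransGen (fun a b => adj a b ∧ b ∈ R) u v}

/-- `g` is additive on subsets of `V` without edges in between. -/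
def IsAdditive {α : Type u} (V : Set α) (adj : α → α → Prop) (g : Set α → ℝ≥0) : Prop :=
  ∀ A B : Set α, A ⊆ V → B ⊆ V → Disjoint A B → (∀ a ∈ A, ∀ b ∈ B, ¬ adj a b) →
    g (A ∪ B) = g A + g B

section Width

variable {α : Type u} {V U K : Set α} {adj r : α → α → Prop} {g : Set α → ℝ≥0}

theorem IsAdditive.empty (hg : IsAdditive V adj g) : g ∅ = 0 := by
  have := hg ∅ ∅ (by simp) (by simp) (by simp) (by simp)
  simpa using this

theorem closedNhd_mono (n : ℕ) : closedNhd adj K n ⊆ closedNhd adj K (n + 1) :=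
  Set.subset_union_left

theorem subset_closedNhd (n : ℕ) : K ⊆ closedNhd adj K n := by
  induction n with
  | zero => exact subset_rfl
  | succ n ih => exact ih.trans (closedNhd_mono n)

theorem reach_subset (R : Set α) : reach adj K R ⊆ R := by
  rintro v ⟨u, ⟨-, hu⟩, h⟩
  rcases h.cases_tail with rfl | ⟨_, -, h⟩
  · exact hu
  · exact h.2

theorem reach_step {R : Set α} {a b : α} (ha : a ∈ reach adj K R) (hab : adj a b) (hb : b ∈ R) :
    b ∈ reach adj K R := by
  obtain ⟨u, hu, h⟩ := ha
  exact ⟨u, hu, h.tail ⟨hab, hb⟩⟩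

/-- Until the reachable part is exhausted, each further unit of distance adds one of its vertices,
and there are at most `s` of them. -/
theorem reach_subset_closedNhd {R : Set α} (hR : R.Finite) {s : ℕ} (hs : R.ncard ≤ s) :
    reach adj K R ⊆ closedNhd adj K s := by
  by_contra hcon
  have hfin : (reach adj K R).Finite := hR.subset (reach_subset R)
  have key : ∀ n, n ≤ s → n + 1 ≤ (reach adj K R ∩ closedNhd adj K n).ncard := by
    intro n hn
    have hncon : ¬ reach adj K R ⊆ closedNhd adj K n := by
      intro h
      refine hcon (h.trans ?_)
      exact monotone_nat_of_le_succ closedNhd_mono hn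
    induction n with
    | zero =>
      obtain ⟨v, ⟨u, hu, -⟩, -⟩ := Set.not_subset.mp hncon
      have : u ∈ reach adj K R ∩ closedNhd adj K 0 := ⟨⟨u, hu, .refl⟩, hu.1⟩
      exact (Set.ncard_pos (hfin.subset Set.inter_subset_left)).mpr ⟨u, this⟩
    | succ n ih =>
      have h1 := ih (by omega) (fun h => hncon (h.trans (closedNhd_mono n)))
      refine lt_of_le_of_lt h1 (Set.ncard_lt_ncard ?_ (hfin.subset Set.inter_subset_left))
      refine ⟨Set.inter_subset_inter_right _ (closedNhd_mono n), fun hle => hncon ?_⟩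
      rintro v ⟨u, hu, hv⟩
      refine closedNhd_mono n ?_
      suffices v ∈ reach adj K R ∩ closedNhd adj K n from this.2
      induction hv with
      | refl => exact ⟨⟨u, hu, .refl⟩, subset_closedNhd n hu.1⟩
      | tail h1 h2 ih2 =>
        exact hle ⟨reach_step ih2.1 h2.1 h2.2, .inr ⟨_, ih2.2, h2.1⟩⟩
  have := key s le_rfl
  have h2 := Set.ncard_le_ncard (Set.inter_subset_left.trans (reach_subset R) :
    reach adj K R ∩ closedNhd adj K s ⊆ R) hR
  omega

/-- Replacing `R` by `R'` has the same effect on `g (R ∪ B)` for all sets `B` that are adjacent to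
`R` and `R'` only at `K`. -/
theorem IsAdditive.exchange (hg : IsAdditive V adj g) (hadj : ∀ a b, adj a b → adj b a) {s : ℕ}
    {R R' B B₁ : Set α} (hR : R ⊆ V) (hR' : R' ⊆ V) (hB : B ⊆ V) (hB₁ : B₁ ⊆ V) (hfin : V.Finite)
    (hs : R.ncard ≤ s) (hdisj : Disjoint (R ∪ R') (B ∪ B₁))
    (hcut : ∀ a ∈ R ∪ R', ∀ b ∈ B ∪ B₁, adj a b → a ∈ K)
    (hloc : ∀ a ∈ closedNhd adj K (s + 1), (a ∈ R ↔ a ∈ R'))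
    (hle : g (R' ∪ B₁) ≤ g (R ∪ B₁)) : g (R' ∪ B) ≤ g (R ∪ B) := by
  -- `Q` lies within distance `s` of `K`, and a neighbour of `Q` within distance `s + 1`, where `R`
  -- and `R'` agree. So `Q` is also the part of `R'` connected to `K`. No edge joins `R \ Q` or `R'
  -- \ Q` to `Q` or to `B ∪ B₁`, hence by additivity the comparison reduces to `g (R' \ Q) ≤ g (R \
  -- Q)`, in which `B` and `B₁` no longer occur.
  set Q := reach adj K R with hQ
  have hQR : Q ⊆ R := reach_subset R
  have hQn : Q ⊆ closedNhd adj K s := reach_subset_closedNhd (hfin.subset hR) hs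
  have hQR' : Q ⊆ R' := fun q hq => (hloc q (closedNhd_mono s (hQn hq))).mp (hQR hq)
  have hKQ : ∀ a ∈ K, a ∈ R ∪ R' → a ∈ Q := by
    intro a ha hm
    have := hloc a (subset_closedNhd _ ha)
    have haR : a ∈ R := by rcases hm with h | h <;> tauto
    exact ⟨a, ⟨ha, haR⟩, .refl⟩
  have hsplit : ∀ S, S ⊆ R ∪ R' → Q ⊆ S → (∀ a ∈ S, ∀ q ∈ Q, adj q a → a ∈ Q) →
      ∀ D, D ⊆ B ∪ B₁ → g (S ∪ D) = g (Q ∪ D) + g (S \ Q) := by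
    intro S hS hQS hSQ D hD
    have hSV : S ⊆ V := hS.trans (Set.union_subset hR hR')
    rw [← hg]
    · congr 1
      ext v
      have := @hQS v
      simp only [Set.mem_union, Set.mem_sdiff]
      tauto
    · exact Set.union_subset (hQS.trans hSV) (hD.trans (Set.union_subset hB hB₁))
    · exact Set.sdiff_subset.trans hSV
    · rw [Set.disjoint_left]
      rintro v (hv | hv) hv'
      · exact hv'.2 hv
      · exact Set.disjoint_left.mp hdisj (hS hv'.1) (hD hv)
    · rintro v (hv | hv) w hw hvw
      · exact hw.2 (hSQ w hw.1 v hv hvw)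
      · exact hw.2 (hKQ w (hcut w (hS hw.1) v (hD hv) (hadj _ _ hvw)) (hS hw.1))
  have h1 := hsplit R Set.subset_union_left hQR fun a ha q hq hqa => reach_step hq hqa ha
  have h2 := hsplit R' Set.subset_union_right hQR' fun a ha q hq hqa =>
    reach_step hq hqa ((hloc a (.inr ⟨q, hQn hq, hqa⟩)).mpr ha)
  rw [h1 B Set.subset_union_left, h2 B Set.subset_union_left]
  rw [h1 B₁ Set.subset_union_right, h2 B₁ Set.subset_union_right] at hle
  have := le_of_add_le_add_left hle
  gcongr

/-- The separator is a chain, because each of its elements lies above all of `Q`. It is contained in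
the bag of its lowest element. -/
theorem ncard_separator_le (h : IsTreeOrder V r) (hV : V.Finite) {Q : Set α} (hQV : Q ⊆ V) {s : ℕ}
    (hbag : ∀ u ∈ V, (orderBag adj r u).ncard ≤ s)
    (hQ : ∀ z ∉ Q, ∀ a ∈ Q, ∀ b ∈ Q, r z a → r z b) : (separator adj r Q).ncard ≤ s := by
  have hsub : separator adj r Q ⊆ V := fun v ⟨_, w, hw, hvw, _⟩ => h.mem_left hvw (hQV hw)
  rcases (separator adj r Q).eq_empty_or_nonempty with he | hne
  · simp [he]
  obtain ⟨m, hm, hmax⟩ := exists_isGreatest_of_chain h (hV.subset hsub) hne (by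
    rintro a ⟨ha, wa, hwa, haw, -⟩ b ⟨hb, wb, hwb, hbw, -⟩
    exact h.chain (hQ a ha wa hwa wb hwb haw) hbw)
  refine (Set.ncard_le_ncard ?_ (hV.subset ?_)).trans (hbag m (hsub hm))
  · rintro v ⟨hv, w, hw, hvw, hadj⟩
    obtain ⟨hm', wm, hwm, hmw, -⟩ := id hm
    exact .inr ⟨hmax v ⟨hv, w, hw, hvw, hadj⟩, w, hQ m hm' wm hwm w hw hmw, hadj⟩
  · rintro v (rfl | ⟨hv, -⟩)
    · exact hsub hm
    · exact h.mem_left hv (hsub hm)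

variable {X Y Z : Set α}

theorem orderBag_subset (h : IsTreeOrder V r) {w : α} (hw : w ∈ V) : orderBag adj r w ⊆ V := by
  rintro v (rfl | ⟨hv, -⟩)
  · exact hw
  · exact h.mem_left hv hw

theorem separator_subset (h : IsTreeOrder V r) {Q : Set α} (hQ : Q ⊆ V) :
    separator adj r Q ⊆ V := fun _ ⟨_, _, hw, hvw, _⟩ => h.mem_left hvw (hQ hw)

/-- The common part of the two cases in which the exchange affects a bag. -/
theorem IsAdditive.bag_le (hg : IsAdditive V adj g) (hadj : ∀ a b, adj a b → adj b a)
    (hV : V.Finite) {s : ℕ} {S S' T T' D : Set α} (hS : S ⊆ V) (hS' : S' ⊆ V) (hT : T ⊆ V)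
    (hs : S.ncard ≤ s) (hD : ∀ a b, adj a b → (a ∈ D ↔ b ∉ D) → a ∈ K)
    (h1 : T ∩ D = S ∩ D) (h2 : T' ∩ D = S' ∩ D) (h3 : T ∩ Dᶜ = T' ∩ Dᶜ) (h4 : S ∩ Dᶜ = S' ∩ Dᶜ)
    (hloc : ∀ a ∈ closedNhd adj K (s + 1), (a ∈ S ↔ a ∈ S'))
    (hle : g S' ≤ g S) : g T' ≤ g T := by
  have e : ∀ A : Set α, A = A ∩ D ∪ A ∩ Dᶜ := fun A => (Set.inter_union_compl A D).symm
  have := hg.exchange (K := K) hadj (s := s) (R := S ∩ D) (R' := S' ∩ D) (B := T ∩ Dᶜ)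
    (B₁ := S ∩ Dᶜ) (Set.inter_subset_left.trans hS) (Set.inter_subset_left.trans hS')
    (Set.inter_subset_left.trans hT) (Set.inter_subset_left.trans hS) hV
    ((Set.ncard_le_ncard Set.inter_subset_left (hV.subset hS)).trans hs)
    (by
      rw [Set.disjoint_left]
      rintro v (hv | hv) (hv' | hv') <;> exact hv'.2 hv.2)
    (by
      rintro a ha b hb hab
      refine hD a b hab ?_
      have h1 : a ∈ D := ha.elim (fun h => h.2) (fun h => h.2)
      have h2 : b ∉ D := hb.elim (fun h => h.2) (fun h => h.2)
      tauto)
    (fun a ha => by have := hloc a ha; simp only [Set.mem_inter_iff]; tauto)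
    (by rw [← e S, h4, ← e S']; exact hle)
  rwa [← h1, ← e T, ← h2, h3, ← e T'] at this

set_option maxHeartbeats 1000000 in
/-- The exchange of `X` and `Y` does not increase the width, provided that `X` and `Y` are on
different sides of `U` and far from the cut, and that the separators have suitable values. -/
theorem IsStack.width_exchange (h : IsTreeOrder V r) (st : IsStack V r X Y Z) (hV : V.Finite)
    (hg : IsAdditive V adj g) (hadj : ∀ a b, adj a b → adj b a) {s : ℕ} {k : ℝ≥0}
    (hbag : ∀ u ∈ V, (orderBag adj r u).ncard ≤ s) (hk : ∀ u ∈ V, g (orderBag adj r u) ≤ k)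
    {p : Prop} (hX : ∀ x ∈ X, (x ∈ U ↔ p)) (hY : ∀ y ∈ Y, (y ∈ U ↔ ¬ p))
    (hfar : ∀ v ∈ X ∪ Y, v ∉ closedNhd adj (cutSet adj U) (s + 2))
    (h1 : (∃ a ∈ X, ∃ b ∈ Y ∪ Z, r a b) → g (separator adj r Z) ≤ g (separator adj r (Y ∪ Z)))
    (h2 : (∃ a ∈ Y, ∃ b ∈ Z, r a b) →
      g (separator adj r (X ∪ Y ∪ Z)) ≤ g (separator adj r (Y ∪ Z))) :
    ∀ u ∈ V, g (orderBag adj (exchange r X Y Z) u) ≤ k := by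
  have nm := fun a => st.notMem (a := a)
  have hYZ : Y ∪ Z ⊆ V :=
    fun v hv => st.subset (by rcases hv with hv | hv; exacts [.inl (.inr hv), .inr hv])
  have hZ : Z ⊆ V := fun v hv => st.subset (.inr hv)
  have hK : ∀ a b, adj a b → ¬ (a ∈ U ↔ b ∈ U) → a ∈ cutSet adj U := fun a b hab hu => ⟨b, hab, hu⟩
  have hfar0 : ∀ v ∈ X ∪ Y, ∀ w, adj v w → (v ∈ U ↔ w ∈ U) := by
    intro v hv w hvw
    by_contra hcon
    exact hfar v hv (subset_closedNhd _ ⟨w, hvw, hcon⟩)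
  have hX' : ∀ v, ∀ x ∈ X, adj v x → (v ∈ U ↔ p) := fun v x hx hvx => by
    rw [← hX x hx, hfar0 x (.inl hx) v (hadj _ _ hvx)]
  have hY' : ∀ v, ∀ x ∈ Y, adj v x → (v ∈ U ↔ ¬ p) := fun v x hx hvx => by
    rw [← hY x hx, hfar0 x (.inr hx) v (hadj _ _ hvx)]
  -- This accounts for the radius `s + 2`: up to distance `s + 1` no vertex lies in `X ∪ Y` or has a
  -- neighbour there, so the separators of `Z`, `Y ∪ Z` and `X ∪ Y ∪ Z` agree up to that distance.
  have hnear : ∀ v ∈ closedNhd adj (cutSet adj U) (s + 1), v ∉ X ∧ v ∉ Y ∧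
      ∀ w, adj v w → w ∉ X ∧ w ∉ Y := by
    intro v hv
    refine ⟨fun hx => hfar v (.inl hx) (.inl hv), fun hx => hfar v (.inr hx) (.inl hv),
      fun w hw => ⟨fun hx => hfar w (.inl hx) (.inr ⟨v, hv, hw⟩),
        fun hx => hfar w (.inr hx) (.inr ⟨v, hv, hw⟩)⟩⟩
  have hsep : (separator adj r (Y ∪ Z)).ncard ≤ s := by
    refine ncard_separator_le h hV hYZ hbag ?_
    intro z hz a ha b hb hza
    by_cases hzX : z ∈ X
    · exact st.belowX z hzX a ha b hb hza
    · refine st.above z ?_ a ?_ b ?_ hza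
      · simp only [Set.mem_union] at hz ⊢; tauto
      · simp only [Set.mem_union] at ha ⊢; tauto
      · simp only [Set.mem_union] at hb ⊢; tauto
  -- `D` is the colour of `Y`. The vertices of `Y` and their neighbours are in `D`, those of `X` and
  -- their neighbours are not.
  set D : Set α := {v | v ∈ U ↔ ¬ p} with hDdef
  have hDK : ∀ a b, adj a b → (a ∈ D ↔ b ∉ D) → a ∈ cutSet adj U := by
    intro a b hab hd
    refine hK a b hab fun hu => ?_
    simp only [hDdef, Set.mem_ofPred_eq] at hd
    tauto
  have hXD : ∀ x ∈ X, x ∉ D := fun x hx hd => by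
    have := hX x hx
    simp only [hDdef, Set.mem_ofPred_eq] at hd
    tauto
  have hYD : ∀ x ∈ Y, x ∈ D := fun x hx => hY x hx
  have hX'D : ∀ v, ∀ x ∈ X, adj v x → v ∉ D := fun v x hx hvx hd => by
    have := hX' v x hx hvx
    simp only [hDdef, Set.mem_ofPred_eq] at hd
    tauto
  have hY'D : ∀ v, ∀ x ∈ Y, adj v x → v ∈ D := fun v x hx hvx => hY' v x hx hvx
  clear_value D
  intro u hu
  have cl : ∀ a b, r a b → a ∈ X ∪ Y ∪ Z → b ∈ X ∪ Y ∪ Z := fun a b hab ha => st.closed a ha b hab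
  have clZ : ∀ a b, r a b → a ∈ Z → b ∈ Z := fun a b hab ha => st.closedZ a ha b hab
  have hab := st.above
  have hbX := st.belowX
  have hbY := st.belowY
  have hnl := st.not_le
  have htr : ∀ a b c, r a b → r b c → r a c := fun a b c => h.trans
  have hbagV : orderBag adj r u ⊆ V := orderBag_subset h hu
  have hS : separator adj r (Y ∪ Z) ⊆ V := separator_subset h hYZ
  clear hfar hfar0 hX' hY' hK
  simp only [Set.mem_union] at cl hab hbX hX hY
  by_cases huX : u ∈ X
  · by_cases hex : ∃ b ∈ Y ∪ Z, r u b
    · obtain ⟨b, hb, hub⟩ := hex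
      -- For `u` in the spine of `X`, the bag coincides inside `D` with the separator of `Y ∪ Z`
      -- before the exchange and with that of `Z` after it. Outside `D` the bag does not change, nor
      -- do the two separators differ.
      refine (hg.bag_le (D := D) hadj hV (T := orderBag adj r u)
        (S := separator adj r (Y ∪ Z))
        hS (separator_subset h hZ) hbagV hsep hDK ?_ ?_ ?_ ?_ ?_
        (h1 ⟨u, huX, b, hb, hub⟩)).trans (hk u hu)
      · ext v
        constructor
        · rintro ⟨hv | ⟨hvu, w, huw, hvw⟩, hvD⟩
          · grind
          · refine ⟨⟨?_, w, ?_, htr _ _ _ hvu huw, hvw⟩, hvD⟩ <;> grind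
        · rintro ⟨⟨hv, w, hw, hvw, ha⟩, hvD⟩
          refine ⟨.inr ⟨?_, w, ?_, ha⟩, hvD⟩
          · refine hab v ?_ w ?_ u ?_ hvw <;> grind
          · exact hbX u huX b hb w hw hub
      · ext v
        constructor
        · rintro ⟨hv | ⟨hvu, w, huw, hvw⟩, hvD⟩
          · grind
          · have hw : w ∈ Z ∧ r u w := by grind [exchange]
            refine ⟨⟨?_, w, hw.1, ?_, hvw⟩, hvD⟩ <;> grind [exchange]
        · rintro ⟨⟨hv, w, hw, hvw, ha⟩, hvD⟩
          refine ⟨.inr ⟨?_, w, .inl ⟨hbX u huX b hb w (.inr hw) hub, by grind⟩, ha⟩, hvD⟩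
          by_cases hvY : v ∈ Y
          · exact .inr ⟨hvY, huX, w, hw, hvw⟩
          · refine .inl ⟨hab v ?_ w ?_ u ?_ hvw, ?_⟩ <;> grind
      · ext v
        constructor
        · rintro ⟨hv | ⟨hvu, w, huw, hvw⟩, hvD⟩
          · exact ⟨.inl hv, hvD⟩
          · refine ⟨.inr ⟨.inl ⟨hvu, ?_⟩, w, .inl ⟨huw, ?_⟩, hvw⟩, hvD⟩ <;> grind
        · rintro ⟨hv | ⟨hvu, w, huw, hvw⟩, hvD⟩
          · exact ⟨.inl hv, hvD⟩
          · refine ⟨.inr ⟨?_, w, ?_, hvw⟩, hvD⟩ <;> grind [exchange]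
      · ext v
        constructor
        · rintro ⟨⟨hv, w, hw, hvw, ha⟩, hvD⟩
          refine ⟨⟨?_, w, ?_, hvw, ha⟩, hvD⟩ <;> grind
        · rintro ⟨⟨hv, w, hw, hvw, ha⟩, hvD⟩
          refine ⟨⟨?_, w, ?_, hvw, ha⟩, hvD⟩ <;> grind
      · intro a ha
        have := hnear a ha
        constructor
        · rintro ⟨hv, w, hw, hvw, ha⟩
          refine ⟨?_, w, ?_, hvw, ha⟩ <;> grind
        · rintro ⟨hv, w, hw, hvw, ha⟩
          refine ⟨?_, w, ?_, hvw, ha⟩ <;> grind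
    · suffices orderBag adj (exchange r X Y Z) u = orderBag adj r u from this ▸ hk u hu
      push Not at hex
      ext v
      constructor
      · rintro (hv | ⟨hvu, w, huw, hvw⟩)
        · exact .inl hv
        · refine .inr ⟨?_, w, ?_, hvw⟩ <;> grind [exchange]
      · rintro (hv | ⟨hvu, w, huw, hvw⟩)
        · exact .inl hv
        · refine .inr ⟨.inl ⟨hvu, ?_⟩, w, .inl ⟨huw, ?_⟩, hvw⟩ <;> grind
  by_cases huY : u ∈ Y
  · by_cases hex : ∃ b ∈ Z, r u b
    · obtain ⟨b, hb, hub⟩ := hex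
      -- For `u` in the spine of `Y` the colours swap roles: within `Dᶜ` the bag passes from the
      -- separator of `Y ∪ Z` to that of `X ∪ Y ∪ Z`, since `u` now lies above `X` as well.
      refine (hg.bag_le (K := cutSet adj U) (D := Dᶜ) hadj hV (T := orderBag adj r u) (S := separator adj r (Y ∪ Z))
        hS (separator_subset h st.subset) hbagV hsep ?_ ?_ ?_ ?_ ?_ ?_
        (h2 ⟨u, huY, b, hb, hub⟩)).trans (hk u hu)
      · intro a b hab hd
        refine hDK a b hab ?_
        simp only [Set.mem_compl_iff] at hd
        tauto
      · ext v
        constructor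
        · rintro ⟨hv | ⟨hvu, w, huw, hvw⟩, hvD⟩
          · grind
          · refine ⟨⟨?_, w, ?_, htr _ _ _ hvu huw, hvw⟩, hvD⟩ <;> grind
        · rintro ⟨⟨hv, w, hw, hvw, ha⟩, hvD⟩
          have hwZ : w ∈ Z := by grind
          refine ⟨.inr ⟨?_, w, hbY u huY b hb w hwZ hub, ha⟩, hvD⟩
          by_cases hvX : v ∈ X
          · exact hbX v hvX w hw u (.inl huY) hvw
          · refine hab v ?_ w ?_ u ?_ hvw <;> grind
      · ext v
        constructor
        · rintro ⟨hv | ⟨hvu, w, huw, hvw⟩, hvD⟩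
          · grind
          · have hv' : r v u ∧ v ∉ X ∧ v ∉ Y ∧ v ∉ Z := by grind [exchange]
            have hw : w ∈ X ∪ Y ∪ Z := by
              simp only [Set.mem_union]
              grind [exchange]
            refine ⟨⟨by grind, w, hw, ?_, hvw⟩, hvD⟩
            exact st.above v (by grind) u (by grind) w hw hv'.1
        · rintro ⟨⟨hv, w, hw, hvw, ha⟩, hvD⟩
          have hvu := st.above v hv w hw u (by grind) hvw
          refine ⟨.inr ⟨.inl ⟨hvu, by grind⟩, w, ?_, ha⟩, hvD⟩
          by_cases hwX : w ∈ X
          · exact .inr ⟨huY, hwX, b, hb, hub⟩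
          · exact .inl ⟨hbY u huY b hb w (by grind) hub, by grind⟩
      · rw [compl_compl]
        ext v
        constructor
        · rintro ⟨hv | ⟨hvu, w, huw, hvw⟩, hvD⟩
          · exact ⟨.inl hv, hvD⟩
          · refine ⟨.inr ⟨.inl ⟨hvu, ?_⟩, w, .inl ⟨huw, ?_⟩, hvw⟩, hvD⟩ <;> grind
        · rintro ⟨hv | ⟨hvu, w, huw, hvw⟩, hvD⟩
          · exact ⟨.inl hv, hvD⟩
          · refine ⟨.inr ⟨?_, w, ?_, hvw⟩, hvD⟩ <;> grind [exchange]
      · rw [compl_compl]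
        ext v
        constructor
        · rintro ⟨⟨hv, w, hw, hvw, ha⟩, hvD⟩
          refine ⟨⟨?_, w, ?_, hvw, ha⟩, hvD⟩ <;> grind
        · rintro ⟨⟨hv, w, hw, hvw, ha⟩, hvD⟩
          refine ⟨⟨?_, w, ?_, hvw, ha⟩, hvD⟩ <;> grind
      · intro a ha
        have := hnear a ha
        constructor
        · rintro ⟨hv, w, hw, hvw, ha⟩
          refine ⟨?_, w, ?_, hvw, ha⟩ <;> grind
        · rintro ⟨hv, w, hw, hvw, ha⟩
          refine ⟨?_, w, ?_, hvw, ha⟩ <;> grind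
    · suffices orderBag adj (exchange r X Y Z) u = orderBag adj r u from this ▸ hk u hu
      push Not at hex
      ext v
      constructor
      · rintro (hv | ⟨hvu, w, huw, hvw⟩)
        · exact .inl hv
        · refine .inr ⟨?_, w, ?_, hvw⟩ <;> grind [exchange]
      · rintro (hv | ⟨hvu, w, huw, hvw⟩)
        · exact .inl hv
        · refine .inr ⟨.inl ⟨hvu, ?_⟩, w, .inl ⟨huw, ?_⟩, hvw⟩ <;> grind
  · suffices orderBag adj (exchange r X Y Z) u = orderBag adj r u from this ▸ hk u hu
    have e1 : ∀ v, exchange r X Y Z v u ↔ r v u := by grind [exchange]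
    have e2 : ∀ v, exchange r X Y Z u v ↔ r u v := by grind [exchange]
    simp only [orderBag, e1, e2]

end Width

/-! ### Reduced tree orders -/

theorem ncard_image_le_of_factors {α β : Type*} {S : Set α} (hS : S.Finite) {f h : α → β}
    (hfac : ∀ v ∈ S, ∀ w ∈ S, f v = f w → h v = h w) : (h '' S).ncard ≤ (f '' S).ncard := by
  rcases S.eq_empty_or_nonempty with rfl | ⟨a₀, ha₀⟩
  · simp
  classical
  have hφ : ∀ A : β, ∃ v, A ∈ f '' S → v ∈ S ∧ f v = A := fun A => by
    by_cases hA : A ∈ f '' S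
    · obtain ⟨v, hv, rfl⟩ := hA
      exact ⟨v, fun _ => ⟨hv, rfl⟩⟩
    · exact ⟨a₀, fun h => absurd h hA⟩
  choose φ hφ using hφ
  have : h '' S ⊆ (h ∘ φ) '' (f '' S) := by
    rintro _ ⟨v, hv, rfl⟩
    have := hφ (f v) ⟨v, hv, rfl⟩
    exact ⟨f v, ⟨v, hv, rfl⟩, hfac _ this.1 _ hv this.2⟩
  exact (Set.ncard_le_ncard this ((hS.image f).image _)).trans (Set.ncard_image_le (hS.image f))

theorem ncard_image_lt_of_factors {α β : Type*} {S : Set α} (hS : S.Finite) {f h : α → β}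
    (hfac : ∀ v ∈ S, ∀ w ∈ S, f v = f w → h v = h w) {v w : α} (hv : v ∈ S) (hw : w ∈ S)
    (hf : f v ≠ f w) (hh : h v = h w) : (h '' S).ncard < (f '' S).ncard := by
  set S' := {x ∈ S | f x ≠ f v} with hS'
  have h1 : h '' S ⊆ h '' S' := by
    rintro _ ⟨x, hx, rfl⟩
    by_cases hxv : f x = f v
    · exact ⟨w, ⟨hw, hf.symm⟩, by rw [← hh, hfac x hx v hv hxv]⟩
    · exact ⟨x, ⟨hx, hxv⟩, rfl⟩
  have hS'f : S'.Finite := hS.subset fun x hx => hx.1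
  have h2 := ncard_image_le_of_factors hS'f fun x hx y hy => hfac x hx.1 y hy.1
  refine (Set.ncard_le_ncard h1 (hS'f.image h)).trans_lt (h2.trans_lt ?_)
  refine Set.ncard_lt_ncard ⟨Set.image_mono fun x hx => hx.1, fun hsub => ?_⟩ (hS.image f)
  obtain ⟨x, hx, hxv⟩ := hsub ⟨v, hv, rfl⟩
  exact hx.2 hxv

/-- `r` is the ancestor relation of an elimination forest of width at most `k` whose trees are
contained in connected components. -/
structure IsGood {α : Type u} (V : Set α) (adj : α → α → Prop) (g : Set α → ℝ≥0) (k : ℝ≥0)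
    (r : α → α → Prop) : Prop where
  order : IsTreeOrder V r
  elim : ∀ a b, adj a b → r a b ∨ r b a
  width : ∀ u ∈ V, g (orderBag adj r u) ≤ k
  conn : ∀ a b, r a b → Relation.ReflTransGen adj a b

/-- The hypotheses under which `X` and `Y` may be exchanged; `p` says that `X` is contained in `U`,
and `Y` is then disjoint from `U`. -/
structure IsMove {α : Type u} (V U : Set α) (adj : α → α → Prop) (g : Set α → ℝ≥0) (s : ℕ)
    (r : α → α → Prop) (X Y Z : Set α) (p : Prop) : Prop where
  stack : IsStack V r X Y Z
  colorX : ∀ x ∈ X, (x ∈ U ↔ p)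
  colorY : ∀ y ∈ Y, (y ∈ U ↔ ¬ p)
  far : ∀ v ∈ X ∪ Y, v ∉ closedNhd adj (cutSet adj U) (s + 2)
  satX : ∀ v ∈ X, cls V r U v ⊆ X
  satY : ∀ v ∈ Y, cls V r U v ⊆ Y
  -- The two value conditions say that the separator between `X` and `Y` is a weak local maximum.
  -- Each is needed only if the corresponding part has a spine, since otherwise none of its bags
  -- change.
  valueX : (∃ a ∈ X, ∃ b ∈ Y ∪ Z, r a b) → g (separator adj r Z) ≤ g (separator adj r (Y ∪ Z))
  valueY : (∃ a ∈ Y, ∃ b ∈ Z, r a b) →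
    g (separator adj r (X ∪ Y ∪ Z)) ≤ g (separator adj r (Y ∪ Z))
  conn : (∃ a ∈ Y, ∃ b ∈ Z, r a b) → ∃ c, ∀ n ∈ X ∪ Y, r c n

/-- No move merges two maximal factors of `U` or of its complement, and no move only removes
relations. -/
def IsExchangeReduced {α : Type u} (V U : Set α) (adj : α → α → Prop) (g : Set α → ℝ≥0) (s : ℕ)
    (r : α → α → Prop) : Prop :=
  ∀ X Y Z p, IsMove V U adj g s r X Y Z p →
    (∀ v ∈ V, ∀ w ∈ V, cls V (exchange r X Y Z) U v = cls V (exchange r X Y Z) U w →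
      cls V r U v = cls V r U w) ∧
    ((∀ a ∈ Y, ∀ b ∈ Z, ¬ r a b) → ∀ a ∈ X, ∀ b ∈ Y, ¬ r a b)

section Reduced

variable {α : Type u} {V U : Set α} {adj r : α → α → Prop} {g : Set α → ℝ≥0} {X Y Z : Set α}
  {s : ℕ} {k : ℝ≥0} {p : Prop}

/-- No edge joins `X` to `Y`, as such an edge would put its ends into the cut, so the deleted
relations are not needed for any edge. A new relation between `Y` and `X` stays inside a connected
component because of the common ancestor in `conn`. -/
theorem IsMove.isGood (m : IsMove V U adj g s r X Y Z p) (hr : IsGood V adj g k r) (hV : V.Finite)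
    (hg : IsAdditive V adj g) (hadj : ∀ a b, adj a b → adj b a)
    (hs : ∀ S ⊆ V, g S ≤ k → S.ncard ≤ s) : IsGood V adj g k (exchange r X Y Z) where
  order := m.stack.isTreeOrder_exchange hr.order
  width := m.stack.width_exchange hr.order hV hg hadj
    (fun u hu => hs _ (orderBag_subset hr.order hu) (hr.width u hu)) hr.width m.colorX m.colorY
    m.far m.valueX m.valueY
  elim a b hab := by
    have key : ∀ a b, adj a b → ¬ (a ∈ X ∧ b ∈ Y) := by
      rintro a b hab ⟨ha, hb⟩
      refine m.far a (.inl ha) (subset_closedNhd _ ⟨b, hab, fun h => ?_⟩)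
      have h1 := m.colorX a ha
      have h2 := m.colorY b hb
      tauto
    exact (hr.elim a b hab).imp (fun h => .inl ⟨h, key a b hab⟩)
      fun h => .inl ⟨h, key b a (hadj _ _ hab)⟩
  conn a b hab := by
    rcases hab with ⟨hab, -⟩ | ⟨haY, hbX, z, hz, haz⟩
    · exact hr.conn a b hab
    · obtain ⟨c, hc⟩ := m.conn ⟨a, haY, z, hz, haz⟩
      have : Std.Symm adj := ⟨hadj⟩
      have h1 := hr.conn c a (hc a (.inr haY))
      exact (Std.Symm.symm _ _ h1 : Relation.ReflTransGen adj a c).trans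
        (hr.conn c b (hc b (.inl hbX)))

/-- `X` and `Y` are unions of classes, so a monochromatic factor meeting one of them lies inside it.
Thus moves can merge classes but never break them up. -/
theorem IsMove.isFac (m : IsMove V U adj g s r X Y Z p) {B : Set α}
    (hB : IsFac V r B) (hU : Monochromatic U B) : IsFac V (exchange r X Y Z) B :=
  m.stack.isFac_exchange hB (fun ⟨v, hv, hvX⟩ => (subset_cls hB hU hv).trans (m.satX v hvX))
    (fun ⟨v, hv, hvY⟩ => (subset_cls hB hU hv).trans (m.satY v hvY))

theorem cls_subset_cls (h : IsTreeOrder V r) (hV : V.Finite) {r' : α → α → Prop} {v : α}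
    (hv : v ∈ V) (hfac : IsFac V r' (cls V r U v)) : cls V r U v ⊆ cls V r' U v :=
  subset_cls hfac (cls_spec hV h hv).2.1 (mem_cls_self hV h hv)

theorem cls_eq_of_cls_subset (h : IsTreeOrder V r) {r' : α → α → Prop}
    (h' : IsTreeOrder V r') (hV : V.Finite) {v w : α} (hv : v ∈ V) (hw : w ∈ V)
    (hsub : cls V r U v ⊆ cls V r' U v) (heq : cls V r U v = cls V r U w) :
    cls V r' U v = cls V r' U w :=
  (cls_eq hV h' hv (hsub (heq ▸ mem_cls_self hV h hw))).symm

/-- Among the good orders for which each member of a family `𝒰` of sets, contained in or disjoint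
from `U`, has at most `Γ` maximal factors, there is a reduced one. -/
theorem exists_isExchangeReduced (hV : V.Finite) (hg : IsAdditive V adj g)
    (hadj : ∀ a b, adj a b → adj b a) (hs : ∀ S ⊆ V, g S ≤ k → S.ncard ≤ s) {𝒰 : Set (Set α)}
    {Γ : ℕ} (hlam : ∀ U' ∈ 𝒰, U' ⊆ V ∧ (U' ⊆ U ∨ Disjoint U' U))
    (hex : ∃ r, IsGood V adj g k r ∧ ∀ U' ∈ 𝒰, (cls V r U' '' U').ncard ≤ Γ) :
    ∃ r, (IsGood V adj g k r ∧ ∀ U' ∈ 𝒰, (cls V r U' '' U').ncard ≤ Γ) ∧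
      IsExchangeReduced V U adj g s r := by
  -- The first component drops when a move merges classes. The second, the number of relations,
  -- drops when a move deletes relations without adding any.
  let μ : (α → α → Prop) → ℕ ×ₗ ℕ := fun r => toLex ((cls V r U '' V).ncard,
    {q : α × α | q.1 ∈ V ∧ q.2 ∈ V ∧ r q.1 q.2}.ncard)
  obtain ⟨r, hr, hmin⟩ := (InvImage.wf μ wellFounded_lt).has_min
    {r | IsGood V adj g k r ∧ ∀ U' ∈ 𝒰, (cls V r U' '' U').ncard ≤ Γ} hex
  refine ⟨r, hr, fun X Y Z p m => ?_⟩
  have ho := hr.1.order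
  have hgood := m.isGood hr.1 hV hg hadj hs
  have ho' := hgood.order
  set r' := exchange r X Y Z with hr'
  have hsub : ∀ U', (∀ v ∈ V, Monochromatic U (cls V r U' v) → cls V r U' v ⊆ cls V r' U' v) :=
    fun U' v hv hm => cls_subset_cls ho hV hv (m.isFac (cls_spec hV ho hv).1 hm)
  -- A class of `U'` contained in `U'` is also monochromatic for `U`, because `U'` lies inside `U`
  -- or is disjoint from it. So it survives the move as a factor.
  have hadm : ∀ U' ∈ 𝒰, (cls V r' U' '' U').ncard ≤ Γ := by
    intro U' hU'
    obtain ⟨hU'V, hl⟩ := hlam U' hU'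
    refine (ncard_image_le_of_factors (hV.subset hU'V) fun v hv w hw heq => ?_).trans (hr.2 U' hU')
    refine cls_eq_of_cls_subset ho ho' hV (hU'V hv) (hU'V hw) (hsub U' v (hU'V hv) ?_) heq
    have hc : cls V r U' v ⊆ U' := fun w hw =>
      ((cls_spec hV ho (hU'V hv)).2.1 v (mem_cls_self hV ho (hU'V hv)) w hw).mp hv
    intro a ha b hb
    rcases hl with hl | hl
    · exact iff_of_true (hl (hc ha)) (hl (hc hb))
    · exact iff_of_false (Set.disjoint_left.mp hl (hc ha)) (Set.disjoint_left.mp hl (hc hb))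
  have hnot := hmin r' ⟨hgood, hadm⟩
  have hfac : ∀ v ∈ V, ∀ w ∈ V, cls V r U v = cls V r U w → cls V r' U v = cls V r' U w :=
    fun v hv w hw heq => cls_eq_of_cls_subset ho ho' hV hv hw
      (hsub U v hv (cls_spec hV ho hv).2.1) heq
  refine ⟨fun v hv w hw heq => ?_, fun hYZ a ha b hb hab => ?_⟩
  · by_contra hne
    exact hnot (Prod.Lex.toLex_lt_toLex.mpr
      (.inl (ncard_image_lt_of_factors hV hfac hv hw hne heq)))
  · refine hnot (Prod.Lex.toLex_lt_toLex.mpr ?_)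
    rcases (ncard_image_le_of_factors hV hfac).lt_or_eq with hlt | heq
    · exact .inl hlt
    refine .inr ⟨heq, Set.ncard_lt_ncard ⟨?_, fun hle => ?_⟩ ?_⟩
    · rintro ⟨x, y⟩ ⟨hx, hy, hxy⟩
      refine ⟨hx, hy, ?_⟩
      rcases hxy with hxy | ⟨hxY, -, z, hz, hxz⟩
      · exact hxy.1
      · exact absurd hxz (hYZ x hxY z hz)
    · have hab' : (a, b) ∈ {q : α × α | q.1 ∈ V ∧ q.2 ∈ V ∧ r' q.1 q.2} :=
        hle ⟨m.stack.subset (.inl (.inl ha)), m.stack.subset (.inl (.inr hb)), hab⟩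
      rcases hab'.2.2 with h | ⟨haY, -⟩
      · exact h.2 ⟨ha, hb⟩
      · exact (m.stack.notMem.1 ha).1 haY
    · exact (hV.prod hV).subset fun q hq => ⟨hq.1, hq.2.1⟩

end Reduced

/-! ### The structure of reduced tree orders -/

/-- `x` is the least element of a maximal factor that contains no element of `W`, and `W'` consists
of the elements of `W` below `x`. -/
structure IsChainTop {α : Type u} (V : Set α) (r : α → α → Prop) (U W W' : Set α) (x : α) :
    Prop where
  mem : x ∈ V
  least : ∀ b ∈ cls V r U x, r x b
  avoid : ∀ b ∈ cls V r U x, b ∉ W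
  eq : ∀ w ∈ W, (r x w ↔ w ∈ W')

/-- `x` and `y` are consecutive among the elements satisfying `IsChainTop`. -/
structure IsConsecutive {α : Type u} (V : Set α) (r : α → α → Prop) (U W W' : Set α) (x y : α) :
    Prop where
  left : IsChainTop V r U W W' x
  right : IsChainTop V r U W W' y
  le : r x y
  ne : x ≠ y
  between : ∀ z, IsChainTop V r U W W' z → r x z → r z y → z = x ∨ z = y

section Structure

variable {α : Type u} {V U W W' : Set α} {adj r : α → α → Prop} {g : Set α → ℝ≥0} {s : ℕ}

theorem strictBelow_cls (h : IsTreeOrder V r) (hV : V.Finite) {v z : α} (hv : v ∈ V)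
    (hz : z ∈ strictBelow r (cls V r U v)) : cls V r U z ⊆ strictBelow r (cls V r U v) := by
  have hA := (cls_spec (U := U) hV h hv).1
  have hzV : z ∈ V := hA.strictBelow_subset h hz
  obtain ⟨x, hx, hxA⟩ := hA.least_of_strictBelow ⟨z, hz⟩
  have hne : ∀ w ∈ cls V r U z, w ∉ cls V r U v := by
    intro w hw hwv
    have := (cls_eq hV h hv hwv).symm.trans (cls_eq hV h hzV hw)
    exact hz.1 (this ▸ mem_cls_self hV h hzV)
  have hxz := ((IsFac.mem_strictBelow_iff h hx hxA).mp hz).2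
  intro w hw
  refine (IsFac.mem_strictBelow_iff h hx hxA).mpr ⟨hne w hw, ?_⟩
  exact (cls_spec hV h hzV).1.above x (fun hxz => hne x hxz hx) z (mem_cls_self hV h hzV) w hw hxz

theorem mem_iff_of_mem_cls (h : IsTreeOrder V r) (hV : V.Finite) {v w : α} (hv : v ∈ V)
    (hw : w ∈ cls V r U v) : w ∈ U ↔ v ∈ U :=
  (cls_spec hV h hv).2.1 w hw v (mem_cls_self hV h hv)

theorem cls_closed {v : α} (he : strictBelow r (cls V r U v) = ∅) {a b : α}
    (ha : a ∈ cls V r U v) (hab : r a b) : b ∈ cls V r U v := by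
  by_contra hb
  have : b ∈ strictBelow r (cls V r U v) := ⟨hb, a, ha, hab⟩
  simp [he] at this

/-- A maximal factor closed under descendants directly below another maximal factor has the other
colour. -/
theorem color_ne_of_strictBelow (h : IsTreeOrder V r) (hV : V.Finite) {v z : α} (hv : v ∈ V)
    (hz : z ∈ strictBelow r (cls V r U v)) (hcl : strictBelow r (cls V r U z) = ∅)
    (hup : ∀ z' ∈ strictBelow r (cls V r U v), ∀ b ∈ cls V r U z, r z' b → z' ∈ cls V r U z) :
    ¬ (z ∈ U ↔ v ∈ U) := by
  intro hcol
  obtain ⟨hA, hAm, hvA⟩ := cls_spec (U := U) hV h hv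
  have hzV : z ∈ V := hA.strictBelow_subset h hz
  obtain ⟨hB, hBm, hzB⟩ := cls_spec (U := U) hV h hzV
  obtain ⟨x, hx, hxA⟩ := hA.least_of_strictBelow ⟨z, hz⟩
  have hsub := strictBelow_cls h hV hv hz
  have hxle : ∀ b ∈ cls V r U v ∪ cls V r U z, r x b := by
    rintro b (hb | hb)
    · exact hxA b hb
    · exact ((IsFac.mem_strictBelow_iff h hx hxA).mp (hsub hb)).2
  -- With equal colours this union would be a larger monochromatic factor: `x` is above all of it,
  -- nothing outside separates the two classes, and only elements of the upper one can have
  -- something outside below them.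
  have hF : IsFac V r (cls V r U v ∪ cls V r U z) := by
    refine ⟨⟨v, .inl hvA⟩, Set.union_subset hA.subset hB.subset, ?_, ?_, ?_⟩
    · intro w hw a ha b hb hwa
      simp only [Set.mem_union, not_or] at hw
      suffices r w x from h.trans this (hxle b hb)
      rcases ha with ha | ha
      · exact hA.above w hw.1 a ha x hx hwa
      · rcases h.chain hwa (hxle a (.inr ha)) with h1 | h1
        · exact h1
        · exact absurd (hup w ((IsFac.mem_strictBelow_iff h hx hxA).mpr ⟨hw.1, h1⟩) a ha hwa) hw.2
    · intro w hw w' hw' a ha b hb haw hbw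
      simp only [Set.mem_union, not_or] at hw hw'
      have hm : ∀ a ∈ cls V r U v ∪ cls V r U z, ∀ w ∉ cls V r U z, r a w → a ∈ cls V r U v := by
        rintro a (ha | ha) w hw haw
        · exact ha
        · exact absurd (cls_closed hcl ha haw) hw
      exact hA.below w hw.1 w' hw'.1 a (hm a ha w hw.2 haw) b (hm b hb w' hw'.2 hbw) haw hbw
    · intro _ _ _ _ _
      exact ⟨x, .inl hx, hxle⟩
  have hm : Monochromatic U (cls V r U v ∪ cls V r U z) := by
    have key : ∀ a ∈ cls V r U v ∪ cls V r U z, (a ∈ U ↔ v ∈ U) := by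
      rintro a (ha | ha)
      · exact mem_iff_of_mem_cls h hV hv ha
      · exact (mem_iff_of_mem_cls h hV hzV ha).trans hcol
    exact fun a ha b hb => (key a ha).trans (key b hb).symm
  exact hz.1 (subset_cls hF hm (.inl hvA) (.inr hzB))

/-- A maximal factor with nothing far from it below is closed under descendants. -/
theorem IsExchangeReduced.strictBelow_eq_empty (h : IsTreeOrder V r) (hV : V.Finite)
    (hg : IsAdditive V adj g) (red : IsExchangeReduced V U adj g s r) {v : α} (hv : v ∈ V)
    (hoff : ∀ a ∈ cls V r U v, ∀ w ∈ closedNhd adj (cutSet adj U) (s + 2), ¬ r a w) :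
    strictBelow r (cls V r U v) = ∅ := by
  by_contra hne
  set W := closedNhd adj (cutSet adj U) (s + 2) with hW
  set S := {x | x ∈ V ∧ (∀ b ∈ cls V r U x, r x b) ∧ (strictBelow r (cls V r U x)).Nonempty ∧
    ∀ a ∈ cls V r U x, ∀ w ∈ W, ¬ r a w} with hS
  have hmk : ∀ v ∈ V, (strictBelow r (cls V r U v)).Nonempty →
      (∀ a ∈ cls V r U v, ∀ w ∈ W, ¬ r a w) → ∃ x ∈ S, x ∈ cls V r U v := by
    intro v hv hne hoff
    obtain ⟨x, hx, hxA⟩ := (cls_spec (U := U) hV h hv).1.least_of_strictBelow hne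
    have he := cls_eq hV h hv hx
    exact ⟨x, ⟨cls_subset hx, by rwa [he], by rwa [he], by rwa [he]⟩, hx⟩
  obtain ⟨x₀, hx₀, -⟩ := hmk v hv (Set.nonempty_iff_ne_empty.mpr hne) hoff
  have hSV : S ⊆ V := fun x hx => hx.1
  -- Fewest descendants means a lowest counterexample: every class strictly below that of `x` is
  -- closed under descendants, and therefore has the other colour.
  obtain ⟨x, ⟨hxV, hxl, hxne, hxoff⟩, hmin⟩ :=
    Set.exists_min_image S (fun x => {y | y ∈ V ∧ r x y}.ncard) (hV.subset hSV) ⟨x₀, hx₀⟩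
  have hA := (cls_spec (U := U) hV h hxV).1
  have hxA := mem_cls_self (U := U) hV h hxV
  set A := cls V r U x with hAdef
  have hm : ∀ z, z ∈ strictBelow r A ↔ z ∉ A ∧ r x z := fun z =>
    IsFac.mem_strictBelow_iff h hxA hxl
  have hoff' : ∀ z ∈ strictBelow r A, ∀ w ∈ W, ¬ r z w := fun z hz w hw hzw =>
    hxoff x hxA w hw (h.trans ((hm z).mp hz).2 hzw)
  have hBV := hA.strictBelow_subset h
  have hclosed : ∀ z ∈ strictBelow r A, strictBelow r (cls V r U z) = ∅ := by
    intro z hz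
    by_contra hzne
    have hzA : cls V r U z ⊆ strictBelow r A := strictBelow_cls h hV hxV hz
    obtain ⟨x', hx', hx'z⟩ := hmk z (hBV hz) (Set.nonempty_iff_ne_empty.mpr hzne)
      fun a ha => hoff' a (hzA ha)
    have hxx' := (hm x').mp (hzA hx'z)
    refine absurd (hmin x' hx') (not_le.mpr (Set.ncard_lt_ncard ⟨?_, fun hle => ?_⟩
      (hV.subset fun y hy => hy.1)))
    · exact fun y hy => ⟨hy.1, h.trans hxx'.2 hy.2⟩
    · have h1 : r x' x := (hle ⟨hxV, h.refl x⟩).2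
      exact hxx'.1 (h.antisymm h1 hxx'.2 ▸ hxA)
  have hcol : ∀ z ∈ strictBelow r A, ¬ (z ∈ U ↔ x ∈ U) := by
    intro z hz
    refine color_ne_of_strictBelow h hV hxV hz (hclosed z hz) fun z' hz' b hb hz'b => ?_
    have h1 := cls_closed (hclosed z' hz') (mem_cls_self hV h (hBV hz')) hz'b
    rw [← cls_eq hV h (hBV hz) hb, cls_eq hV h (hBV hz') h1]
    exact mem_cls_self hV h (hBV hz')
  obtain ⟨z, hz⟩ := hxne
  -- The move with `Z = ∅` detaches everything below `A` from it. It only deletes relations, and the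
  -- value condition holds because the separator of `∅` has value `0`.
  refine (red A (strictBelow r A) ∅ (x ∈ U) ?_).2 (by simp) x hxA z hz ((hm z).mp hz).2
  refine ⟨⟨?_, ?_, ?_, ?_, ?_, ?_, ?_, ?_, ?_, ?_⟩, ?_, ?_, ?_, ?_, ?_, ?_, ?_, ?_⟩
  · simpa using ⟨hA.subset, hBV⟩
  · exact Set.disjoint_left.mpr fun a ha hb => hb.1 ha
  · simp
  · simp
  · rintro a ((ha | ha) | ha) b hab
    · by_cases hb : b ∈ A
      · exact .inl (.inl hb)
      · exact .inl (.inr ⟨hb, a, ha, hab⟩)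
    · exact .inl (.inr (hA.strictBelow_closed h ha hab))
    · exact absurd ha (by simp)
  · simp only [Set.union_empty, Set.mem_union, not_or]
    intro w hw a ha b hb hwa
    have hxle : ∀ b, b ∈ A ∨ b ∈ strictBelow r A → r x b := fun b hb =>
      hb.elim (hxl b) fun hb => ((hm b).mp hb).2
    suffices r w x from h.trans this (hxle b hb)
    rcases h.chain hwa (hxle a ha) with h1 | h1
    · exact h1
    · exact absurd ((hm w).mpr ⟨hw.1, h1⟩) hw.2
  · exact fun y hy a ha => hA.not_le_of_strictBelow h hy ha
  · simp only [Set.union_empty]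
    rintro a ha b hb b' ⟨hb', c, hc, hcb⟩ hab
    exact hA.below b hb.1 b' hb' a ha c hc hab hcb
  · simp
  · simp
  · exact fun a ha => mem_iff_of_mem_cls h hV hxV ha
  · intro a ha
    have := hcol a ha
    tauto
  · rintro a (ha | ha) haW
    · exact hxoff a ha a haW (h.refl a)
    · exact hoff' a ha a haW (h.refl a)
  · intro a ha
    rw [cls_eq hV h hxV ha]
  · intro a ha
    exact strictBelow_cls h hV hxV ha
  · intro _
    have : separator adj r (∅ : Set α) = ∅ := by
      ext v; simp [separator]
    rw [this, hg.empty]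
    exact zero_le
  · simp
  · simp

theorem IsConsecutive.mem_strictBelow (h : IsTreeOrder V r) (hV : V.Finite) {x y : α}
    (c : IsConsecutive V r U W W' x y) : y ∈ strictBelow r (cls V r U x) := by
  refine ⟨fun hy => c.ne ?_, x, mem_cls_self hV h c.left.mem, c.le⟩
  have he := cls_eq hV h c.left.mem hy
  exact h.antisymm c.le (c.right.least x (he ▸ mem_cls_self hV h c.left.mem))

/-- The elements below the maximal factor of `x` but not below `y` are far from the cut. -/
theorem IsConsecutive.side (h : IsTreeOrder V r) (hV : V.Finite) {x y : α}
    (c : IsConsecutive V r U W W' x y) {z : α}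
    (hz : z ∈ strictBelow r (cls V r U x)) (hyz : ¬ r y z) :
    (∀ w ∈ W, ¬ r z w) ∧ ∀ u ∈ cls V r U z, u ∈ strictBelow r (cls V r U x) ∧ ¬ r y u := by
  have hx := c.left.mem
  have hxA := mem_cls_self (U := U) hV h hx
  have hm : ∀ z, z ∈ strictBelow r (cls V r U x) ↔ z ∉ cls V r U x ∧ r x z := fun z =>
    IsFac.mem_strictBelow_iff h hxA c.left.least
  have hzV : z ∈ V := (cls_spec hV h hx).1.strictBelow_subset h hz
  have hB := (cls_spec (U := U) hV h hzV).1
  have hzB := mem_cls_self (U := U) hV h hzV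
  have hsub := strictBelow_cls h hV hx hz
  have hyB : y ∉ cls V r U z := fun hy => by
    refine hyz (c.right.least z ?_)
    rw [cls_eq hV h hzV hy]
    exact hzB
  have h2 : ∀ u ∈ cls V r U z, ¬ r y u := fun u hu hyu =>
    hyz (hB.above y hyB u hu z hzB hyu)
  refine ⟨fun w hw hzw => ?_, fun u hu => ⟨hsub hu, h2 u hu⟩⟩
  have hxw : r x w := h.trans ((hm z).mp hz).2 hzw
  have hyw : r y w := (c.right.eq w hw).mpr ((c.left.eq w hw).mp hxw)
  have hzy : r z y := (h.chain hzw hyw).resolve_right hyz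
  -- If some `w ∈ W` lay below `z`, then `z` would lie above `y`, and the least element `t` of its
  -- class would be a chain top strictly between `x` and `y`.
  obtain ⟨t, ht, htB⟩ := hB.least y hyB z hzB hzy
  have he := cls_eq hV h hzV ht
  have htop : IsChainTop V r U W W' t := by
    refine ⟨cls_subset ht, by rwa [he], ?_, ?_⟩
    · rw [he]
      intro b hb hbW
      have hxb : r x b := ((hm b).mp (hsub hb)).2
      exact h2 b hb ((c.right.eq b hbW).mpr ((c.left.eq b hbW).mp hxb))
    · intro w' hw'
      constructor
      · intro htw
        exact (c.left.eq w' hw').mp (h.trans ((hm t).mp (hsub ht)).2 htw)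
      · intro hw''
        exact h.trans (htB z hzB) (h.trans hzy ((c.right.eq w' hw').mpr hw''))
  have hxt := (hm t).mp (hsub ht)
  rcases c.between t htop hxt.2 (h.trans (htB z hzB) hzy) with rfl | rfl
  · exact hxt.1 hxA
  · exact hyB ht

end Structure

/-! ### Colours and separator values along a chain of maximal factors -/

section Chains

variable {α : Type u} {V U W' : Set α} {adj r : α → α → Prop} {g : Set α → ℝ≥0} {s : ℕ}
  {x y z : α}

theorem IsChainTop.mem_strictBelow_iff {W : Set α} (h : IsTreeOrder V r) (hV : V.Finite)
    (c : IsChainTop V r U W W' x) {v : α} :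
    v ∈ strictBelow r (cls V r U x) ↔ v ∉ cls V r U x ∧ r x v :=
  IsFac.mem_strictBelow_iff h (mem_cls_self hV h c.mem) c.least

theorem IsChainTop.mem_union_iff {W : Set α} (h : IsTreeOrder V r) (hV : V.Finite)
    (c : IsChainTop V r U W W' x) {v : α} :
    v ∈ cls V r U x ∪ strictBelow r (cls V r U x) ↔ r x v := by
  rw [Set.mem_union, c.mem_strictBelow_iff h hV]
  have := c.least v
  tauto

theorem IsConsecutive.subset_strictBelow {W : Set α} (h : IsTreeOrder V r) (hV : V.Finite)
    (c : IsConsecutive V r U W W' x y) {v : α} (hv : r y v) :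
    v ∈ strictBelow r (cls V r U x) :=
  (cls_spec hV h c.left.mem).1.strictBelow_closed h (c.mem_strictBelow h hV) hv

variable (h : IsTreeOrder V r) (hV : V.Finite) (hg : IsAdditive V adj g)
  (red : IsExchangeReduced V U adj g s r)

include h hV hg red

/-- The elements below the maximal factor of `x` but not below `y` have the colour opposite to that
of `x` and form maximal factors closed under descendants. -/
theorem IsConsecutive.color_side
    (c : IsConsecutive V r U (closedNhd adj (cutSet adj U) (s + 2)) W' x y)
    (hz : z ∈ strictBelow r (cls V r U x)) (hyz : ¬ r y z) :
    strictBelow r (cls V r U z) = ∅ ∧ ¬ (z ∈ U ↔ x ∈ U) := by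
  have hx := c.left.mem
  have hsV := (cls_spec (U := U) hV h hx).1.strictBelow_subset h
  have key : ∀ z ∈ strictBelow r (cls V r U x), ¬ r y z → strictBelow r (cls V r U z) = ∅ := by
    intro z hz hyz
    have hs := c.side h hV hz hyz
    exact red.strictBelow_eq_empty h hV hg (hsV hz) fun a ha =>
      (c.side h hV (hs.2 a ha).1 (hs.2 a ha).2).1
  refine ⟨key z hz hyz, color_ne_of_strictBelow h hV hx hz (key z hz hyz) fun z' hz' b hb hzb => ?_⟩
  have hyz' : ¬ r y z' := fun hy => ((c.side h hV hz hyz).2 b hb).2 (h.trans hy hzb)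
  have h1 := cls_closed (key z' hz' hyz') (mem_cls_self hV h (hsV hz')) hzb
  rw [← cls_eq hV h (hsV hz) hb, cls_eq hV h (hsV hz') h1]
  exact mem_cls_self hV h (hsV hz')

theorem IsConsecutive.closed_side
    (c : IsConsecutive V r U (closedNhd adj (cutSet adj U) (s + 2)) W' x y) {w : α}
    (hz : z ∈ strictBelow r (cls V r U x)) (hyz : ¬ r y z) (hzw : r z w) :
    w ∈ strictBelow r (cls V r U x) ∧ ¬ r y w := by
  have hzV := (cls_spec (U := U) hV h c.left.mem).1.strictBelow_subset h hz
  exact (c.side h hV hz hyz).2 w (cls_closed (c.color_side h hV hg red hz hyz).1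
    (mem_cls_self hV h hzV) hzw)

/-- Otherwise the side part, which has the opposite colour and nothing of `{v | r y v}` below it,
could be detached from the class of `x` by a move that only deletes relations. -/
theorem IsConsecutive.lt_of_side
    (c : IsConsecutive V r U (closedNhd adj (cutSet adj U) (s + 2)) W' x y)
    (hz : z ∈ strictBelow r (cls V r U x)) (hyz : ¬ r y z) :
    g (separator adj r (strictBelow r (cls V r U x))) < g (separator adj r {v | r y v}) := by
  by_contra hle
  rw [not_lt] at hle
  obtain ⟨hA, hAm, hxA⟩ := cls_spec (U := U) hV h c.left.mem
  have hsV := hA.strictBelow_subset h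
  set A := cls V r U x with hAdef
  have hm : ∀ v, v ∈ strictBelow r A ↔ v ∉ A ∧ r x v := fun v => c.left.mem_strictBelow_iff h hV
  have hxle : ∀ v, v ∈ A ∨ v ∈ strictBelow r A ↔ r x v := fun v => c.left.mem_union_iff h hV
  set S := strictBelow r A \ {v | r y v} with hS
  have hSF : S ∪ {v | r y v} = strictBelow r A := by
    rw [hS, Set.sdiff_union_of_subset]
    exact fun v hv => c.subset_strictBelow h hV hv
  have hN : A ∪ S ∪ {v | r y v} = {v | r x v} := by
    rw [Set.union_assoc, hSF]
    ext v
    exact hxle v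
  refine (red A S {v | r y v} (x ∈ U) ?_).2 ?_ x hxA z ⟨hz, hyz⟩ ((hm z).mp hz).2
  · refine ⟨⟨?_, ?_, ?_, ?_, ?_, ?_, ?_, ?_, ?_, ?_⟩, ?_, ?_, ?_, ?_, ?_, ?_, ?_, ?_⟩
    · rw [hN]
      exact fun v hv => h.mem_right hv c.left.mem
    · exact Set.disjoint_left.mpr fun a ha hb => hb.1.1 ha
    · exact Set.disjoint_left.mpr fun a ha hb => (c.subset_strictBelow h hV hb).1 ha
    · exact Set.disjoint_left.mpr fun a ha hb => ha.2 hb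
    · rw [hN]
      exact fun a ha b hab => h.trans ha hab
    · rw [hN]
      intro w hw a ha b hb hwa
      exact h.trans ((h.chain hwa ha).resolve_right hw) hb
    · exact fun w hw a ha => hA.not_le_of_strictBelow h hw.1 ha
    · rw [hSF]
      rintro a ha b hb b' ⟨hb', d, hd, hdb⟩ hab
      exact hA.below b hb.1 b' hb' a ha d hd hab hdb
    · exact fun a ha b hab => h.trans ha hab
    · intro a ha b hb b' hb' hab
      exact absurd hb (c.closed_side h hV hg red ha.1 ha.2 hab).2
    · exact fun a ha => mem_iff_of_mem_cls h hV c.left.mem ha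
    · intro a ha
      have := (c.color_side h hV hg red ha.1 ha.2).2
      tauto
    · rintro a (ha | ha) haW
      · exact c.left.avoid a ha haW
      · exact (c.side h hV ha.1 ha.2).1 a haW (h.refl a)
    · intro a ha
      rw [cls_eq hV h c.left.mem ha]
    · intro a ha
      exact (c.side h hV ha.1 ha.2).2
    · intro _
      rwa [hSF]
    · rintro ⟨a, ha, b, hb, hab⟩
      exact absurd hb (c.closed_side h hV hg red ha.1 ha.2 hab).2
    · rintro ⟨a, ha, b, hb, hab⟩
      exact absurd hb (c.closed_side h hV hg red ha.1 ha.2 hab).2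
  · exact fun a ha b hb hab => (c.closed_side h hV hg red ha.1 ha.2 hab).2 hb

omit hg in
/-- A move below the maximal factor of `x` does not place a part of the same colour next to it. -/
theorem IsExchangeReduced.not_union {X Y Z : Set α} {p : Prop} {v w : α}
    (m : IsMove V U adj g s r X Y Z p) (hv : v ∈ V)
    (hN : strictBelow r (cls V r U v) = X ∪ Y ∪ Z) (hw : w ∈ Y) (hcol : v ∈ U ↔ w ∈ U) : False := by
  obtain ⟨hA, hAm, hvA⟩ := cls_spec (U := U) hV h hv
  have hF := m.stack.isFac_union_exchange h hA hN ⟨w, .inl (.inr hw)⟩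
  have ho' := m.stack.isTreeOrder_exchange h
  have hmono : Monochromatic U (cls V r U v ∪ Y) := by
    have key : ∀ a ∈ cls V r U v ∪ Y, (a ∈ U ↔ v ∈ U) := by
      rintro a (ha | ha)
      · exact mem_iff_of_mem_cls h hV hv ha
      · rw [hcol, m.colorY a ha, m.colorY w hw]
    exact fun a ha b hb => (key a ha).trans (key b hb).symm
  have hwm := subset_cls hF hmono (.inl hvA) (.inr hw)
  have hwV : w ∈ V := m.stack.subset (.inl (.inr hw))
  have := (red X Y Z p m).1 v hv w hwV (cls_eq hV ho' hv hwm).symm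
  have hwN : w ∈ strictBelow r (cls V r U v) := hN ▸ .inl (.inr hw)
  exact hwN.1 (this ▸ mem_cls_self hV h hwV)

/-- If the colours were equal, the class of `y` could be moved above the side part `S`, directly
below the class of `x`, and would merge with it. The value condition on the class of `y` is
`lt_of_side`, or an equality if `S` is empty. The one on `S` is vacuous. -/
theorem IsConsecutive.color_ne
    (c : IsConsecutive V r U (closedNhd adj (cutSet adj U) (s + 2)) W' x y) :
    ¬ (y ∈ U ↔ x ∈ U) := by
  intro hcol
  obtain ⟨hA, hAm, hxA⟩ := cls_spec (U := U) hV h c.left.mem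
  obtain ⟨hB, hBm, hyB⟩ := cls_spec (U := U) hV h c.right.mem
  have hsV := hA.strictBelow_subset h
  set A := cls V r U x with hAdef
  set B := cls V r U y with hBdef
  have hBle : ∀ v, v ∈ B ∨ v ∈ strictBelow r B ↔ r y v := fun v => c.right.mem_union_iff h hV
  set S := strictBelow r A \ {v | r y v} with hS
  have hBF : B ∪ strictBelow r B = {v | r y v} := by
    ext v
    exact hBle v
  have hSF : S ∪ {v | r y v} = strictBelow r A := by
    rw [hS, Set.sdiff_union_of_subset]
    exact fun v hv => c.subset_strictBelow h hV hv
  have hN : strictBelow r A = S ∪ B ∪ strictBelow r B := by rw [Set.union_assoc, hBF, hSF]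
  refine red.not_union h hV (X := S) (Y := B) (Z := strictBelow r B) (p := ¬ (x ∈ U)) ?_
    c.left.mem hN hyB hcol.symm
  refine ⟨⟨?_, ?_, ?_, ?_, ?_, ?_, ?_, ?_, ?_, ?_⟩, ?_, ?_, ?_, ?_, ?_, ?_, ?_, ?_⟩
  · rwa [← hN]
  · exact Set.disjoint_left.mpr fun a ha hb => ha.2 ((hBle a).mp (.inl hb))
  · exact Set.disjoint_left.mpr fun a ha hb => ha.2 ((hBle a).mp (.inr hb))
  · exact Set.disjoint_left.mpr fun a ha hb => hb.1 ha
  · rw [← hN]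
    exact fun a ha b hab => hA.strictBelow_closed h ha hab
  · rw [← hN]
    exact fun w hw a ha b hb hwa => hA.strictBelow_above h hw ha hb hwa
  · exact fun b hb a ha hab => ha.2 (h.trans (c.right.least b hb) hab)
  · rw [hBF]
    intro a ha b hb b' hb' hab
    exact absurd hb (c.closed_side h hV hg red ha.1 ha.2 hab).2
  · exact fun a ha b hab => hB.strictBelow_closed h ha hab
  · rintro a ha b hb b' ⟨hb', d, hd, hdb⟩ hab
    exact hB.below b hb.1 b' hb' a ha d hd hab hdb
  · intro a ha
    have := (c.color_side h hV hg red ha.1 ha.2).2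
    tauto
  · intro a ha
    rw [mem_iff_of_mem_cls h hV c.right.mem ha, not_not, hcol]
  · rintro a (ha | ha) haW
    · exact (c.side h hV ha.1 ha.2).1 a haW (h.refl a)
    · exact c.right.avoid a ha haW
  · intro a ha
    exact (c.side h hV ha.1 ha.2).2
  · intro a ha
    rw [cls_eq hV h c.right.mem ha]
  · rw [hBF]
    rintro ⟨a, ha, b, hb, hab⟩
    exact absurd hb (c.closed_side h hV hg red ha.1 ha.2 hab).2
  · intro _
    rw [← hN, hBF]
    rcases S.eq_empty_or_nonempty with hSe | ⟨z, hz⟩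
    · rw [← hSF, hSe, Set.empty_union]
    · exact (c.lt_of_side h hV hg red hz.1 hz.2).le
  · intro _
    refine ⟨x, fun n hn => ((c.left.mem_strictBelow_iff h hV).mp (?_ : n ∈ strictBelow r A)).2⟩
    rw [hN]
    exact .inl hn

theorem IsConsecutive.color_diff
    (c : IsConsecutive V r U (closedNhd adj (cutSet adj U) (s + 2)) W' x y)
    (hz : z ∈ strictBelow r (cls V r U x) \ strictBelow r (cls V r U y)) :
    (z ∈ U ↔ y ∈ U) ∧ z ∉ closedNhd adj (cutSet adj U) (s + 2) := by
  by_cases hyz : r y z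
  · have hzB : z ∈ cls V r U y := ((c.right.mem_union_iff h hV).mpr hyz).resolve_right hz.2
    exact ⟨mem_iff_of_mem_cls h hV c.right.mem hzB, c.right.avoid z hzB⟩
  · have h1 := c.color_ne h hV hg red
    have h2 := (c.color_side h hV hg red hz.1 hyz).2
    exact ⟨by tauto, fun hzW => (c.side h hV hz.1 hyz).1 z hzW (h.refl z)⟩

/-- The values of the separators along a chain of consecutive maximal factors have no local
maximum. -/
theorem IsConsecutive.no_local_max
    (c : IsConsecutive V r U (closedNhd adj (cutSet adj U) (s + 2)) W' x y)
    (c' : IsConsecutive V r U (closedNhd adj (cutSet adj U) (s + 2)) W' y z)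
    (h1 : g (separator adj r (strictBelow r (cls V r U x))) ≤
      g (separator adj r (strictBelow r (cls V r U y))))
    (h2 : g (separator adj r (strictBelow r (cls V r U z))) ≤
      g (separator adj r (strictBelow r (cls V r U y)))) : False := by
  have hA := (cls_spec (U := U) hV h c.left.mem).1
  have hB := (cls_spec (U := U) hV h c.right.mem).1
  have hC := (cls_spec (U := U) hV h c'.right.mem).1
  have hm := fun v => c.left.mem_strictBelow_iff h hV (v := v)
  have hzy := c'.mem_strictBelow h hV
  have hz : z ∈ strictBelow r (cls V r U y) \ strictBelow r (cls V r U z) :=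
    ⟨hzy, fun hz => hz.1 (mem_cls_self hV h c'.right.mem)⟩
  have hsub : ∀ {x y}, IsConsecutive V r U (closedNhd adj (cutSet adj U) (s + 2)) W' x y →
      strictBelow r (cls V r U y) ⊆ strictBelow r (cls V r U x) := fun c v hv =>
    c.subset_strictBelow h hV ((c.right.mem_strictBelow_iff h hV).mp hv).2
  have hsat : ∀ {x y}, IsConsecutive V r U (closedNhd adj (cutSet adj U) (s + 2)) W' x y →
      ∀ v ∈ strictBelow r (cls V r U x) \ strictBelow r (cls V r U y), cls V r U v ⊆
        strictBelow r (cls V r U x) \ strictBelow r (cls V r U y) := by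
    intro x y c v hv u hu
    have hvV := (cls_spec hV h c.left.mem).1.strictBelow_subset h hv.1
    refine ⟨strictBelow_cls h hV c.left.mem hv.1 hu, fun hu' => hv.2 ?_⟩
    refine strictBelow_cls h hV c.right.mem hu' ?_
    rw [cls_eq hV h hvV hu]
    exact mem_cls_self hV h hvV
  have e1 : strictBelow r (cls V r U y) \ strictBelow r (cls V r U z) ∪
      strictBelow r (cls V r U z) = strictBelow r (cls V r U y) :=
    Set.sdiff_union_of_subset (hsub c')
  have e2 : strictBelow r (cls V r U x) \ strictBelow r (cls V r U y) ∪
      strictBelow r (cls V r U y) = strictBelow r (cls V r U x) :=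
    Set.sdiff_union_of_subset (hsub c)
  have n1 := c.color_ne h hV hg red
  have n2 := c'.color_ne h hV hg red
  have e3 : strictBelow r (cls V r U x) \ strictBelow r (cls V r U y) ∪
      strictBelow r (cls V r U y) \ strictBelow r (cls V r U z) ∪ strictBelow r (cls V r U z) =
      strictBelow r (cls V r U x) := by rw [Set.union_assoc, e1, e2]
  -- `X` has the colour of `y`, and `Y` that of `z`. As colours alternate, the latter is the colour
  -- of `x`, so the move would merge the class of `x` with part of `Y`.
  refine red.not_union h hV (X := strictBelow r (cls V r U x) \ strictBelow r (cls V r U y))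
    (Y := strictBelow r (cls V r U y) \ strictBelow r (cls V r U z))
    (Z := strictBelow r (cls V r U z)) (p := y ∈ U) ?_ c.left.mem e3.symm hz (by tauto)
  refine ⟨⟨?_, ?_, ?_, ?_, ?_, ?_, ?_, ?_, ?_, ?_⟩, ?_, ?_, ?_, ?_, ?_, ?_, ?_, ?_⟩
  · rw [e3]
    exact hA.strictBelow_subset h
  · exact Set.disjoint_left.mpr fun a ha hb => ha.2 hb.1
  · exact Set.disjoint_left.mpr fun a ha hb => ha.2 (hsub c' hb)
  · exact Set.disjoint_left.mpr fun a ha hb => ha.2 hb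
  · rw [e3]
    exact fun a ha b hab => hA.strictBelow_closed h ha hab
  · rw [e3]
    exact fun w hw a ha b hb hwa => hA.strictBelow_above h hw ha hb hwa
  · exact fun b hb a ha hab => ha.2 (hB.strictBelow_closed h hb.1 hab)
  · rw [e1]
    exact fun a ha b hb b' hb' hab => hB.strictBelow_above h ha.2 hb hb' hab
  · exact fun a ha b hab => hC.strictBelow_closed h ha hab
  · exact fun a ha b hb b' hb' hab => hC.strictBelow_above h ha.2 hb hb' hab
  · exact fun a ha => (c.color_diff h hV hg red ha).1
  · intro a ha
    have := (c'.color_diff h hV hg red ha).1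
    tauto
  · rintro a (ha | ha)
    · exact (c.color_diff h hV hg red ha).2
    · exact (c'.color_diff h hV hg red ha).2
  · exact hsat c
  · exact hsat c'
  · intro _
    rwa [e1]
  · intro _
    rwa [e1, e3]
  · intro _
    refine ⟨x, fun n hn => ((hm n).mp ?_).2⟩
    rw [← e3]
    exact .inl hn

end Chains

/-! ### Counting the maximal factors of a reduced order -/

section Counting

variable {α : Type u} {V U W' : Set α} {adj r : α → α → Prop} {g : Set α → ℝ≥0} {s : ℕ}

/-- A function on a finite chain without a local maximum in the interior takes no value three
times. -/
theorem not_three_of_no_local_max {I : Set α} (h : IsTreeOrder V r) (hI : I.Finite)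
    (hc : ∀ a ∈ I, ∀ b ∈ I, r a b ∨ r b a) (T : α → ℝ≥0)
    (hT : ∀ x ∈ I, ∀ y ∈ I, ∀ z ∈ I, r x y → x ≠ y → r y z → y ≠ z →
      (∀ t ∈ I, r x t → r t y → t = x ∨ t = y) → (∀ t ∈ I, r y t → r t z → t = y ∨ t = z) →
      T x ≤ T y → T z ≤ T y → False)
    {x y z : α} (hx : x ∈ I) (hy : y ∈ I) (hz : z ∈ I) (hxy : r x y) (hxy' : x ≠ y) (hyz : r y z)
    (hyz' : y ≠ z) (h1 : T x ≤ T y) (h2 : T z ≤ T y) : False := by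
  -- A maximiser `d` of `T` strictly between `x` and `z` is at least as large as its two neighbours
  -- `e` and `f`, also if these are the end points, since `T y ≤ T d`.
  obtain ⟨d, ⟨hdI, hxd, hdz, hdx, hdz'⟩, hmax⟩ :=
    Set.exists_max_image {d ∈ I | r x d ∧ r d z ∧ d ≠ x ∧ d ≠ z} T
      (hI.subset fun d hd => hd.1) ⟨y, hy, hxy, hyz, hxy'.symm, hyz'⟩
  have hyd : T y ≤ T d := hmax y ⟨hy, hxy, hyz, hxy'.symm, hyz'⟩
  obtain ⟨e, ⟨heI, hxe, hed, hed'⟩, hemax⟩ := exists_isGreatest_of_chain h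
    (S := {e ∈ I | r x e ∧ r e d ∧ e ≠ d}) (hI.subset fun d hd => hd.1)
    ⟨x, hx, h.refl x, hxd, hdx.symm⟩ (fun a ha b hb => hc a ha.1 b hb.1)
  obtain ⟨f, ⟨hfI, hdf, hfz, hdf'⟩, hfmin⟩ := exists_isLeast_of_chain h
    (S := {f ∈ I | r d f ∧ r f z ∧ d ≠ f}) (hI.subset fun d hd => hd.1)
    ⟨z, hz, hdz, h.refl z, hdz'⟩ (fun a ha b hb => hc a ha.1 b hb.1)
  refine hT e heI d hdI f hfI hed hed' hdf hdf' ?_ ?_ ?_ ?_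
  · intro t ht het htd
    by_cases htd' : t = d
    · exact .inr htd'
    · exact .inl (h.antisymm (hemax t ⟨ht, h.trans hxe het, htd, htd'⟩) het)
  · intro t ht hdt htf
    by_cases htd' : d = t
    · exact .inl htd'.symm
    · exact .inr (h.antisymm htf (hfmin t ⟨ht, hdt, h.trans htf hfz, htd'⟩))
  · by_cases hex : e = x
    · rw [hex]; exact h1.trans hyd
    · refine hmax e ⟨heI, hxe, h.trans hed hdz, hex, ?_⟩
      rintro rfl
      exact hdz' (h.antisymm hdz hed)
  · by_cases hfz' : f = z
    · rw [hfz']; exact h2.trans hyd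
    · refine hmax f ⟨hfI, h.trans hxd hdf, hfz, ?_, hfz'⟩
      rintro rfl
      exact hdx (h.antisymm hdf hxd)

variable (h : IsTreeOrder V r) (hV : V.Finite) (hg : IsAdditive V adj g)
  (red : IsExchangeReduced V U adj g s r) {𝒱 : Set ℝ≥0} (h𝒱 : 𝒱.Finite)
  (hval : ∀ S ⊆ V, S.ncard ≤ s → g S ∈ 𝒱) (hbag : ∀ u ∈ V, (orderBag adj r u).ncard ≤ s)

include h hV hg red h𝒱 hval hbag

/-- A common element of `W'` below makes these tops a chain. If three of them had the same value,
the middle one would violate `not_three_of_no_local_max`. The separators have at most `s` elements,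
which confines the values to `𝒱`. -/
theorem ncard_isChainTop_le (hW' : W'.Nonempty) (hsub : W' ⊆ closedNhd adj (cutSet adj U) (s + 2)) :
    {x | IsChainTop V r U (closedNhd adj (cutSet adj U) (s + 2)) W' x}.ncard ≤ 2 * 𝒱.ncard := by
  classical
  set I := {x | IsChainTop V r U (closedNhd adj (cutSet adj U) (s + 2)) W' x} with hI
  have hIfin : I.Finite := hV.subset fun x hx => hx.mem
  obtain ⟨w, hw⟩ := hW'
  have hc : ∀ a ∈ I, ∀ b ∈ I, r a b ∨ r b a := fun a ha b hb =>
    h.chain ((ha.eq w (hsub hw)).mpr hw) ((hb.eq w (hsub hw)).mpr hw)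
  set T : α → ℝ≥0 := fun x => g (separator adj r (strictBelow r (cls V r U x))) with hT
  have key : ∀ {x y z : α}, x ∈ I → y ∈ I → z ∈ I → r x y → x ≠ y → r y z → y ≠ z →
      T x ≤ T y → T z ≤ T y → False := by
    intro x y z
    refine not_three_of_no_local_max h hIfin hc T ?_
    intro x hx y hy z hz hxy hxy' hyz hyz' b1 b2 h1 h2
    exact IsConsecutive.no_local_max h hV hg red ⟨hx, hy, hxy, hxy', b1⟩
      ⟨hy, hz, hyz, hyz', b2⟩ h1 h2
  rw [Set.ncard_eq_toFinset_card _ hIfin, Set.ncard_eq_toFinset_card _ h𝒱]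
  refine Finset.card_le_mul_card_image_of_maps_to (f := T) ?_ 2 ?_
  · intro x hx
    rw [Set.Finite.mem_toFinset] at hx ⊢
    have hA := (cls_spec (U := U) hV h hx.mem).1
    have hsV := hA.strictBelow_subset h
    exact hval _ (separator_subset h hsV) (ncard_separator_le h hV hsV hbag
      fun z hz a ha b hb hza => hA.strictBelow_above h hz ha hb hza)
  · intro t _
    by_contra hlt
    rw [not_le, Finset.two_lt_card] at hlt
    obtain ⟨a, ha, b, hb, c, hc', hab, hac, hbc⟩ := hlt
    simp only [Finset.mem_filter, Set.Finite.mem_toFinset] at ha hb hc'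
    obtain ⟨ha, hat⟩ := ha
    obtain ⟨hb, hbt⟩ := hb
    obtain ⟨hc', hct⟩ := hc'
    have e : ∀ {x y : α}, T x = t → T y = t → T x ≤ T y := fun hx hy => (hx.trans hy.symm).le
    rcases hc a ha b hb with h1 | h1 <;> rcases hc b hb c hc' with h2 | h2 <;>
      rcases hc a ha c hc' with h3 | h3
    · exact key ha hb hc' h1 hab h2 hbc (e hat hbt) (e hct hbt)
    · exact key ha hb hc' h1 hab h2 hbc (e hat hbt) (e hct hbt)
    · exact key ha hc' hb h3 hac h2 hbc.symm (e hat hct) (e hbt hct)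
    · exact key hc' ha hb h3 hac.symm h1 hab (e hct hat) (e hbt hat)
    · exact key hb ha hc' h1 hab.symm h3 hac (e hbt hat) (e hct hat)
    · exact key hb hc' ha h2 hbc h3 hac.symm (e hbt hct) (e hat hct)
    · exact key hc' hb ha h2 hbc.symm h1 hab.symm (e hct hbt) (e hat hbt)
    · exact key hc' hb ha h2 hbc.symm h1 hab.symm (e hct hbt) (e hat hbt)

omit hg red h𝒱 hval hbag in
/-- Two maximal factors of the same colour that are closed under descendants and lie directly below
the same maximal factor coincide. -/
theorem cls_eq_of_parent {a a' : α} (ha : a ∈ V) (ha' : a' ∈ V)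
    (he : strictBelow r (cls V r U a) = ∅) (he' : strictBelow r (cls V r U a') = ∅)
    (hcol : a ∈ U ↔ a' ∈ U)
    (hanc : ∀ z, z ∉ cls V r U a → z ∉ cls V r U a' → (r z a ↔ r z a')) :
    cls V r U a = cls V r U a' := by
  obtain ⟨hA, hAm, haA⟩ := cls_spec (U := U) hV h ha
  obtain ⟨hB, hBm, haB⟩ := cls_spec (U := U) hV h ha'
  have hno : ∀ z ∉ cls V r U a ∪ cls V r U a', ∀ b ∈ cls V r U a ∪ cls V r U a', ¬ r b z := by
    rintro z hz b (hb | hb) hbz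
    · exact hz (.inl (cls_closed he hb hbz))
    · exact hz (.inr (cls_closed he' hb hbz))
  have hF : IsFac V r (cls V r U a ∪ cls V r U a') := by
    refine ⟨⟨a, .inl haA⟩, Set.union_subset hA.subset hB.subset, ?_, ?_, ?_⟩
    · intro z hz b hb b' hb' hzb
      simp only [Set.mem_union, not_or] at hz
      have hiff := hanc z hz.1 hz.2
      have hza : r z a := hb.elim (fun hb => hA.above z hz.1 b hb a haA hzb)
        fun hb => hiff.mpr (hB.above z hz.2 b hb a' haB hzb)
      exact hb'.elim (fun hb' => hA.above z hz.1 a haA b' hb' hza)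
        fun hb' => hB.above z hz.2 a' haB b' hb' (hiff.mp hza)
    · exact fun z hz _ _ b hb _ _ hbz => absurd hbz (hno z hz b hb)
    · exact fun z hz b hb hbz => absurd hbz (hno z hz b hb)
  have hm : Monochromatic U (cls V r U a ∪ cls V r U a') := by
    have key : ∀ b ∈ cls V r U a ∪ cls V r U a', (b ∈ U ↔ a ∈ U) := by
      rintro b (hb | hb)
      · exact mem_iff_of_mem_cls h hV ha hb
      · exact (mem_iff_of_mem_cls h hV ha' hb).trans hcol.symm
    exact fun b hb b' hb' => (key b hb).trans (key b' hb').symm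
  exact (cls_eq hV h ha (subset_cls hF hm (.inl haA) (.inr haB))).symm

/-- The number of maximal factors of `U` and its complement that meet or lie above the
neighbourhood of the cut. -/
theorem ncard_cls_near_le {M : ℕ} (hWV : closedNhd adj (cutSet adj U) (s + 2) ⊆ V)
    (hM : (closedNhd adj (cutSet adj U) (s + 2)).ncard ≤ M) :
    {A ∈ cls V r U '' V | ∃ a ∈ A, ∃ w ∈ closedNhd adj (cutSet adj U) (s + 2), r a w}.ncard ≤
      M + 2 * 𝒱.ncard * 2 ^ M := by
  classical
  set W := closedNhd adj (cutSet adj U) (s + 2) with hW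
  have hWfin := hV.subset hWV
  set tops := {x | x ∈ V ∧ (∀ b ∈ cls V r U x, r x b) ∧ (∀ b ∈ cls V r U x, b ∉ W) ∧
    ∃ w ∈ W, r x w} with htops
  have htfin : tops.Finite := hV.subset fun x hx => hx.1
  -- At most `M` classes meet `W`. Any other one has something of `W` below it, hence a least
  -- element, and these are sorted by the trace of `W` below them.
  have hsub : {A ∈ cls V r U '' V | ∃ a ∈ A, ∃ w ∈ W, r a w} ⊆
      cls V r U '' W ∪ cls V r U '' tops := by
    rintro _ ⟨⟨v, hv, rfl⟩, a, ha, w, hw, haw⟩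
    by_cases hex : ∃ b ∈ cls V r U v, b ∈ W
    · obtain ⟨b, hb, hbW⟩ := hex
      exact .inl ⟨b, hbW, cls_eq hV h hv hb⟩
    · push Not at hex
      obtain ⟨x, hx, hxA⟩ := (cls_spec (U := U) hV h hv).1.least w (fun hw' => hex w hw' hw) a ha haw
      have he := cls_eq hV h hv hx
      exact .inr ⟨x, ⟨cls_subset hx, by rwa [he], by rwa [he], w, hw, h.trans (hxA a ha) haw⟩, he⟩
  have h1 : (cls V r U '' W).ncard ≤ M := (Set.ncard_image_le hWfin).trans hM
  have h2 : (cls V r U '' tops).ncard ≤ 2 * 𝒱.ncard * 2 ^ M := by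
    refine (Set.ncard_image_le htfin).trans ?_
    have h3 : tops.ncard ≤ 2 * 𝒱.ncard * (hWfin.toFinset.powerset).card := by
      rw [Set.ncard_eq_toFinset_card _ htfin]
      refine Finset.card_le_mul_card_image_of_maps_to
        (f := fun x => hWfin.toFinset.filter fun w => r x w) ?_ _ ?_
      · intro x _
        exact Finset.mem_powerset.mpr (Finset.filter_subset _ _)
      · intro W' hW'
        rcases W'.eq_empty_or_nonempty with rfl | hne
        · rw [Finset.card_eq_zero.mpr]
          · exact Nat.zero_le _
          · refine Finset.filter_eq_empty_iff.mpr fun x hx he => ?_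
            obtain ⟨w, hw, hxw⟩ := ((htfin.mem_toFinset).mp hx).2.2.2
            have : w ∈ hWfin.toFinset.filter fun w => r x w := by simp [hw, hxw]
            simp [he] at this
        · rw [Finset.mem_powerset] at hW'
          refine le_trans ?_ (ncard_isChainTop_le h hV hg red h𝒱 hval hbag (W' := (W' : Set α))
            (by simpa using hne) (fun w hw => (hWfin.mem_toFinset).mp (hW' hw)))
          rw [← Set.ncard_coe_finset]
          refine Set.ncard_le_ncard ?_ (hV.subset fun x hx => hx.mem)
          intro x hx
          simp only [Finset.coe_filter, Set.Finite.mem_toFinset, Set.mem_ofPred_eq] at hx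
          obtain ⟨⟨h1, h2, h3, -⟩, h4⟩ := hx
          refine ⟨h1, h2, h3, fun w hw => ?_⟩
          rw [← h4]
          have hw' : w ∈ W := hw
          simp [hw']
    rw [Finset.card_powerset, ← Set.ncard_eq_toFinset_card _ hWfin] at h3
    exact h3.trans (by gcongr; norm_num)
  exact (Set.ncard_le_ncard hsub ((hWfin.image _).union (htfin.image _))).trans
    ((Set.ncard_union_le _ _).trans (add_le_add h1 h2))

/-- The number of maximal factors of `U` and its complement. -/
theorem ncard_cls_le {M : ℕ} (hWV : closedNhd adj (cutSet adj U) (s + 2) ⊆ V)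
    (hM : (closedNhd adj (cutSet adj U) (s + 2)).ncard ≤ M) :
    (cls V r U '' V).ncard ≤ 3 * (M + 2 * 𝒱.ncard * 2 ^ M) + 2 := by
  classical
  set W := closedNhd adj (cutSet adj U) (s + 2) with hW
  have hnear := ncard_cls_near_le h hV hg red h𝒱 hval hbag hWV hM
  set near := {A ∈ cls V r U '' V | ∃ a ∈ A, ∃ w ∈ W, r a w} with hnear_def
  set off := {A ∈ cls V r U '' V | ¬ ∃ a ∈ A, ∃ w ∈ W, r a w} with hoff
  have hfin : (cls V r U '' V).Finite := hV.image _
  have hnf : near.Finite := hfin.subset fun A hA => hA.1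
  have hof : off.Finite := hfin.subset fun A hA => hA.1
  have hall : cls V r U '' V ⊆ near ∪ off := fun A hA => by
    by_cases hex : ∃ a ∈ A, ∃ w ∈ W, r a w
    · exact .inl ⟨hA, hex⟩
    · exact .inr ⟨hA, hex⟩
  have hempty : ∀ v ∈ V, cls V r U v ∉ near → strictBelow r (cls V r U v) = ∅ := by
    intro v hv hn
    refine red.strictBelow_eq_empty h hV hg hv fun a ha w hw haw =>
      hn ⟨⟨v, hv, rfl⟩, a, ha, w, hw, haw⟩
  -- `q` is the class of the lowest ancestor of `v` outside its own class, or `none` if there is no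
  -- such ancestor.
  have hpar : ∀ v, ∃ q : Option (Set α), v ∈ V → (q = none ∧ ∀ z ∉ cls V r U v, ¬ r z v) ∨
      ∃ p, q = some (cls V r U p) ∧ p ∉ cls V r U v ∧ r p v ∧ ∀ z ∉ cls V r U v, r z v → r z p := by
    intro v
    by_cases hv : v ∈ V
    · rcases Set.eq_empty_or_nonempty {z | z ∉ cls V r U v ∧ r z v} with he | hne
      · refine ⟨none, fun _ => .inl ⟨rfl, fun z hz hzv => ?_⟩⟩
        have : z ∈ {z | z ∉ cls V r U v ∧ r z v} := ⟨hz, hzv⟩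
        simp [he] at this
      · obtain ⟨p, hp, hmax⟩ := exists_isGreatest_of_chain h
          (hV.subset fun z hz => h.mem_left hz.2 hv) hne fun a ha b hb => h.chain ha.2 hb.2
        exact ⟨_, fun _ => .inr ⟨p, rfl, hp.1, hp.2, fun z hz hzv => hmax z ⟨hz, hzv⟩⟩⟩
    · exact ⟨none, fun hv' => absurd hv' hv⟩
  choose q hq using hpar
  obtain ⟨S, hSs, hS⟩ := Set.exists_subset_bijOn {v ∈ V | cls V r U v ∉ near} (cls V r U)
  have hSV : S ⊆ V := fun v hv => (hSs hv).1
  have hoffS : off ⊆ cls V r U '' S := by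
    rintro _ ⟨⟨v, hv, rfl⟩, hA⟩
    rw [hS.image_eq]
    exact ⟨v, ⟨hv, fun hn => hA hn.2⟩, rfl⟩
  -- A class off `W` is coded by parent class and colour. The parent class is near `W`, because it
  -- is not closed under descendants. Together this gives `near + 2 * (near + 1) = 3 * near + 2`.
  set tgt : Set (Option (Set α) × Prop) := (insert none (some '' near)) ×ˢ Set.univ with htgt
  have htf : tgt.Finite := ((hnf.image _).insert _).prod Set.finite_univ
  have htc : tgt.ncard ≤ (near.ncard + 1) * 2 := by
    rw [htgt, Set.ncard_prod]
    refine Nat.mul_le_mul ?_ (by simp [Set.ncard_univ])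
    exact (Set.ncard_insert_le _ _).trans (Nat.add_le_add_right (Set.ncard_image_le hnf) 1)
  have hmem : ∀ v ∈ V, v ∈ cls V r U v := fun v hv => mem_cls_self hV h hv
  have hoff_le : off.ncard ≤ (near.ncard + 1) * 2 := by
    refine (Set.ncard_le_ncard hoffS ((hV.subset hSV).image _)).trans
      ((Set.ncard_image_le (hV.subset hSV)).trans (le_trans ?_ htc))
    refine Set.ncard_le_ncard_of_injOn (fun v => (q v, v ∈ U)) ?_ ?_ htf
    · intro v hv
      refine ⟨?_, trivial⟩
      rcases hq v (hSV hv) with ⟨h1, -⟩ | ⟨p, h1, hp, hpv, -⟩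
      · exact .inl h1
      · refine .inr ⟨_, ?_, h1.symm⟩
        have hpV : p ∈ V := h.mem_left hpv (hSV hv)
        by_contra hn
        have he := hempty p hpV hn
        have := cls_closed he (hmem p hpV) hpv
        exact hp (cls_eq hV h hpV this ▸ hmem p hpV)
    · intro v hv w hw heq
      have hvV := hSV hv
      have hwV := hSV hw
      simp only [Prod.mk.injEq, eq_iff_iff] at heq
      obtain ⟨heq, hcol⟩ := heq
      refine hS.injOn hv hw (cls_eq_of_parent h hV hvV hwV (hempty v hvV (hSs hv).2)
        (hempty w hwV (hSs hw).2) hcol ?_)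
      -- Equal parent classes need not come with equal `p` and `p'`. By `below`, however, elements
      -- of one factor with something outside below them see the same outside elements, so each of
      -- `p`, `p'` lies above both `v` and `w`.
      have key : ∀ {v w p p' : α}, v ∈ V → w ∈ V → cls V r U p = cls V r U p' →
          p ∉ cls V r U v → r p v → p' ∉ cls V r U w → r p' w →
          (∀ z ∉ cls V r U w, r z w → r z p') → r p w ∧ r p p' := by
        intro v w p p' hv hw he hp hpv hp' hpw hmax
        have hpV := h.mem_left hpv hv
        have hpV' := h.mem_left hpw hw
        have hne : ∀ {v p}, v ∈ V → p ∈ V → p ∉ cls V r U v → v ∉ cls V r U p :=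
          fun hv hp hn hvp => hn (cls_eq hV h hp hvp ▸ hmem _ hp)
        have h1 : r p w := (cls_spec (U := U) hV h hpV).1.below v (hne hv hpV hp) w
          (he ▸ hne hw hpV' hp') p (hmem p hpV) p' (he ▸ hmem p' hpV') hpv hpw
        refine ⟨h1, hmax p (fun hpw' => ?_) h1⟩
        have h2 := cls_eq hV h hw hpw'
        exact hp' (h2 ▸ he ▸ hmem p' hpV')
      rcases hq v hvV with ⟨h1, hno⟩ | ⟨p, h1, hp, hpv, hmax⟩ <;>
        rcases hq w hwV with ⟨h1', hno'⟩ | ⟨p', h1', hp', hpv', hmax'⟩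
      · exact fun z hz hz' => iff_of_false (hno z hz) (hno' z hz')
      · rw [h1, h1'] at heq
        cases heq
      · rw [h1, h1'] at heq
        cases heq
      · rw [h1, h1', Option.some.injEq] at heq
        obtain ⟨k1, k2⟩ := key hvV hwV heq hp hpv hp' hpv' hmax'
        obtain ⟨k3, k4⟩ := key hwV hvV heq.symm hp' hpv' hp hpv hmax
        exact fun z hz hz' => ⟨fun hzv => h.trans (hmax z hz hzv) k1,
          fun hzw => h.trans (hmax' z hz' hzw) k3⟩
  have := (Set.ncard_le_ncard hall (hnf.union hof)).trans (Set.ncard_union_le _ _)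
  omega

end Counting

/-- Abstract form of the dealternation lemma: for a finite laminar family of sets whose cuts are
small, there is a tree order of the given width in which every member of the family has a bounded
number of maximal factors. -/
theorem exists_isGood_of_laminar {α : Type u} {V : Set α} {adj : α → α → Prop} {g : Set α → ℝ≥0}
    {s M : ℕ} {k : ℝ≥0} (hV : V.Finite) (hg : IsAdditive V adj g)
    (hadj : ∀ a b, adj a b → adj b a) (hs : ∀ S ⊆ V, g S ≤ k → S.ncard ≤ s)
    {𝒱 : Set ℝ≥0} (h𝒱 : 𝒱.Finite) (hval : ∀ S ⊆ V, S.ncard ≤ s → g S ∈ 𝒱)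
    (hex : ∃ r, IsGood V adj g k r) (𝒰 : Finset (Set α)) (hUV : ∀ U ∈ 𝒰, U ⊆ V)
    (hlam : ∀ U ∈ 𝒰, ∀ U' ∈ 𝒰, U ⊆ U' ∨ U' ⊆ U ∨ Disjoint U U')
    (hW : ∀ U ∈ 𝒰, closedNhd adj (cutSet adj U) (s + 2) ⊆ V ∧
      (closedNhd adj (cutSet adj U) (s + 2)).ncard ≤ M) :
    ∃ r, IsGood V adj g k r ∧
      ∀ U ∈ 𝒰, (cls V r U '' U).ncard ≤ 3 * (M + 2 * 𝒱.ncard * 2 ^ M) + 2 := by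
  classical
  -- The largest set is treated last: by laminarity every earlier set is contained in it or disjoint
  -- from it, as `exists_isExchangeReduced` requires.
  induction 𝒰 using Finset.induction_on_max_value (fun U : Set α => U.ncard) with
  | empty =>
    obtain ⟨r, hr⟩ := hex
    exact ⟨r, hr, by simp⟩
  | insert U 𝒰 hU hmax ih =>
    have hUUV := hUV U (Finset.mem_insert_self _ _)
    obtain ⟨r, hr, hr'⟩ := ih (fun U' h => hUV U' (Finset.mem_insert_of_mem h))
      (fun U' h U'' h' => hlam U' (Finset.mem_insert_of_mem h) U'' (Finset.mem_insert_of_mem h'))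
      fun U' h => hW U' (Finset.mem_insert_of_mem h)
    obtain ⟨r, ⟨hr, hr'⟩, red⟩ := exists_isExchangeReduced (U := U) (𝒰 := (𝒰 : Set (Set α)))
      (Γ := 3 * (M + 2 * 𝒱.ncard * 2 ^ M) + 2) hV hg hadj hs (fun U' hU' => by
        refine ⟨hUV U' (Finset.mem_insert_of_mem hU'), ?_⟩
        rcases hlam U (Finset.mem_insert_self _ _) U' (Finset.mem_insert_of_mem hU') with h | h | h
        · exact .inl (Set.eq_of_subset_of_ncard_le h (hmax U' hU')
            (hV.subset (hUV U' (Finset.mem_insert_of_mem hU')))).ge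
        · exact .inl h
        · exact .inr h.symm) ⟨r, hr, hr'⟩
    refine ⟨r, hr, fun U' hU' => ?_⟩
    rcases Finset.mem_insert.mp hU' with rfl | hU'
    · obtain ⟨hWV, hWM⟩ := hW U' (Finset.mem_insert_self _ _)
      refine (Set.ncard_le_ncard (Set.image_mono hUUV) (hV.image _)).trans
        (ncard_cls_le hr.order hV hg red h𝒱 hval (fun u hu => ?_) hWV hWM)
      exact hs _ (orderBag_subset hr.order hu) (hr.width u hu)
    · exact hr' U' hU'

/-! ### Rooted forests and tree orders -/

namespace RootedForest

variable {N : Type v} (T : RootedForest N)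

/-- The ancestor relation, extended by the identity to all elements. -/
def le (a b : N) : Prop := a = b ∨ T.Ancestor a b

theorem le_refl (a : N) : T.le a a := .inl rfl

theorem ancestor_iff {a b : N} (ha : a ∈ T.nodes) : T.Ancestor a b ↔ T.le a b :=
  ⟨.inr, fun h => h.elim (fun h => h ▸ ⟨ha, .refl⟩) id⟩

theorem reflTransGen_of_le {a b : N} (h : T.le a b) : Relation.ReflTransGen T.arc a b := by
  rcases h with rfl | h
  · exact .refl
  · exact h.2

theorem le_of_arc {a b : N} (h : T.arc a b) : T.le a b := .inr ⟨(T.arc_mem a b h).1, .single h⟩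

theorem not_arc_self (a : N) : ¬ T.arc a a := fun h => T.acyclic a (.single h)

theorem isTreeOrder_le : IsTreeOrder T.nodes T.le where
  refl a := .inl rfl
  trans {a b c} hab hbc := by
    rcases hab with rfl | hab
    · exact hbc
    rcases hbc with rfl | hbc
    · exact .inr hab
    · exact .inr ⟨hab.1, hab.2.trans hbc.2⟩
  antisymm {a b} hab hba := by
    have h1 := T.reflTransGen_of_le hab
    have h2 := T.reflTransGen_of_le hba
    rcases Relation.reflTransGen_iff_eq_or_transGen.mp h1 with h | h
    · exact h.symm
    · exact absurd (h.trans_left h2) (T.acyclic a)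
  chain {a b c} hac hbc := by
    rcases hac with rfl | hac
    · exact .inr hbc
    rcases hbc with rfl | hbc
    · exact .inl (.inr hac)
    have hu : Relator.RightUnique (Function.swap T.arc) := fun x p q hp hq =>
      T.parent_unique p q x hp hq
    have h1 := Relation.reflTransGen_swap.mpr hac.2
    have h2 := Relation.reflTransGen_swap.mpr hbc.2
    rcases Relation.ReflTransGen.total_of_right_unique hu h1 h2 with h | h
    · exact .inr (.inr ⟨hbc.1, Relation.reflTransGen_swap.mp h⟩)
    · exact .inl (.inr ⟨hac.1, Relation.reflTransGen_swap.mp h⟩)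
  supp {a b} hab := by
    rcases hab with rfl | ⟨ha, hab⟩
    · exact .inl rfl
    · refine (eq_or_ne a b).imp id fun hne => ⟨ha, ?_⟩
      rcases hab.cases_tail with h | ⟨c, -, h⟩
      · exact absurd h.symm hne
      · exact (T.arc_mem c b h).2

theorem exists_arc_of_le {a b : N} (h : T.le a b) (hne : a ≠ b) : ∃ p, T.arc p b ∧ T.le a p := by
  rcases h with rfl | ⟨ha, h⟩
  · exact absurd rfl hne
  rcases h.cases_tail with h | ⟨c, h1, h2⟩
  · exact absurd h.symm hne
  · exact ⟨c, h2, .inr ⟨ha, h1⟩⟩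

theorem mem_desc_iff {x y : N} (hx : x ∈ T.nodes) : y ∈ T.desc x ↔ T.le x y := T.ancestor_iff hx

theorem IsForestFactorWithRoots.spec {R A : Set N} (h : T.IsForestFactorWithRoots R A) :
    A.Nonempty ∧ A ⊆ T.nodes ∧ (∀ a ∈ A, ∀ b, T.le a b → b ∈ A) ∧
      ∀ z ∉ A, ∀ a ∈ A, ∀ b ∈ A, T.le z a → T.le z b := by
  obtain ⟨⟨x₀, hx₀⟩, hR, hsib, rfl⟩ := h
  have ho := T.isTreeOrder_le
  have hm : ∀ a, a ∈ ⋃ x ∈ R, T.desc x ↔ ∃ x ∈ R, T.le x a := fun a => by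
    simp only [Set.mem_iUnion, exists_prop]
    exact exists_congr fun x => and_congr_right fun hx => T.mem_desc_iff (hR hx)
  refine ⟨⟨x₀, (hm _).mpr ⟨x₀, hx₀, .inl rfl⟩⟩, ?_, ?_, ?_⟩
  · intro a ha
    obtain ⟨x, hx, hxa⟩ := (hm a).mp ha
    exact ho.mem_right hxa (hR hx)
  · intro a ha b hab
    obtain ⟨x, hx, hxa⟩ := (hm a).mp ha
    exact (hm b).mpr ⟨x, hx, ho.trans hxa hab⟩
  · intro z hz a ha b hb hza
    obtain ⟨x, hx, hxa⟩ := (hm a).mp ha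
    obtain ⟨y, hy, hyb⟩ := (hm b).mp hb
    have hzx : T.le z x := (ho.chain hza hxa).resolve_right fun h => hz ((hm z).mpr ⟨x, hx, h⟩)
    have hne : z ≠ x := fun h => hz ((hm z).mpr ⟨x, hx, .inl h.symm⟩)
    obtain ⟨p, hp, hzp⟩ := T.exists_arc_of_le hzx hne
    exact ho.trans hzp (ho.trans (T.le_of_arc ((hsib x hx y hy p).mp hp)) hyb)

theorem exists_isForestFactorWithRoots {A : Set N} (hne : A.Nonempty) (hA : A ⊆ T.nodes)
    (hcl : ∀ a ∈ A, ∀ b, T.le a b → b ∈ A)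
    (hab : ∀ z ∉ A, ∀ a ∈ A, ∀ b ∈ A, T.le z a → T.le z b) :
    ∃ R ⊆ A, T.IsForestFactorWithRoots R A := by
  have ho := T.isTreeOrder_le
  have hroot : ∀ a ∈ A, ∃ x ∈ A, (∀ p, T.arc p x → p ∉ A) ∧ T.le x a := by
    intro a ha
    obtain ⟨x, ⟨hx, hxa⟩, hmin⟩ := exists_isLeast_of_chain ho (S := {z ∈ A | T.le z a})
      (T.finite_nodes.subset fun z hz => hA hz.1) ⟨a, ha, .inl rfl⟩
      fun b hb c hc => ho.chain hb.2 hc.2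
    refine ⟨x, hx, fun p hp hpA => ?_, hxa⟩
    have h1 := T.le_of_arc hp
    have h2 := ho.antisymm (hmin p ⟨hpA, ho.trans h1 hxa⟩) h1
    exact T.not_arc_self x (h2 ▸ hp : T.arc x x)
  refine ⟨{x ∈ A | ∀ p, T.arc p x → p ∉ A}, fun x hx => hx.1, ?_, fun x hx => hA hx.1, ?_, ?_⟩
  · obtain ⟨a, ha⟩ := hne
    obtain ⟨x, hx, hx', -⟩ := hroot a ha
    exact ⟨x, hx, hx'⟩
  · have key : ∀ x ∈ A, (∀ p, T.arc p x → p ∉ A) → ∀ y ∈ A, (∀ p, T.arc p y → p ∉ A) →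
        ∀ p, T.arc p x → T.arc p y := by
      intro x hx hx' y hy hy' p hp
      have hpA := hx' p hp
      obtain ⟨q, hq, hpq⟩ := T.exists_arc_of_le (hab p hpA x hx y hy (T.le_of_arc hp))
        (fun h => hpA (h ▸ hy))
      have hqA := hy' q hq
      obtain ⟨p', hp', hqp⟩ := T.exists_arc_of_le (hab q hqA y hy x hx (T.le_of_arc hq))
        (fun h => hqA (h ▸ hx))
      rw [T.parent_unique p' p x hp' hp] at hqp
      rwa [ho.antisymm hpq hqp]
    rintro x ⟨hx, hx'⟩ y ⟨hy, hy'⟩ p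
    exact ⟨key x hx hx' y hy hy' p, key y hy hy' x hx hx' p⟩
  · ext a
    simp only [Set.mem_iUnion, exists_prop]
    constructor
    · intro ha
      obtain ⟨x, hx, hx', hxa⟩ := hroot a ha
      exact ⟨x, ⟨hx, hx'⟩, (T.mem_desc_iff (hA hx)).mpr hxa⟩
    · rintro ⟨x, ⟨hx, -⟩, hxa⟩
      exact hcl x hx a ((T.mem_desc_iff (hA hx)).mp hxa)

/-- The two kinds of factor are told apart by `strictBelow`. If it is empty, `A` is a forest factor.
Otherwise `A` has a least element `x`, and `strictBelow` is the forest factor removed from the tree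
factor at `x`. -/
theorem isFactor_iff {A : Set N} : T.IsFactor A ↔ IsFac T.nodes T.le A := by
  have ho := T.isTreeOrder_le
  constructor
  · rintro (⟨R, hR⟩ | ⟨x, hx, R, Y, hR, hRx, rfl⟩)
    · obtain ⟨h1, h2, h3, h4⟩ := hR.spec
      exact ⟨h1, h2, h4, fun z hz _ _ a ha _ _ haz => absurd (h3 a ha z haz) hz,
        fun z hz a ha haz => absurd (h3 a ha z haz) hz⟩
    · obtain ⟨h1, h2, h3, h4⟩ := hR.spec
      have hm : ∀ a, a ∈ T.desc x ↔ T.le x a := fun a => T.mem_desc_iff hx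
      have hxA : x ∈ T.desc x \ Y := by
        refine ⟨(hm x).mpr (.inl rfl), fun hxY => ?_⟩
        rw [hR.2.2.2] at hxY
        simp only [Set.mem_iUnion, exists_prop] at hxY
        obtain ⟨y, hy, hyx⟩ := hxY
        exact (hRx y hy).2 (ho.antisymm (.inr hyx) (.inr (hRx y hy).1))
      have hout : ∀ z ∉ T.desc x \ Y, ∀ a ∈ T.desc x \ Y, T.le a z → z ∈ Y := by
        intro z hz a ha haz
        by_contra hzY
        exact hz ⟨(hm z).mpr (ho.trans ((hm a).mp ha.1) haz), hzY⟩
      refine ⟨⟨x, hxA⟩, fun a ha => ho.mem_right ((hm a).mp ha.1) hx, ?_, ?_, ?_⟩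
      · intro z hz a ha b hb hza
        suffices T.le z x from ho.trans this ((hm b).mp hb.1)
        refine (ho.chain hza ((hm a).mp ha.1)).resolve_right fun hxz => ?_
        by_cases hzY : z ∈ Y
        · exact ha.2 (h3 z hzY a hza)
        · exact hz ⟨(hm z).mpr hxz, hzY⟩
      · intro z hz z' hz' a ha b hb haz hbz
        exact h4 a ha.2 z (hout z hz a ha haz) z' (hout z' hz' b hb hbz) haz
      · exact fun _ _ _ _ _ => ⟨x, hxA, fun b hb => (hm b).mp hb.1⟩
  · intro hA
    rcases (strictBelow T.le A).eq_empty_or_nonempty with he | hne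
    · obtain ⟨R, -, hR⟩ := T.exists_isForestFactorWithRoots hA.nonempty hA.subset
        (fun a ha b hab => by
          by_contra hb
          have : b ∈ strictBelow T.le A := ⟨hb, a, ha, hab⟩
          simp [he] at this) hA.above
      exact .inl ⟨R, hR⟩
    · obtain ⟨x, hx, hxA⟩ := hA.least_of_strictBelow hne
      obtain ⟨R, hRY, hR⟩ := T.exists_isForestFactorWithRoots hne (hA.strictBelow_subset ho)
        (fun a ha b hab => hA.strictBelow_closed ho ha hab)
        fun z hz a ha b hb hza => hA.strictBelow_above ho hz ha hb hza
      have hm : ∀ z, z ∈ strictBelow T.le A ↔ z ∉ A ∧ T.le x z := fun z =>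
        IsFac.mem_strictBelow_iff ho hx hxA
      have hxn := hA.subset hx
      refine .inr ⟨x, hxn, R, _, hR, fun y hy => ?_, ?_⟩
      · have := (hm y).mp (hRY hy)
        exact ⟨(T.ancestor_iff hxn).mpr this.2, fun h => this.1 (h ▸ hx)⟩
      · ext a
        rw [Set.mem_sdiff, hm, T.mem_desc_iff hxn]
        have := hxA a
        tauto

theorem ncard_MF_le {U : Set N} (hU : U ⊆ T.nodes) :
    (T.MF U).ncard ≤ (cls T.nodes T.le U '' U).ncard := by
  have ho := T.isTreeOrder_le
  refine Set.ncard_le_ncard ?_ ((T.finite_nodes.subset hU).image _)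
  intro A hA
  replace hA : Maximal (fun B => T.IsFactor B ∧ B ⊆ U) A := hA
  have hF := T.isFactor_iff.mp hA.prop.1
  obtain ⟨a, ha⟩ := hF.nonempty
  have haU := hA.prop.2 ha
  obtain ⟨h1, h2, h3⟩ := cls_spec (U := U) T.finite_nodes ho (hU haU)
  have hsub : A ⊆ cls T.nodes T.le U a :=
    subset_cls hF (fun b hb c hc => iff_of_true (hA.prop.2 hb) (hA.prop.2 hc)) ha
  refine ⟨a, haU, Set.Subset.antisymm ?_ hsub⟩
  exact hA.2 ⟨T.isFactor_iff.mpr h1, fun b hb => (h2 a h3 b hb).mp haU⟩ hsub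

/-- A set closed under descendants is well-formed. -/
theorem wellFormed_of_closed {U : Set N} (hU : ∀ a ∈ U, ∀ b, T.Ancestor a b → b ∈ U) :
    T.WellFormed U := by
  rintro A hA ⟨x, hx, R, Y, hR, hRx, rfl⟩
  replace hA : Maximal (fun B => T.IsFactor B ∧ B ⊆ U) (T.desc x \ Y) := hA
  have hF := T.isFactor_iff.mp hA.prop.1
  obtain ⟨y, hy⟩ := hR.1
  have hyY : y ∈ Y := by
    rw [hR.2.2.2]
    simp only [Set.mem_iUnion, exists_prop]
    exact ⟨y, hy, hR.2.1 hy, .refl⟩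
  have hd : T.IsFactor (T.desc x) := by
    refine .inl ⟨{x}, ⟨x, rfl⟩, by simpa using hx, ?_, by simp⟩
    rintro a rfl b rfl p
    rfl
  obtain ⟨a, ha⟩ := hF.nonempty
  have hxU : x ∈ U := by
    by_contra hxU
    obtain ⟨h1, h2, h3, h4⟩ := hR.spec
    have hxY : x ∉ Y := by
      intro hxY
      rw [hR.2.2.2] at hxY
      simp only [Set.mem_iUnion, exists_prop] at hxY
      obtain ⟨y, hy, hyx⟩ := hxY
      exact (hRx y hy).2 (T.isTreeOrder_le.antisymm (.inr hyx) (.inr (hRx y hy).1))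
    exact hxU (hA.prop.2 ⟨⟨hx, .refl⟩, hxY⟩)
  exact (hA.2 ⟨hd, fun b hb => hU x hxU b hb⟩ Set.sdiff_subset (hRx y hy).1).2 hyY

/-- The rooted forest with a given ancestor relation. -/
def ofOrder (V : Set N) (r : N → N → Prop) (hV : V.Finite) (h : IsTreeOrder V r) :
    RootedForest N where
  nodes := V
  finite_nodes := hV
  arc p x := p ∈ V ∧ x ∈ V ∧ r p x ∧ p ≠ x ∧ ∀ z, r p z → r z x → z = p ∨ z = x
  arc_mem p x hpx := ⟨hpx.1, hpx.2.1⟩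
  parent_unique p q x hp hq := by
    obtain ⟨-, -, hp, hpx, hp'⟩ := hp
    obtain ⟨-, -, hq, hqx, hq'⟩ := hq
    rcases h.chain hp hq with hpq | hqp
    · exact ((hp' q hpq hq).resolve_right hqx).symm
    · exact (hq' p hqp hp).resolve_right hpx
  acyclic x hx := by
    have key : ∀ a b, Relation.TransGen (fun p x => p ∈ V ∧ x ∈ V ∧ r p x ∧ p ≠ x ∧
        ∀ z, r p z → r z x → z = p ∨ z = x) a b → r a b ∧ a ≠ b := by
      intro a b hab
      induction hab with
      | single hab => exact ⟨hab.2.2.1, hab.2.2.2.1⟩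
      | tail _ hbc ih =>
        refine ⟨h.trans ih.1 hbc.2.2.1, ?_⟩
        rintro rfl
        exact ih.2 (h.antisymm ih.1 hbc.2.2.1)
    exact (key x x hx).2 rfl

theorem le_ofOrder {V : Set N} {r : N → N → Prop} (hV : V.Finite) (h : IsTreeOrder V r) :
    (ofOrder V r hV h).le = r := by
  funext a b
  refine propext ⟨fun hab => ?_, fun hab => ?_⟩
  · have := (ofOrder V r hV h).reflTransGen_of_le hab
    clear hab
    induction this with
    | refl => exact h.refl a
    | tail h1 h2 ih =>
      have hbV : _ ∈ V := h2.1
      exact h.trans ih h2.2.2.1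
  · rcases h.supp hab with rfl | ⟨ha, hb⟩
    · exact .inl rfl
    refine .inr ⟨ha, ?_⟩
    induction hn : {z | r z b}.ncard using Nat.strong_induction_on generalizing b with
    | _ n ih =>
      by_cases hne : a = b
      · exact hne ▸ .refl
      have hfin : ∀ b ∈ V, {z | r z b}.Finite := fun b hb => hV.subset fun z hz => h.mem_left hz hb
      obtain ⟨p, ⟨hap, hpb, hpne⟩, hmax⟩ := exists_isGreatest_of_chain h
        (S := {z | r a z ∧ r z b ∧ z ≠ b}) ((hfin b hb).subset fun z hz => hz.2.1)
        ⟨a, h.refl a, hab, hne⟩ fun c hc d hd => h.chain hc.2.1 hd.2.1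
      have hpV := h.mem_left hpb hb
      refine (ih {z | r z p}.ncard ?_ p hap hpV rfl).tail ⟨hpV, hb, hpb, hpne, fun z hpz hzb => ?_⟩
      · rw [← hn]
        refine Set.ncard_lt_ncard ⟨fun z hz => h.trans hz hpb, fun hle => ?_⟩ (hfin b hb)
        exact hpne (h.antisymm hpb (hle (h.refl b)))
      · by_cases hzb' : z = b
        · exact .inr hzb'
        · exact .inl (h.antisymm (hmax z ⟨h.trans hap hpz, hzb, hzb'⟩) hpz)

end RootedForest

namespace EliminationForest

variable {α : Type u} {H : Hypergraph α} (F : EliminationForest H)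

/-- The elimination forest with a given ancestor relation. -/
def ofOrder (hV : V(H).Finite) {r : α → α → Prop} (h : IsTreeOrder V(H) r)
    (he : ∀ a b, H.Adj a b → r a b ∨ r b a) : EliminationForest H where
  toRootedForest := RootedForest.ofOrder V(H) r hV h
  nodes_eq := rfl
  comparable a b hab := by
    obtain ⟨e, he', ha, hb⟩ := id hab
    have haV := H.mem_vertexSet_of_mem_edgeSet he' ha
    have hbV := H.mem_vertexSet_of_mem_edgeSet he' hb
    rw [RootedForest.ancestor_iff _ (by exact haV), RootedForest.ancestor_iff _ (by exact hbV),
      RootedForest.le_ofOrder]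
    exact he a b hab

theorem bag_eq {u : α} (hu : u ∈ V(H)) : F.bag u = orderBag H.Adj F.le u := by
  have hun : u ∈ F.nodes := F.nodes_eq ▸ hu
  ext v
  simp only [bag, orderBag, Set.mem_ofPred_eq, F.ancestor_iff hun]
  constructor
  · rintro (hv | ⟨hv, hw⟩)
    · exact .inl hv
    · exact .inr ⟨.inr hv, hw⟩
  · rintro (hv | ⟨rfl | hv, hw⟩)
    · exact .inl hv
    · exact .inl rfl
    · exact .inr ⟨hv, hw⟩

end EliminationForest

/-! ### Tree decompositions -/

namespace TreeDecomposition

variable {α : Type u} {H : Hypergraph α} {ι : Type v} (t : TreeDecomposition H ι)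

/-- Start from the highest ancestor of some node `x₀` whose bag contains `v`. A path through nodes
whose bags contain `v` cannot leave its subtree, since the first step out would go to its parent. -/
theorem exists_top {v : α} (hv : v ∈ V(H)) : ∃ x ∈ t.nodes, v ∈ t.bag x ∧
    ∀ y ∈ t.nodes, v ∈ t.bag y → t.le x y ∧ ∀ b, t.le x b → t.le b y → v ∈ t.bag b := by
  have ho := t.isTreeOrder_le
  have hc := t.connected v hv
  obtain ⟨⟨x₀, hx₀, hx₀v⟩⟩ := hc.nonempty
  obtain ⟨x, ⟨hx, hxv, hxx₀⟩, hmin⟩ := exists_isLeast_of_chain ho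
    (S := {z | z ∈ t.nodes ∧ v ∈ t.bag z ∧ t.le z x₀}) (t.finite_nodes.subset fun z hz => hz.1)
    ⟨x₀, hx₀, hx₀v, t.le_refl _⟩ fun a ha b hb => ho.chain ha.2.2 hb.2.2
  refine ⟨x, hx, hxv, fun y hy hyv => ?_⟩
  have hreach := hc.preconnected ⟨x, hx, hxv⟩ ⟨y, hy, hyv⟩
  rw [SimpleGraph.reachable_iff_reflTransGen] at hreach
  suffices ∀ q : {x | x ∈ t.nodes ∧ v ∈ t.bag x}, Relation.ReflTransGen
      (t.graph.induce {x | x ∈ t.nodes ∧ v ∈ t.bag x}).Adj ⟨x, hx, hxv⟩ q →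
      t.le x q.1 ∧ ∀ b, t.le x b → t.le b q.1 → v ∈ t.bag b from this _ hreach
  intro q hq
  induction hq with
  | refl => exact ⟨t.le_refl _, fun b h1 h2 => ho.antisymm h1 h2 ▸ hxv⟩
  | @tail p q _ hpq ih =>
    obtain ⟨ih1, ih2⟩ := ih
    have hadj : p.1 ≠ q.1 ∧ (t.arc p.1 q.1 ∨ t.arc q.1 p.1) := hpq
    obtain ⟨hne, harc | harc⟩ := hadj
    · refine ⟨ho.trans ih1 (t.le_of_arc harc), fun b hxb hbq => ?_⟩
      by_cases hb : b = q.1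
      · exact hb ▸ q.2.2
      · obtain ⟨p', hp', hbp⟩ := t.exists_arc_of_le hbq hb
        rw [t.parent_unique _ _ _ hp' harc] at hbp
        exact ih2 b hxb hbp
    · by_cases hxp : x = p.1
      · have hqx := hxp ▸ t.le_of_arc harc
        have := hmin q.1 ⟨q.2.1, q.2.2, ho.trans hqx hxx₀⟩
        exact absurd (hxp ▸ ho.antisymm this hqx) hne
      · obtain ⟨p', hp', hxp'⟩ := t.exists_arc_of_le ih1 hxp
        rw [t.parent_unique _ _ _ hp' harc] at hxp'
        exact ⟨hxp', fun b hxb hbq => ih2 b hxb (ho.trans hbq (t.le_of_arc harc))⟩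

open Classical in
/-- The topmost node whose bag contains `v`. -/
def top (v : α) : ι := if hv : v ∈ V(H) then (t.exists_top hv).choose
  else t.existsUnique_root.choose

variable {t}

theorem top_spec {v : α} (hv : v ∈ V(H)) : t.top v ∈ t.nodes ∧ v ∈ t.bag (t.top v) ∧
    ∀ y ∈ t.nodes, v ∈ t.bag y →
      t.le (t.top v) y ∧ ∀ b, t.le (t.top v) b → t.le b y → v ∈ t.bag b := by
  rw [top, dif_pos hv]
  exact (t.exists_top hv).choose_spec

theorem exists_common_bag {v w : α} (h : H.Adj v w) :
    v ∈ V(H) ∧ w ∈ V(H) ∧ ∃ z ∈ t.nodes, v ∈ t.bag z ∧ w ∈ t.bag z := by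
  obtain ⟨e, he, hv, hw⟩ := h
  obtain ⟨z, hz, hez⟩ := t.edge_subset_bag e he
  exact ⟨H.mem_vertexSet_of_mem_edgeSet he hv, H.mem_vertexSet_of_mem_edgeSet he hw, z, hz,
    hez hv, hez hw⟩

theorem mem_mrg_iff {y : ι} (hy : y ∈ t.nodes) {v : α} :
    v ∈ t.mrg y ↔ v ∈ V(H) ∧ t.top v = y := by
  have ho := t.isTreeOrder_le
  constructor
  · rintro ⟨hvy, hadh⟩
    have hv := t.bag_subset y hy hvy
    obtain ⟨h1, h2, h3⟩ := top_spec (t := t) hv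
    refine ⟨hv, ?_⟩
    by_contra hne
    obtain ⟨h4, h5⟩ := h3 y hy hvy
    obtain ⟨p, hp, hle⟩ := t.exists_arc_of_le h4 hne
    exact hadh ⟨hvy, p, hp, h5 p hle (t.le_of_arc hp)⟩
  · rintro ⟨hv, rfl⟩
    obtain ⟨h1, h2, h3⟩ := top_spec (t := t) hv
    refine ⟨h2, ?_⟩
    rintro ⟨-, p, hp, hvp⟩
    have := (h3 p (t.arc_mem _ _ hp).1 hvp).1
    have heq := ho.antisymm this (t.le_of_arc hp)
    exact t.not_arc_self p (by rwa [heq] at hp)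

theorem mem_cmp_iff {x : ι} (hx : x ∈ t.nodes) {v : α} :
    v ∈ t.cmp x ↔ v ∈ V(H) ∧ t.le x (t.top v) := by
  have ho := t.isTreeOrder_le
  simp only [cmp, Set.mem_iUnion, exists_prop]
  constructor
  · rintro ⟨y, hy, hv⟩
    have hxy := (t.mem_desc_iff hx).mp hy
    obtain ⟨h1, rfl⟩ := (mem_mrg_iff (ho.mem_right hxy hx)).mp hv
    exact ⟨h1, hxy⟩
  · rintro ⟨hv, hxv⟩
    exact ⟨_, (t.mem_desc_iff hx).mpr hxv, (mem_mrg_iff (top_spec hv).1).mpr ⟨hv, rfl⟩⟩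

theorem cmp_subset {x : ι} (hx : x ∈ t.nodes) : t.cmp x ⊆ V(H) := fun _ hv =>
  ((mem_cmp_iff hx).mp hv).1

theorem cmp_laminar {x y : ι} (hx : x ∈ t.nodes) (hy : y ∈ t.nodes) :
    t.cmp x ⊆ t.cmp y ∨ t.cmp y ⊆ t.cmp x ∨ Disjoint (t.cmp x) (t.cmp y) := by
  have ho := t.isTreeOrder_le
  by_cases hd : Disjoint (t.cmp x) (t.cmp y)
  · exact .inr (.inr hd)
  obtain ⟨v, hvx, hvy⟩ := Set.not_disjoint_iff.mp hd
  rcases ho.chain ((mem_cmp_iff hx).mp hvx).2 ((mem_cmp_iff hy).mp hvy).2 with h | h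
  · refine .inr (.inl fun w hw => ?_)
    have := (mem_cmp_iff hy).mp hw
    exact (mem_cmp_iff hx).mpr ⟨this.1, ho.trans h this.2⟩
  · refine .inl fun w hw => ?_
    have := (mem_cmp_iff hx).mp hw
    exact (mem_cmp_iff hy).mpr ⟨this.1, ho.trans h this.2⟩

/-- The neighbours of the component of `x` lie in the adhesion of `x`. -/
theorem mem_bag_of_adj_cmp {x : ι} (hx : x ∈ t.nodes) {v w : α} (hv : v ∈ t.cmp x)
    (hw : w ∉ t.cmp x) (h : H.Adj v w) : w ∈ t.bag x ∧ ∀ p, t.arc p x → w ∈ t.bag p := by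
  have ho := t.isTreeOrder_le
  obtain ⟨hvV, hwV, z, hz, hvz, hwz⟩ := exists_common_bag (t := t) h
  obtain ⟨-, -, h3⟩ := top_spec (t := t) hvV
  obtain ⟨-, -, k3⟩ := top_spec (t := t) hwV
  have hxz : t.le x z := ho.trans ((mem_cmp_iff hx).mp hv).2 (h3 z hz hvz).1
  obtain ⟨k4, k5⟩ := k3 z hz hwz
  have hnot : ¬ t.le x (t.top w) := fun h => hw ((mem_cmp_iff hx).mpr ⟨hwV, h⟩)
  have hwx := (ho.chain k4 hxz).resolve_right hnot
  refine ⟨k5 x hwx hxz, fun p hp => ?_⟩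
  have hne : t.top w ≠ x := fun h => hnot (h ▸ t.le_refl _)
  obtain ⟨p', hp', hwp⟩ := t.exists_arc_of_le hwx hne
  rw [t.parent_unique _ _ _ hp' hp] at hwp
  exact k5 p hwp (ho.trans (t.le_of_arc hp) hxz)

theorem disjoint_cmp_of_arc {x y y' : ι} (hy : t.arc x y) (hy' : t.arc x y') {v : α}
    (hv : v ∈ t.cmp y) (hv' : v ∈ t.cmp y') : y = y' := by
  have ho := t.isTreeOrder_le
  have key : ∀ y y', t.arc x y → t.arc x y' → t.le y y' → y = y' := by
    intro y y' hy hy' hle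
    by_contra hne
    obtain ⟨p, hp, hyp⟩ := t.exists_arc_of_le hle hne
    rw [t.parent_unique _ _ _ hp hy'] at hyp
    have := ho.antisymm hyp (t.le_of_arc hy)
    exact t.not_arc_self x (by rwa [this] at hy)
  rcases ho.chain ((mem_cmp_iff (t.arc_mem _ _ hy).2).mp hv).2
    ((mem_cmp_iff (t.arc_mem _ _ hy').2).mp hv').2 with h | h
  · exact key y y' hy hy' h
  · exact (key y' y hy' hy h).symm

theorem ncard_bag_le {x : ι} (hx : x ∈ t.nodes) : (t.bag x).ncard ≤ t.tw + 1 := by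
  have : (t.bag x).ncard ≤ sSup ((fun x => (t.bag x).ncard) '' t.nodes) :=
    le_csSup (t.finite_nodes.image _).bddAbove ⟨x, hx, rfl⟩
  unfold tw
  omega

variable (t)

/-- A tree decomposition yields an elimination forest whose bags are contained in bags. -/
theorem exists_eliminationForest (hV : V(H).Finite) :
    ∃ F : EliminationForest H, ∀ u ∈ V(H), ∃ x ∈ t.nodes, F.bag u ⊆ t.bag x := by
  classical
  have ho := t.isTreeOrder_le
  let _ : LinearOrder α := IsWellOrder.linearOrder (WellOrderingRel (α := α))
  -- Vertices are ordered by their topmost nodes, and those with the same topmost node linearly. The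
  -- bag of `u` is then contained in the bag of the topmost node of `u`.
  let r : α → α → Prop := fun a b => a = b ∨ (a ∈ V(H) ∧ b ∈ V(H) ∧
    ((t.top a ≠ t.top b ∧ t.le (t.top a) (t.top b)) ∨ (t.top a = t.top b ∧ a ≤ b)))
  have hle : ∀ {a b}, r a b → t.le (t.top a) (t.top b) := by
    rintro a b (rfl | ⟨-, -, h | h⟩)
    · exact t.le_refl _
    · exact h.2
    · exact h.1 ▸ t.le_refl _
  have htot : ∀ {a b}, a ∈ V(H) → b ∈ V(H) → t.le (t.top a) (t.top b) ∨ t.le (t.top b) (t.top a) →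
      r a b ∨ r b a := by
    intro a b ha hb h
    by_cases he : t.top a = t.top b
    · rcases le_total a b with h' | h'
      · exact .inl (.inr ⟨ha, hb, .inr ⟨he, h'⟩⟩)
      · exact .inr (.inr ⟨hb, ha, .inr ⟨he.symm, h'⟩⟩)
    · exact h.imp (fun h => .inr ⟨ha, hb, .inl ⟨he, h⟩⟩)
        fun h => .inr ⟨hb, ha, .inl ⟨fun h => he h.symm, h⟩⟩
  have hr : IsTreeOrder V(H) r := by
    refine ⟨fun a => .inl rfl, ?_, ?_, ?_, ?_⟩
    · rintro a b c hab hbc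
      have h1 := hle hab
      have h2 := hle hbc
      rcases hab with rfl | ⟨ha, hb, hab⟩
      · exact hbc
      rcases hbc with rfl | ⟨-, hc, hbc⟩
      · exact .inr ⟨ha, hb, hab⟩
      refine .inr ⟨ha, hc, ?_⟩
      by_cases hac : t.top a = t.top c
      · refine .inr ⟨hac, ?_⟩
        have hab' : t.top a = t.top b := ho.antisymm h1 (hac ▸ h2)
        have hbc' : t.top b = t.top c := hab' ▸ hac
        exact ((hab.resolve_left fun h => h.1 hab').2).trans (hbc.resolve_left fun h => h.1 hbc').2
      · exact .inl ⟨hac, ho.trans h1 h2⟩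
    · rintro a b hab hba
      have he := ho.antisymm (hle hab) (hle hba)
      rcases hab with rfl | ⟨-, -, hab⟩
      · rfl
      rcases hba with rfl | ⟨-, -, hba⟩
      · rfl
      exact le_antisymm (hab.resolve_left fun h => h.1 he).2
        (hba.resolve_left fun h => h.1 he.symm).2
    · rintro a b c hac hbc
      have hch := ho.chain (hle hac) (hle hbc)
      rcases hac with rfl | ⟨ha, hc, hac⟩
      · exact .inr hbc
      rcases hbc with rfl | ⟨hb, -, hbc⟩
      · exact .inl (.inr ⟨ha, hc, hac⟩)
      exact htot ha hb hch
    · rintro a b (rfl | ⟨ha, hb, -⟩)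
      · exact .inl rfl
      · exact .inr ⟨ha, hb⟩
  have he : ∀ a b, H.Adj a b → r a b ∨ r b a := by
    intro a b hab
    obtain ⟨ha, hb, z, hz, haz, hbz⟩ := exists_common_bag (t := t) hab
    exact htot ha hb (ho.chain ((top_spec ha).2.2 z hz haz).1 ((top_spec hb).2.2 z hz hbz).1)
  refine ⟨.ofOrder hV hr he, fun u hu => ⟨t.top u, (top_spec hu).1, ?_⟩⟩
  rw [EliminationForest.bag_eq _ hu]
  have hle' : (EliminationForest.ofOrder hV hr he).le = r := RootedForest.le_ofOrder hV hr
  rw [hle']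
  rintro v (rfl | ⟨hvu, w, huw, hvw⟩)
  · exact (top_spec hu).2.1
  · obtain ⟨hv, hw, z, hz, hvz, hwz⟩ := exists_common_bag (t := t) hvw
    have h1 := ((top_spec hw).2.2 z hz hwz).1
    exact ((top_spec hv).2.2 z hz hvz).2 _ (hle hvu) (ho.trans (hle huw) h1)

end TreeDecomposition

/-! ### From elimination forests to tree decompositions -/

namespace EliminationForest

variable {α : Type u} {H : Hypergraph α} (F : EliminationForest H)

theorem le_of_mem_bag {u v : α} (h : v ∈ F.bag u) : F.le v u := by
  rcases h with rfl | ⟨h, -⟩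
  · exact F.le_refl _
  · exact .inr h

theorem bag_subset {u : α} (hu : u ∈ V(H)) : F.bag u ⊆ V(H) := fun _ hv =>
  F.nodes_eq ▸ F.isTreeOrder_le.mem_left (F.le_of_mem_bag hv) (F.nodes_eq ▸ hu)

/-- The tree decomposition induced by an elimination forest. -/
theorem exists_treeDecomposition (hH : H.IsProper) : ∃ (ι : Type) (t : TreeDecomposition H ι),
    ∀ x ∈ t.nodes, t.bag x = ∅ ∨ ∃ u ∈ V(H), t.bag x = F.bag u := by
  classical
  have ho := F.isTreeOrder_le
  have hfin := hH.finite.to_subtype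
  obtain ⟨n, ⟨e⟩⟩ := Finite.exists_equiv_fin V(H)
  let ψ : Fin n → α := fun i => (e.symm i).1
  have hψ : ∀ i, ψ i ∈ V(H) := fun i => (e.symm i).2
  have hinj : ∀ {i j}, ψ i = ψ j → i = j := fun h => e.symm.injective (Subtype.ext h)
  have hsurj : ∀ v ∈ V(H), ∃ i, ψ i = v := fun v hv => ⟨e ⟨v, hv⟩, by simp [ψ]⟩
  -- The node `none` is an additional root with empty bag that joins the trees of `F` into one.
  -- Nodes are indexed by `Fin n` because `Hypergraph.fWidth` ranges over index types in `Type`.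
  let arc : Option (Fin n) → Option (Fin n) → Prop := fun p x =>
    match p, x with
    | none, some i => F.IsRoot (ψ i)
    | some i, some j => F.arc (ψ i) (ψ j)
    | _, none => False
  have harc : ∀ {p x}, arc p x → ∃ j, x = some j ∧ (p = none → F.IsRoot (ψ j)) ∧
      ∀ i, p = some i → F.arc (ψ i) (ψ j) := by
    rintro (_ | i) (_ | j) h
    · exact h.elim
    · exact ⟨j, rfl, fun _ => h, by simp⟩
    · exact h.elim
    · exact ⟨j, rfl, by simp, by rintro i' h'; cases h'; exact h⟩
  have hroot : ∀ j, F.IsRoot (ψ j) ∨ ∃ i, F.arc (ψ i) (ψ j) := by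
    intro j
    by_cases h : ∃ p, F.arc p (ψ j)
    · obtain ⟨p, hp⟩ := h
      obtain ⟨i, rfl⟩ := hsurj p (F.nodes_eq ▸ (F.arc_mem _ _ hp).1)
      exact .inr ⟨i, hp⟩
    · push Not at h
      exact .inl ⟨F.nodes_eq ▸ hψ j, h⟩
  let T : RootedForest (Option (Fin n)) :=
    { nodes := Set.univ
      finite_nodes := Set.finite_univ
      arc := arc
      arc_mem := fun _ _ _ => ⟨trivial, trivial⟩
      parent_unique := by
        intro p q x hp hq
        obtain ⟨j, rfl, h1, h2⟩ := harc hp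
        obtain ⟨j', hj', k1, k2⟩ := harc hq
        cases hj'
        rcases p with _ | i <;> rcases q with _ | i'
        · rfl
        · exact absurd (k2 i' rfl) ((h1 rfl).2 _)
        · exact absurd (h2 i rfl) ((k1 rfl).2 _)
        · exact congrArg some (hinj (F.parent_unique _ _ _ (h2 i rfl) (k2 i' rfl)))
      acyclic := by
        have key : ∀ a b, Relation.TransGen arc a b → ∃ j, b = some j ∧
            ∀ i, a = some i → Relation.TransGen F.arc (ψ i) (ψ j) := by
          intro a b hab
          induction hab with
          | single hab =>
            obtain ⟨j, rfl, -, h2⟩ := harc hab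
            exact ⟨j, rfl, fun i hi => .single (h2 i hi)⟩
          | tail _ hbc ih =>
            obtain ⟨j, rfl, h⟩ := ih
            obtain ⟨j', rfl, -, h2⟩ := harc hbc
            exact ⟨j', rfl, fun i hi => (h i hi).tail (h2 j rfl)⟩
        intro x hx
        obtain ⟨j, rfl, h⟩ := key x x hx
        exact F.acyclic _ (h j rfl) }
  let bag : Option (Fin n) → Set α := fun x => x.elim ∅ fun i => F.bag (ψ i)
  have hadj : ∀ v w, H.Adj v w → F.le v w ∨ F.le w v := fun v w h =>
    (F.comparable v w h).imp .inr .inr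
  refine ⟨Option (Fin n), ⟨T, ?_, bag, ?_, ?_, ?_⟩, ?_⟩
  · refine ⟨none, ⟨trivial, ?_⟩, ?_⟩
    · intro p hp
      obtain ⟨j, hj, -⟩ := harc hp
      cases hj
    · rintro (_ | j) hj
      · rfl
      · rcases hroot j with h | ⟨i, hi⟩
        · exact absurd (show T.arc none (some j) from h) (hj.2 none)
        · exact absurd (show T.arc (some i) (some j) from hi) (hj.2 (some i))
  · rintro (_ | i) -
    · exact Set.empty_subset _
    · exact F.bag_subset (hψ i)
  · intro d hd
    obtain ⟨m, hm, hmax⟩ := exists_isGreatest_of_chain ho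
      (hH.finite.subset hd.subset_vertexSet) (hH.edge_nonempty d hd)
      fun a ha b hb => hadj a b ⟨d, hd, ha, hb⟩
    have hmV := H.mem_vertexSet_of_mem_edgeSet hd hm
    obtain ⟨i, hi⟩ := hsurj m hmV
    refine ⟨some i, trivial, ?_⟩
    change d ⊆ F.bag (ψ i)
    rw [hi, F.bag_eq hmV]
    exact fun v hv => .inr ⟨hmax v hv, m, F.le_refl m, d, hd, hv, hm⟩
  · intro v hv
    obtain ⟨i₀, hi₀⟩ := hsurj v hv
    have hmem₀ : v ∈ bag (some i₀) := .inl hi₀.symm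
    rw [SimpleGraph.connected_iff_exists_forall_reachable]
    refine ⟨⟨some i₀, trivial, hmem₀⟩, ?_⟩
    suffices ∀ u, Relation.ReflTransGen F.arc v u → ∀ i, ψ i = u → ∀ hi : v ∈ bag (some i),
        (T.graph.induce {x | x ∈ T.nodes ∧ v ∈ bag x}).Reachable ⟨some i₀, trivial, hmem₀⟩
          ⟨some i, trivial, hi⟩ by
      rintro ⟨_ | i, hx, hxv⟩
      · exact hxv.elim
      · exact this _ (F.reflTransGen_of_le (F.le_of_mem_bag hxv)) i rfl hxv
    intro u hu
    induction hu with
    | refl =>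
      intro i hi hvi
      cases hinj (hi.trans hi₀.symm)
      exact .refl _
    | @tail p u hvp hpu ih =>
      intro i hi hvi
      have hpV : p ∈ V(H) := F.nodes_eq ▸ (F.arc_mem _ _ hpu).1
      obtain ⟨j, hj⟩ := hsurj p hpV
      have hvp' : F.le v p := by
        rcases hvp.cases_head with h | ⟨c, h, -⟩
        · exact .inl h
        · exact .inr ⟨(F.arc_mem _ _ h).1, hvp⟩
      have hvj : v ∈ bag (some j) := by
        change v ∈ F.bag (ψ j)
        rw [hj, F.bag_eq hpV]
        rcases hvi with h | ⟨-, w, huw, hvw⟩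
        · rw [hi] at h
          have := ho.antisymm (h ▸ hvp') (F.le_of_arc hpu)
          exact absurd (this ▸ hpu) (F.not_arc_self p)
        · refine .inr ⟨hvp', w, ho.trans (F.le_of_arc hpu) (.inr (hi ▸ huw)), hvw⟩
      refine (ih j hj hvj).trans (SimpleGraph.Adj.reachable ?_)
      have hji : F.arc (ψ j) (ψ i) := by rw [hj, hi]; exact hpu
      refine ⟨fun h => ?_, .inl hji⟩
      cases h
      exact F.not_arc_self _ hji
  · rintro (_ | i) -
    · exact .inl rfl
    · exact .inr ⟨ψ i, hψ i, rfl⟩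

end EliminationForest

/-! ### Values of manageable width functions -/

namespace WidthFunction

variable {f : WidthFunction.{u}}

theorem IsManageable.isAdditive (hf : f.IsManageable) {α : Type u} {H : Hypergraph α}
    (hH : H.IsProper) : IsAdditive V(H) H.Adj (f H) :=
  hf.weaklyAdditive H hH

/-- The values of `f` at sets of size at most `b`. -/
def values (f : WidthFunction.{u}) (b : ℕ) : Set ℝ≥0 :=
  {y | ∃ (α : Type u) (H : Hypergraph α), H.IsProper ∧ ∃ S ⊆ V(H), S.ncard ≤ b ∧ y = f H S}

theorem isomorphic_induce {α β : Type u} {H₁ : Hypergraph α} {H₂ : Hypergraph β} {S₁ : Set α}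
    {S₂ : Set β} [Nonempty β] {N : Set ℕ} {φ₁ : α → ℕ} {φ₂ : β → ℕ} (h₁ : Set.BijOn φ₁ S₁ N)
    (h₂ : Set.BijOn φ₂ S₂ N)
    (hE : Set.image φ₁ '' E(H₁.induce S₁) = Set.image φ₂ '' E(H₂.induce S₂)) :
    (H₁.induce S₁).Isomorphic (H₂.induce S₂) := by
  have hinv := h₂.invOn_invFunOn
  refine ⟨Function.invFunOn φ₂ S₂ ∘ φ₁,
    (hinv.symm.bijOn h₂.surjOn.mapsTo_invFunOn h₂.mapsTo).comp h₁, ?_⟩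
  have hcomp : Set.image (Function.invFunOn φ₂ S₂ ∘ φ₁) =
      Set.image (Function.invFunOn φ₂ S₂) ∘ Set.image φ₁ := by
    funext e
    exact Set.image_comp _ _ e
  rw [hcomp, Set.image_comp, hE, ← Set.image_comp]
  have key : ∀ e ∈ E(H₂.induce S₂),
      (Set.image (Function.invFunOn φ₂ S₂) ∘ Set.image φ₂) e = e := by
    intro e he
    have heS : e ⊆ S₂ := (H₂.induce S₂).subset_vertexSet_of_mem_edgeSet he
    rw [Function.comp_apply, ← Set.image_comp]
    refine (Set.image_congr fun x hx => ?_).trans (Set.image_id e)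
    exact hinv.1 (heS hx)
  exact (Set.image_congr key).trans (Set.image_id' _)

/-- A set of size `n` with its induced hypergraph can be copied onto `{0, …, n - 1}`. By invariance
the copied edge set determines the value, and for `n ≤ b` there are finitely many such edge sets. -/
theorem IsManageable.finite_values (hf : f.IsManageable) (b : ℕ) : (f.values b).Finite := by
  let code : ℕ → Set (Set ℕ) → Set ℝ≥0 := fun n C =>
    {y | ∃ (α : Type u) (H : Hypergraph α), H.IsProper ∧ ∃ S ⊆ V(H), ∃ φ : α → ℕ,
      Set.BijOn φ S (Set.Iio n) ∧ Set.image φ '' E(H.induce S) = C ∧ y = f H S}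
  have hcode : ∀ n C, (code n C).Subsingleton := by
    rintro n C y₁ ⟨α, H₁, hH₁, S₁, hS₁, φ₁, h₁, hE₁, rfl⟩ y₂ ⟨β, H₂, hH₂, S₂, hS₂, φ₂, h₂, hE₂, rfl⟩
    cases isEmpty_or_nonempty β with
    | inl h =>
      have hS₂' : S₂ = ∅ := Set.eq_empty_of_isEmpty _
      have hS₁' : S₁ = ∅ := by
        refine Set.eq_empty_of_forall_notMem fun x hx => ?_
        obtain ⟨y, -⟩ := h₂.surjOn (h₁.mapsTo hx)
        exact h.elim y
      rw [hS₁', hS₂', (hf.isAdditive hH₁).empty, (hf.isAdditive hH₂).empty]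
    | inr h =>
      exact hf.invariantlyLocal H₁ H₂ hH₁ hH₂ S₁ S₂ hS₁ hS₂
        (isomorphic_induce h₁ h₂ (hE₁.trans hE₂.symm))
  have hsub : f.values b ⊆ ⋃ n ∈ Set.Iic b, ⋃ C ∈ 𝒫 (𝒫 (Set.Iio n)), code n C := by
    rintro _ ⟨α, H, hH, S, hS, hb, rfl⟩
    have := (hH.finite.subset hS).to_subtype
    classical
    let e := Finite.equivFin S
    let φ : α → ℕ := fun x => if hx : x ∈ S then (e ⟨x, hx⟩ : ℕ) else 0
    have hφ : ∀ x (hx : x ∈ S), φ x = e ⟨x, hx⟩ := fun x hx => dif_pos hx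
    have hbij : Set.BijOn φ S (Set.Iio S.ncard) := by
      refine ⟨fun x hx => ?_, fun x hx y hy hxy => ?_, fun i hi => ?_⟩
      · rw [hφ x hx]
        exact (e _).2
      · rw [hφ x hx, hφ y hy] at hxy
        exact congrArg Subtype.val (e.injective (Fin.ext hxy))
      · refine ⟨(e.symm ⟨i, hi⟩).1, (e.symm ⟨i, hi⟩).2, ?_⟩
        rw [hφ _ (e.symm ⟨i, hi⟩).2]
        exact congrArg Fin.val (e.apply_symm_apply ⟨i, hi⟩)
    refine Set.mem_biUnion hb (Set.mem_biUnion (x := Set.image φ '' E(H.induce S)) ?_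
      ⟨α, H, hH, S, hS, φ, hbij, rfl, rfl⟩)
    rintro _ ⟨d, hd, rfl⟩
    exact (Set.image_mono ((H.induce S).subset_vertexSet_of_mem_edgeSet hd)).trans
      hbij.mapsTo.image_subset
  refine Set.Finite.subset ?_ hsub
  refine (Set.finite_Iic b).biUnion fun n _ => ?_
  exact ((Set.finite_Iio n).finite_subsets.finite_subsets).biUnion fun C _ =>
    (hcode n C).finite

end WidthFunction

/-! ### Neighbourhoods -/

namespace Hypergraph

variable {α : Type u} {H : Hypergraph α}

theorem Adj.mem_left {v w : α} (h : H.Adj v w) : v ∈ V(H) := by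
  obtain ⟨e, he, hv, -⟩ := h
  exact H.mem_vertexSet_of_mem_edgeSet he hv

theorem Adj.mem_right {v w : α} (h : H.Adj v w) : w ∈ V(H) := h.symm.mem_left

theorem IsProper.finite_edgeSet (hH : H.IsProper) : E(H).Finite :=
  hH.finite.finite_subsets.subset H.edgeSet_subset_powerset_vertexSet

theorem IsProper.ncard_setOf_adj_le (hH : H.IsProper) (v : α) :
    {w | H.Adj v w}.ncard ≤ H.maxDegree * H.rank := by
  by_cases hv : v ∈ V(H)
  · have hfin : {e | e ∈ E(H) ∧ v ∈ e}.Finite := hH.finite_edgeSet.subset fun _ h => h.1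
    have heq : {w | H.Adj v w} = ⋃ e ∈ hfin.toFinset, e := by
      ext w
      simp [Adj, and_assoc]
    have hdeg : hfin.toFinset.card ≤ H.maxDegree := by
      rw [← Set.ncard_eq_toFinset_card _ hfin]
      exact le_csSup (hH.finite.image _).bddAbove ⟨v, hv, rfl⟩
    rw [heq]
    refine (Finset.set_ncard_biUnion_le _ _).trans
      ((Finset.sum_le_card_nsmul _ _ H.rank ?_).trans ?_)
    · intro e he
      exact le_csSup (hH.finite_edgeSet.image _).bddAbove ⟨e, ((hfin.mem_toFinset).mp he).1, rfl⟩
    · rw [smul_eq_mul]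
      exact Nat.mul_le_mul_right _ hdeg
  · have : {w | H.Adj v w} = ∅ := Set.eq_empty_of_forall_notMem fun w hw => hv hw.mem_left
    simp [this]

theorem IsProper.ncard_setOf_exists_adj_le (hH : H.IsProper) {S : Set α} (hS : S ⊆ V(H)) :
    {w | ∃ v ∈ S, H.Adj v w}.ncard ≤ S.ncard * (H.maxDegree * H.rank) := by
  have hfin := hH.finite.subset hS
  have heq : {w | ∃ v ∈ S, H.Adj v w} = ⋃ v ∈ hfin.toFinset, {w | H.Adj v w} := by
    ext w
    simp
  rw [heq, Set.ncard_eq_toFinset_card _ hfin]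
  refine (Finset.set_ncard_biUnion_le _ _).trans ?_
  rw [← smul_eq_mul]
  exact Finset.sum_le_card_nsmul _ _ _ fun v _ => hH.ncard_setOf_adj_le v

theorem IsProper.closedNhd_bound (hH : H.IsProper) {K : Set α} (hK : K ⊆ V(H)) (n : ℕ) :
    closedNhd H.Adj K n ⊆ V(H) ∧
      (closedNhd H.Adj K n).ncard ≤ K.ncard * (1 + H.maxDegree * H.rank) ^ n := by
  induction n with
  | zero => simpa [closedNhd] using hK
  | succ n ih =>
    obtain ⟨h1, h2⟩ := ih
    refine ⟨Set.union_subset h1 ?_, ?_⟩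
    · rintro v ⟨u, -, huv⟩
      exact huv.mem_right
    · refine (Set.ncard_union_le _ _).trans ?_
      calc _ ≤ (closedNhd H.Adj K n).ncard +
            (closedNhd H.Adj K n).ncard * (H.maxDegree * H.rank) :=
            Nat.add_le_add_left (hH.ncard_setOf_exists_adj_le h1) _
        _ = (closedNhd H.Adj K n).ncard * (1 + H.maxDegree * H.rank) := by ring
        _ ≤ _ := by
          rw [pow_succ, ← mul_assoc]
          exact Nat.mul_le_mul_right _ h2

end Hypergraph

namespace TreeDecomposition

variable {α : Type u} {H : Hypergraph α} {ι : Type v} {t : TreeDecomposition H ι}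

/-- Every edge leaving the component of `x` ends in the bag of `x`, so the cut lies in the bag and
its neighbours. -/
theorem cutSet_cmp_bound (hH : H.IsProper) {x : ι} (hx : x ∈ t.nodes) :
    cutSet H.Adj (t.cmp x) ⊆ V(H) ∧
      (cutSet H.Adj (t.cmp x)).ncard ≤ (t.tw + 1) * (1 + H.maxDegree * H.rank) := by
  have hsub : cutSet H.Adj (t.cmp x) ⊆ closedNhd H.Adj (t.bag x) 1 := by
    rintro v ⟨w, hvw, h⟩
    by_cases hv : v ∈ t.cmp x
    · have hw : w ∉ t.cmp x := fun hw => h (iff_of_true hv hw)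
      exact .inr ⟨w, (mem_bag_of_adj_cmp hx hv hw hvw).1, hvw.symm⟩
    · have hw : w ∈ t.cmp x := by_contra fun hw => h (iff_of_false hv hw)
      exact .inl (mem_bag_of_adj_cmp hx hw hv hvw.symm).1
  obtain ⟨h1, h2⟩ := hH.closedNhd_bound (t.bag_subset x hx) 1
  refine ⟨hsub.trans h1, (Set.ncard_le_ncard hsub (hH.finite.subset h1)).trans (h2.trans ?_)⟩
  rw [pow_one]
  exact Nat.mul_le_mul_right _ (ncard_bag_le hx)

end TreeDecomposition

/-! ### Optimal elimination forests -/

namespace EliminationForest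

variable {α : Type u} {H : Hypergraph α} {f : WidthFunction.{u}}

theorem fWidth_le {F : EliminationForest H} {k : ℝ≥0} (h : ∀ u ∈ V(H), f H (F.bag u) ≤ k) :
    F.fWidth f ≤ k := by
  refine csSup_le' ?_
  rintro _ ⟨u, hu, rfl⟩
  exact h u (F.nodes_eq ▸ hu)

theorem le_fWidth (F : EliminationForest H) {u : α} (hu : u ∈ V(H)) :
    f H (F.bag u) ≤ F.fWidth f :=
  le_csSup (F.finite_nodes.image _).bddAbove ⟨u, F.nodes_eq ▸ hu, rfl⟩

/-- The minimal `f`-width of an elimination forest is attained. -/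
theorem exists_optimal (f : WidthFunction.{u}) (hH : H.IsProper) (F₀ : EliminationForest H) :
    ∃ F : EliminationForest H, ∀ F' : EliminationForest H, F.fWidth f ≤ F'.fWidth f := by
  let W : Set ℝ≥0 := Set.range fun F : EliminationForest H => F.fWidth f
  have hW : W.Finite := by
    refine ((hH.finite.finite_subsets.image (f H)).insert 0).subset ?_
    rintro _ ⟨F, rfl⟩
    rcases V(H).eq_empty_or_nonempty with h | h
    · left
      change sSup _ = _
      rw [F.nodes_eq, h, Set.image_empty, csSup_empty, bot_eq_zero]
    · right
      obtain ⟨u, hu, h⟩ :=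
        ((F.nodes_eq ▸ h : F.nodes.Nonempty).image fun u => f H (F.bag u)).csSup_mem
        (F.finite_nodes.image _)
      exact ⟨F.bag u, F.bag_subset (F.nodes_eq ▸ hu), h⟩
  obtain ⟨_, ⟨F, rfl⟩, hF⟩ := Set.exists_min_image W id hW ⟨_, F₀, rfl⟩
  exact ⟨F, fun F' => hF _ ⟨F', rfl⟩⟩

/-- Intersecting the ancestor relation with connectedness confines each bag to the component of its
vertex. By additivity the discarded part of the bag has no edge to the rest and a non-negative
value, so the width does not grow. -/
theorem exists_isGood (hf : f.IsManageable) (hH : H.IsProper) (F : EliminationForest H) :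
    ∃ r, IsGood V(H) H.Adj (f H) (F.fWidth f) r := by
  have ho : IsTreeOrder V(H) F.le := F.nodes_eq ▸ F.isTreeOrder_le
  have hsymm : ∀ {a b}, Relation.ReflTransGen H.Adj a b → Relation.ReflTransGen H.Adj b a :=
    fun h => Relation.ReflTransGen.mono (fun _ _ h => h.symm) _ _ h.swap
  refine ⟨fun a b => F.le a b ∧ Relation.ReflTransGen H.Adj a b, ⟨fun a => ⟨ho.refl a, .refl⟩,
    fun h h' => ⟨ho.trans h.1 h'.1, h.2.trans h'.2⟩, fun h h' => ho.antisymm h.1 h'.1, ?_,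
    fun h => ho.supp h.1⟩, ?_, ?_, fun a b h => h.2⟩
  · intro a b c h h'
    exact (ho.chain h.1 h'.1).imp (fun k => ⟨k, h.2.trans (hsymm h'.2)⟩)
      fun k => ⟨k, h'.2.trans (hsymm h.2)⟩
  · intro a b h
    exact (F.comparable a b h).imp (fun k => ⟨.inr k, .single h⟩)
      fun k => ⟨.inr k, .single h.symm⟩
  · intro u hu
    let C : Set α := {v | Relation.ReflTransGen H.Adj v u}
    have heq : orderBag H.Adj (fun a b => F.le a b ∧ Relation.ReflTransGen H.Adj a b) u =
        F.bag u ∩ C := by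
      rw [F.bag_eq hu]
      ext v
      constructor
      · rintro (rfl | ⟨h, w, hw, hvw⟩)
        · exact ⟨.inl rfl, .refl⟩
        · exact ⟨.inr ⟨h.1, w, hw.1, hvw⟩, h.2⟩
      · rintro ⟨rfl | ⟨h, w, hw, hvw⟩, hC⟩
        · exact .inl rfl
        · exact .inr ⟨⟨h, hC⟩, w, ⟨hw, (hsymm hC).tail hvw⟩, hvw⟩
    have hadd := hf.isAdditive hH (F.bag u ∩ C) (F.bag u \ C)
      (Set.inter_subset_left.trans (F.bag_subset hu)) (Set.sdiff_subset.trans (F.bag_subset hu))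
      (Set.disjoint_sdiff_right.mono_left Set.inter_subset_right)
      fun a ha b hb hab => hb.2 (ha.2.head hab.symm)
    rw [Set.inter_union_sdiff] at hadd
    rw [heq]
    exact (hadd ▸ le_self_add).trans (F.le_fWidth hu)

/-- Monotonicity serves only for the lower bound on tree decompositions: they yield elimination
forests whose bags are subsets of the given bags. -/
theorem fWidth_eq_of_isMonotone (hf : f.IsManageable) (hm : f.IsMonotone) (hH : H.IsProper)
    {F : EliminationForest H} (hF : ∀ F' : EliminationForest H, F.fWidth f ≤ F'.fWidth f) :
    F.fWidth f = H.fWidth f := by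
  obtain ⟨ι, t, ht⟩ := F.exists_treeDecomposition hH
  refine le_antisymm (le_csInf ⟨_, ι, t, rfl⟩ ?_) ?_
  · rintro _ ⟨ι', t', rfl⟩
    obtain ⟨F', hF'⟩ := t'.exists_eliminationForest hH.finite
    refine (hF F').trans (fWidth_le fun u hu => ?_)
    obtain ⟨x, hx, hsub⟩ := hF' u hu
    exact (hm H hH _ _ hsub (t'.bag_subset x hx)).trans
      (le_csSup (t'.finite_nodes.image _).bddAbove ⟨x, hx, rfl⟩)
  · have : H.fWidth f ≤ t.fWidth f := csInf_le (OrderBot.bddBelow _) ⟨ι, t, rfl⟩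
    refine this.trans (csSup_le' ?_)
    rintro _ ⟨x, hx, rfl⟩
    rcases ht x hx with h | ⟨u, hu, h⟩
    · simp only [h, (hf.isAdditive hH).empty, zero_le]
    · simp only [h]
      exact F.le_fWidth hu

end EliminationForest

/-- Without an edge to the bag of `x`, the component of a child is a union of connected components,
hence closed under descendants and well-formed. The other children contain distinct neighbours of
the bag of `x`. -/
theorem irregularity_le {α : Type u} {H : Hypergraph α} {ι : Type v} (hH : H.IsProper)
    (t : TreeDecomposition H ι) (F : EliminationForest H)
    (hF : ∀ a b, F.le a b → Relation.ReflTransGen H.Adj a b) {x : ι} (hx : x ∈ t.nodes) :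
    irregularity t F x ≤ (t.tw + 1) * (H.maxDegree * H.rank) := by
  have hbag := t.bag_subset x hx
  have key : ∀ y, t.arc x y ∧ ¬ F.WellFormed (t.cmp y) →
      ∃ v ∈ t.cmp y, ∃ w ∈ t.bag x, H.Adj w v := by
    rintro y ⟨hy, hwf⟩
    have hyn := (t.arc_mem _ _ hy).2
    by_contra! h
    refine hwf (F.wellFormed_of_closed fun a ha b hab => ?_)
    have := hF a b (.inr hab)
    clear hab
    induction this with
    | refl => exact ha
    | tail _ hcd ih =>
      by_contra hd
      exact h _ ih _ ((TreeDecomposition.mem_bag_of_adj_cmp hyn ih hd hcd).2 x hy) hcd.symm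
  choose g hg hg' using fun y : {y | t.arc x y ∧ ¬ F.WellFormed (t.cmp y)} => key y.1 y.2
  let N : Set α := {v | ∃ w ∈ t.bag x, H.Adj w v}
  have hN : N.Finite := hH.finite.subset fun v ⟨w, _, h⟩ => h.mem_right
  have := hN.to_subtype
  refine (Nat.card_le_card_of_injective (fun y => (⟨g y, hg' y⟩ : N)) ?_).trans
    ((hH.ncard_setOf_exists_adj_le hbag).trans
      (Nat.mul_le_mul_right _ (TreeDecomposition.ncard_bag_le hx)))
  intro y y' h
  have h' : g y = g y' := congrArg Subtype.val h
  exact Subtype.ext (TreeDecomposition.disjoint_cmp_of_arc y.2.1 y'.2.1 (hg y) (h' ▸ hg y'))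

/-- The bound on the split. -/
def splitBound (f : WidthFunction.{u}) (β : ℝ≥0 → ℕ → ℕ) (w r d : ℕ) : ℕ :=
  -- The forest obtained from `t` has bags of size at most `w + 1`, so the supremum bounds the
  -- optimal width and `s` the bag sizes of optimal forests. In `M`, the factor `(w + 1) * (1 + d *
  -- r)` bounds the cut and the power bounds the growth over `s + 2` steps.
  let s := β (sSup (f.values (w + 1))) r
  let M := (w + 1) * (1 + d * r) * (1 + d * r) ^ (s + 2)
  3 * (M + 2 * (f.values s).ncard * 2 ^ M) + 2

theorem exists_eliminationForest_split_le {f : WidthFunction.{u}} (hf : f.IsManageable)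
    {β : ℝ≥0 → ℕ → ℕ} (hβ : ∀ (k : ℝ≥0) ⦃α : Type u⦄ (H : Hypergraph α), H.IsProper →
      ∀ U : Set α, U ⊆ V(H) → f H U ≤ k → U.ncard ≤ β k H.rank)
    {α : Type u} {H : Hypergraph α} (hH : H.IsProper) {ι : Type v} (t : TreeDecomposition H ι) :
    ∃ F : EliminationForest H, (∀ F' : EliminationForest H, F.fWidth f ≤ F'.fWidth f) ∧
      (∀ a b, F.le a b → Relation.ReflTransGen H.Adj a b) ∧
      split t F ≤ splitBound f β t.tw H.rank H.maxDegree := by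
  obtain ⟨F₀, hF₀⟩ := t.exists_eliminationForest hH.finite
  obtain ⟨F₁, hF₁⟩ := EliminationForest.exists_optimal f hH F₀
  have hk : F₁.fWidth f ≤ sSup (f.values (t.tw + 1)) := by
    refine (hF₁ F₀).trans (EliminationForest.fWidth_le fun u hu => ?_)
    obtain ⟨x, hx, hsub⟩ := hF₀ u hu
    refine le_csSup (hf.finite_values _).bddAbove
      ⟨α, H, hH, _, F₀.bag_subset hu, ?_, rfl⟩
    exact (Set.ncard_le_ncard hsub (hH.finite.subset (t.bag_subset x hx))).trans
      (TreeDecomposition.ncard_bag_le hx)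
  set s := β (sSup (f.values (t.tw + 1))) H.rank with hs
  have hTS : t.TS.Finite := t.finite_nodes.image _
  obtain ⟨r, hr, hcls⟩ := exists_isGood_of_laminar (s := s) (𝒱 := f.values s)
    (M := (t.tw + 1) * (1 + H.maxDegree * H.rank) * (1 + H.maxDegree * H.rank) ^ (s + 2))
    hH.finite (hf.isAdditive hH)
    (fun _ _ h => h.symm) (fun S hS h => hβ _ H hH S hS (h.trans hk)) (hf.finite_values s)
    (fun S hS h => ⟨α, H, hH, S, hS, h, rfl⟩) (F₁.exists_isGood hf hH) hTS.toFinset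
    (by
      intro U hU
      obtain ⟨x, hx, rfl⟩ := hTS.mem_toFinset.mp hU
      exact TreeDecomposition.cmp_subset hx)
    (by
      intro U hU U' hU'
      obtain ⟨x, hx, rfl⟩ := hTS.mem_toFinset.mp hU
      obtain ⟨y, hy, rfl⟩ := hTS.mem_toFinset.mp hU'
      exact TreeDecomposition.cmp_laminar hx hy)
    (by
      intro U hU
      obtain ⟨x, hx, rfl⟩ := hTS.mem_toFinset.mp hU
      obtain ⟨h1, h2⟩ := TreeDecomposition.cutSet_cmp_bound hH hx
      obtain ⟨h3, h4⟩ := hH.closedNhd_bound h1 (s + 2)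
      exact ⟨h3, h4.trans (Nat.mul_le_mul_right _ h2)⟩)
  let F := EliminationForest.ofOrder hH.finite hr.order hr.elim
  have hle : F.le = r := RootedForest.le_ofOrder hH.finite hr.order
  refine ⟨F, fun F' => (EliminationForest.fWidth_le fun u hu => ?_).trans (hF₁ F'), ?_, ?_⟩
  · rw [F.bag_eq hu, hle]
    exact hr.width u hu
  · rw [hle]
    exact hr.conn
  · refine csSup_le' ?_
    rintro _ ⟨U, hU, rfl⟩
    have hUV : U ⊆ V(H) := by
      obtain ⟨x, hx, rfl⟩ := hU
      exact TreeDecomposition.cmp_subset hx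
    refine (F.ncard_MF_le hUV).trans ?_
    rw [hle]
    exact hcls U (hTS.mem_toFinset.mpr hU)

end

/-- **Reduced Hypergraph Dealternation Lemma.** -/
theorem mainTheorem3 (f : WidthFunction.{u}) (hf : f.IsManageable) :
    ∃ γ : ℕ × ℝ≥0 × ℕ × ℕ → ℕ, Monotone γ ∧
      ∀ (α : Type u) (H : Hypergraph α), H.IsProper →
        ∀ (ι : Type v) (t : TreeDecomposition H ι),
          ∃ F : EliminationForest H,
            (∀ F' : EliminationForest H, F.fWidth f ≤ F'.fWidth f) ∧
            (f.IsMonotone → F.fWidth f = H.fWidth f) ∧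
            split t F ≤ γ (t.tw, H.fWidth f, H.rank, H.maxDegree) ∧
            mir t F ≤ γ (t.tw, H.fWidth f, H.rank, H.maxDegree) := by
  obtain ⟨β, hβ⟩ := hf.boundedSize
  let G : ℕ → ℕ → ℕ → ℕ := fun w r d => splitBound f β w r d + (w + 1) * (d * r)
  -- Summing `G` over all smaller arguments makes the bound monotone, whatever the behaviour of `β`.
  let γ : ℕ × ℝ≥0 × ℕ × ℕ → ℕ := fun p => ∑ i ∈ Finset.range (p.1 + 1),
    ∑ j ∈ Finset.range (p.2.2.1 + 1), ∑ l ∈ Finset.range (p.2.2.2 + 1), G i j l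
  have hG : ∀ p, G p.1 p.2.2.1 p.2.2.2 ≤ γ p := by
    intro p
    refine le_trans ?_ (Finset.single_le_sum (fun _ _ => Nat.zero_le _)
      (Finset.self_mem_range_succ p.1))
    refine le_trans ?_ (Finset.single_le_sum (fun _ _ => Nat.zero_le _)
      (Finset.self_mem_range_succ p.2.2.1))
    exact Finset.single_le_sum (f := fun l => G p.1 p.2.2.1 l) (fun _ _ => Nat.zero_le _)
      (Finset.self_mem_range_succ p.2.2.2)
  refine ⟨γ, ?_, fun α H hH ι t => ?_⟩
  · intro p q hpq
    have hr : ∀ {a b : ℕ}, a ≤ b → Finset.range (a + 1) ⊆ Finset.range (b + 1) := fun h =>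
      Finset.range_subset_range.mpr (Nat.succ_le_succ h)
    refine (Finset.sum_le_sum fun i _ => ?_).trans (Finset.sum_le_sum_of_subset (hr hpq.1))
    refine (Finset.sum_le_sum fun j _ => ?_).trans (Finset.sum_le_sum_of_subset (hr hpq.2.2.1))
    exact Finset.sum_le_sum_of_subset (hr hpq.2.2.2)
  · obtain ⟨F, hF, hconn, hsplit⟩ := exists_eliminationForest_split_le hf hβ hH t
    have hγ := hG (t.tw, H.fWidth f, H.rank, H.maxDegree)
    refine ⟨F, hF, fun hm => EliminationForest.fWidth_eq_of_isMonotone hf hm hH hF,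
      (hsplit.trans (Nat.le_add_right _ _)).trans hγ, (csSup_le' ?_).trans
        ((Nat.le_add_left _ _).trans hγ)⟩
    rintro _ ⟨x, hx, rfl⟩
    exact irregularity_le hH t F hconn hx
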